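/- All vector spaces are over $\mathbb C$. For a vector space $W$, write a series $a(x)\in\mathrm{Hom}(W,W((x)))$ as $a(x)=\sum_{n\in\mathbb Z}a_nx^{-n-1}$ with $a_n\in\mathrm{End}\,W$. **Definitions.** A *vertex algebra* is a vector space $V$ with a vector $\mathbf 1$ and a linear map $Y(\cdot,x):V\to\mathrm{Hom}(V,V((x)))$ such that $Y(\mathbf 1,x)=1$, $Y(v,x)\mathbf 1\in V[[x]]$ has constant term $v$, and the Jacobi identity holds. A *quasimodule* for it is a vector space $W$ with a linear map $Y_W(\cdot,x):V\to\mathrm{Hom}(W,W((x)))$ such that $Y_W(\mathbf 1,x)=1$ and, for all $u,v\in V$, there is a nonzero polynomial $p(x_1,x_2)$ with $$x_0^{-1}\delta\!\left(\tfrac{x_1-x_2}{x_0}\right)p(x_1,x_2)Y_W(u,x_1)Y_W(v,x_2)-x_0^{-1}\delta\!\left(\tfrac{x_2-x_1}{-x_0}\right)p(x_1,x_2)Y_W(v,x_2)Y_W(u,x_1)=x_2^{-1}\delta\!\left(\tfrac{x_1-x_0}{x_2}\right)p(x_1,x_2)Y_W(Y(u,x_0)v,x_2).$$ For a group $\Gamma$,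 a *$\Gamma$-vertex algebra* is a vertex algebra $V$ with homomorphisms $R:\Gamma\to GL(V)$ and $\phi:\Gamma\to\mathbb C^\times$ such that $R_g\mathbf 1=\mathbf 1$ and $R_gY(v,x)R_g^{-1}=Y(R_gv,\phi(g)^{-1}x)$. A *quasimodule* for a $\Gamma$-vertex algebra $V$ is a quasimodule $(W,Y_W)$ for the vertex algebra $V$ such that $Y_W(R_gv,x)=Y_W(v,\phi(g)x)$ for $g\in\Gamma$, $v\in V$, and for all $u,v\in V$ there are $\alpha_1,\dots,\alpha_k\in\phi(\Gamma)$ with $(x_1-\alpha_1x_2)\cdots(x_1-\alpha_kx_2)[Y_W(u,x_1),Y_W(v,x_2)]=0$. **Setting.** Let $\mathfrak g$ be a Lie algebra with a symmetric invariant bilinear form $\langle\cdot,\cdot\rangle$, let $\Gamma$ be a subgroup of $\mathrm{Aut}(\mathfrak g,\langle\cdot,\cdot\rangle)$ such that for all $a,b\in\mathfrak g$ one has $[ga,b]=0$ and $\langle ga,b\rangle=0$ for all but finitely many $g\in\Gamma$, let $\phi:\Gamma\to\mathbb C^\times$ be a group homomorphism, $H=\ker\phi$, and $\ell\in\mathbb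 C$. * $\hat{\mathfrak g}[\Gamma]$ is the Lie algebra obtained from $\mathfrak g\otimes\mathbb C[t,t^{-1}]\oplus\mathbb C\mathbf k$ with the multiplication $$[a\otimes t^m+\alpha\mathbf k,\,b\otimes t^n+\beta\mathbf k]_\Gamma=\sum_{g\in\Gamma}\phi(g)^m\big([ga,b]\otimes t^{m+n}+m\langle ga,b\rangle\delta_{m+n,0}\mathbf k\big)$$ by factoring out the span of the elements $\phi(g)^m(ga\otimes t^m)-a\otimes t^m$ ($g\in\Gamma$, $a\in\mathfrak g$, $m\in\mathbb Z$). For an $\hat{\mathfrak g}[\Gamma]$-module $W$ and $a\in\mathfrak g$, let $a_W(x)=\sum_n a(n)x^{-n-1}$, where $a(n)$ is the action on $W$ of the image of $a\otimes t^n$. The module is *restricted* if $a_W(x)\in\mathrm{Hom}(W,W((x)))$ for all $a\in\mathfrak g$, and of *level* $\ell$ if $\mathbf k$ acts as the scalar $\ell$. * $\mathfrak g/H$ is the quotient of $\mathfrak g$ by the span of the elements $ha-a$ ($h\in H$, $a\in\mathfrak g$), with the bracket $[\bar a,\bar b]=\sum_{h\in H}\overline{[ha,b]}$ and the symmetric invariant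 form $\langle\bar a,\bar b\rangle_H=\sum_{h\in H}\langle ha,b\rangle$, where $\bar a$ is the image of $a$. The group $\Gamma$ acts on it by $g\bar a=\overline{ga}$. * $V=V_{\widehat{\mathfrak g/H}}(\ell,0)$ is the module for the affine Lie algebra $\widehat{\mathfrak g/H}=(\mathfrak g/H)\otimes\mathbb C[t,t^{-1}]\oplus\mathbb C\mathbf k$ induced from the one-dimensional module of $(\mathfrak g/H)\otimes\mathbb C[t]\oplus\mathbb C\mathbf k$ on which $(\mathfrak g/H)\otimes\mathbb C[t]$ acts as $0$ and $\mathbf k$ acts as $\ell$; $\mathbf 1=1\otimes1$, and $\bar a\in\mathfrak g/H$ is regarded as the vector $\bar a(-1)\mathbf 1$ of $V$. For $g\in\Gamma$ put $R_g=\phi(g)^{-L(0)}g$ on $V$, where $L(0)$ is the grading operator (the vector $u_1(-n_1)\cdots u_r(-n_r)\mathbf 1$ has degree $n_1+\cdots+n_r$) and $g$ acts by $u_1(n_1)\cdots u_r(n_r)\mathbf 1\mapsto(gu_1)(n_1)\cdots(gu_r)(n_r)\mathbf 1$. **Theorem.** There is a unique vertex algebra structure on $V$ with vacuum vector $\mathbf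 1$ and $Y(u,x)=\sum_{n}u(n)x^{-n-1}$ for $u\in\mathfrak g/H$, and with $R$ and $\phi$ it is a $\Gamma$-vertex algebra. Moreover, for every vector space $W$: 1. For every restricted $\hat{\mathfrak g}[\Gamma]$-module structure of level $\ell$ on $W$ there is a unique map $Y_W$ making $W$ a quasimodule for $V$ viewed as a $\Gamma$-vertex algebra such that $Y_W(\bar a,x)=a_W(x)$ for all $a\in\mathfrak g$. 2. For every quasimodule structure $Y_W$ on $W$ for $V$ viewed as a $\Gamma$-vertex algebra there is a unique structure of a restricted $\hat{\mathfrak g}[\Gamma]$-module of level $\ell$ on $W$ such that $a_W(x)=Y_W(\bar a,x)$ for all $a\in\mathfrak g$. -/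

import Mathlib

open scoped TensorProduct
open VertexOperator

attribute [local instance 100] LieRing.ofAssociativeRing

noncomputable section

/-! ## Lie algebras with a group action: the coinvariant Lie algebra `K / G` -/

/-- A symmetric invariant bilinear form on a complex Lie algebra. -/
structure InvForm (K : Type*) [LieRing K] [LieAlgebra ℂ K] where
  form : K →ₗ[ℂ] K →ₗ[ℂ] ℂ
  symm : ∀ u v, form u v = form v u
  invariant : ∀ u v w : K, form ⁅u, v⁆ w = form u ⁅v, w⁆

/-- `Aut(K, ⟨·,·⟩)`: the group of linear automorphisms of `K` which are automorphisms of the Lie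
algebra and preserve the form. -/
def InvForm.aut {K : Type*} [LieRing K] [LieAlgebra ℂ K] (F : InvForm K) :
    Subgroup (K ≃ₗ[ℂ] K) where
  carrier := {σ | (∀ u v : K, σ ⁅u, v⁆ = ⁅σ u, σ v⁆) ∧ ∀ u v, F.form (σ u) (σ v) = F.form u v}
  mul_mem' := by
    rintro σ τ ⟨h1, h2⟩ ⟨h3, h4⟩
    exact ⟨fun u v => by simp [h1, h3], fun u v => by simp [h2, h4]⟩
  one_mem' := ⟨fun _ _ => rfl, fun _ _ => rfl⟩
  inv_mem' := by
    rintro σ ⟨h1, h2⟩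
    refine ⟨fun u v => ?_, fun u v => ?_⟩
    · apply σ.injective
      rw [h1]
      simp only [← LinearEquiv.mul_apply, mul_inv_cancel, LinearEquiv.coe_one, id_eq]
    · rw [← h2]
      simp only [← LinearEquiv.mul_apply, mul_inv_cancel, LinearEquiv.coe_one, id_eq]

/-- An action of a group `G` on a Lie algebra `K` by automorphisms such that for all `u, v`,
`[g u, v] = 0` for all but finitely many `g`. -/
structure LieAct (G K : Type*) [Group G] [LieRing K] [LieAlgebra ℂ K] where
  ρ : Representation ℂ G K
  map_lie : ∀ (g : G) (u v : K), ρ g ⁅u, v⁆ = ⁅ρ g u, ρ g v⁆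
  finite_lie : ∀ u v : K, {g : G | ⁅ρ g u, v⁆ ≠ 0}.Finite

/-- An action as in `LieAct` which preserves a symmetric invariant form and such that for all
`u, v`, `⟨g u, v⟩ = 0` for all but finitely many `g`. -/
structure FormAct (G : Type*) {K : Type*} [Group G] [LieRing K] [LieAlgebra ℂ K]
    (F : InvForm K) extends LieAct G K where
  map_form : ∀ (g : G) (u v : K), F.form (ρ g u) (ρ g v) = F.form u v
  finite_form : ∀ u v : K, {g : G | F.form (ρ g u) v ≠ 0}.Finite

namespace LieAct

variable {G K : Type*} [Group G] [LieRing K] [LieAlgebra ℂ K] (A : LieAct G K)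

/-- The new multiplication `[u, v]_G = ∑_{g ∈ G} [g u, v]` (a finite sum). -/
def bracket : K →ₗ[ℂ] K →ₗ[ℂ] K :=
  LinearMap.mk₂ ℂ (fun u v => ∑ᶠ g : G, ⁅A.ρ g u, v⁆)
    (fun u u' v => by
      simp only [map_add, add_lie]
      exact finsum_add_distrib (A.finite_lie u v) (A.finite_lie u' v))
    (fun c u v => by
      simp only [map_smul, smul_lie]
      exact (smul_finsum c _).symm)
    (fun u v v' => by
      simp only [lie_add]
      exact finsum_add_distrib (A.finite_lie u v) (A.finite_lie u v'))
    (fun c u v => by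
      simp only [lie_smul]
      exact (smul_finsum c _).symm)

theorem bracket_apply (u v : K) : A.bracket u v = ∑ᶠ g : G, ⁅A.ρ g u, v⁆ := rfl

/-- The subspace spanned by the vectors `g u - u`. -/
def coinvKer : Submodule ℂ K := Submodule.span ℂ {x | ∃ (g : G) (u : K), x = A.ρ g u - u}

theorem sub_mem_coinvKer (g : G) (u : K) : A.ρ g u - u ∈ A.coinvKer :=
  Submodule.subset_span ⟨g, u, rfl⟩

theorem bracket_act_left (g : G) (u v : K) : A.bracket (A.ρ g u) v = A.bracket u v := by
  rw [bracket_apply, bracket_apply]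
  have := finsum_comp_equiv (Equiv.mulRight g) (f := fun h : G => ⁅A.ρ h u, v⁆)
  rw [← this]
  refine finsum_congr fun h => ?_
  simp [map_mul]

theorem bracket_left_mem {u : K} (hu : u ∈ A.coinvKer) (v : K) : A.bracket u v = 0 := by
  induction hu using Submodule.span_induction with
  | mem x hx => obtain ⟨g, u, rfl⟩ := hx; simp [bracket_act_left]
  | zero => simp
  | add x y _ _ hx hy => simp [hx, hy]
  | smul c x _ hx => simp [hx]

theorem act_inv_apply (g : G) (u : K) : A.ρ g (A.ρ g⁻¹ u) = u := by
  rw [← Module.End.mul_apply, ← map_mul]; simp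

theorem bracket_add_swap_mem (u v : K) : A.bracket u v + A.bracket v u ∈ A.coinvKer := by
  have h1 : A.bracket v u = ∑ᶠ g : G, -A.ρ g⁻¹ ⁅A.ρ g u, v⁆ := by
    rw [bracket_apply, ← finsum_comp_equiv (Equiv.inv G)]
    refine finsum_congr fun g => ?_
    rw [A.map_lie, ← Module.End.mul_apply, ← map_mul, ← lie_skew]; simp
  have hfin : (Function.support fun g : G => -A.ρ g⁻¹ ⁅A.ρ g u, v⁆).Finite := by
    refine (A.finite_lie u v).subset fun g hg => ?_
    simp only [Function.mem_support, ne_eq, neg_eq_zero, Set.mem_ofPred_eq] at hg ⊢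
    exact fun h => hg (by rw [h, map_zero])
  rw [h1, bracket_apply, ← finsum_add_distrib (A.finite_lie u v) hfin]
  refine finsum_induction (· ∈ A.coinvKer) A.coinvKer.zero_mem (fun _ _ => A.coinvKer.add_mem) fun g => ?_
  have := A.coinvKer.neg_mem (A.sub_mem_coinvKer g⁻¹ ⁅A.ρ g u, v⁆)
  rwa [neg_sub, sub_eq_add_neg] at this

theorem bracket_right_mem (u : K) {v : K} (hv : v ∈ A.coinvKer) : A.bracket u v ∈ A.coinvKer := by
  have := A.bracket_add_swap_mem u v
  rwa [A.bracket_left_mem hv, add_zero] at this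

theorem finite_lie_lie (u v w : K) :
    (Function.support fun p : G × G => ⁅A.ρ p.1 u, ⁅A.ρ p.2 v, w⁆⁆).Finite := by
  refine ((A.finite_lie v w).biUnion fun h _ =>
    ((A.finite_lie u ⁅A.ρ h v, w⁆).prod (Set.finite_singleton h))).subset ?_
  rintro ⟨g, h⟩ hgh
  simp only [Function.mem_support] at hgh
  simp only [Set.mem_iUnion, Set.mem_prod, Set.mem_singleton_iff, Set.mem_ofPred_eq]
  exact ⟨h, fun h0 => hgh (by rw [h0, lie_zero]), hgh, rfl⟩

theorem bracket_bracket (u v w : K) :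
    A.bracket u (A.bracket v w) = ∑ᶠ p : G × G, ⁅A.ρ p.1 u, ⁅A.ρ p.2 v, w⁆⁆ := by
  rw [finsum_curry _ (A.finite_lie_lie u v w), bracket_apply]
  refine finsum_congr fun g => ?_
  have := (LieAlgebra.ad ℂ K (A.ρ g u)).toAddMonoidHom.map_finsum (A.finite_lie v w)
  simpa [bracket_apply] using this

theorem jacobi (u v w : K) :
    A.bracket u (A.bracket v w) =
      A.bracket (A.bracket u v) w + A.bracket v (A.bracket u w) := by
  have h3 : A.bracket v (A.bracket u w) =
      ∑ᶠ p : G × G, ⁅A.ρ p.2 v, ⁅A.ρ p.1 u, w⁆⁆ := by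
    rw [bracket_bracket, ← finsum_comp_equiv (Equiv.prodComm G G)]; rfl
  have f1 := A.finite_lie_lie u v w
  have f3 : (Function.support fun p : G × G => ⁅A.ρ p.2 v, ⁅A.ρ p.1 u, w⁆⁆).Finite := by
    refine ((A.finite_lie_lie v u w).preimage
      (f := Prod.swap) Prod.swap_injective.injOn).subset ?_
    rintro ⟨g, h⟩ hgh; exact hgh
  have f2 : (Function.support fun p : G × G => ⁅⁅A.ρ p.1 u, A.ρ p.2 v⁆, w⁆).Finite := by
    refine (f1.union f3).subset fun p hp => ?_
    by_contra hc
    simp only [Set.mem_union, Function.mem_support, not_or, not_not] at hc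
    exact hp (by simp [lie_lie, hc.1, hc.2])
  let e : G × G ≃ G × G :=
    { toFun := fun p => (p.1 * p.2, p.1)
      invFun := fun p => (p.2, p.2⁻¹ * p.1)
      left_inv := fun p => by simp
      right_inv := fun p => by simp }
  have h2 : A.bracket (A.bracket u v) w =
      ∑ᶠ p : G × G, ⁅⁅A.ρ p.1 u, A.ρ p.2 v⁆, w⁆ := by
    rw [← finsum_comp_equiv e]
    have f2' : (Function.support fun p : G × G =>
        ⁅⁅A.ρ (e p).1 u, A.ρ (e p).2 v⁆, w⁆).Finite :=
      f2.preimage (f := e) e.injective.injOn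
    rw [finsum_curry _ f2', bracket_apply]
    refine finsum_congr fun h => ?_
    have := (AddMonoidHom.mk' (fun x : K => ⁅A.ρ h x, w⁆) fun x y => by simp).map_finsum
      (A.finite_lie u v)
    simp only [AddMonoidHom.mk'_apply] at this
    rw [bracket_apply, this]
    refine finsum_congr fun k => ?_
    simp [e, A.map_lie, map_mul]
  rw [h3, h2, bracket_bracket, ← finsum_add_distrib f2 f3]
  exact finsum_congr fun p => leibniz_lie _ _ _

/-- The Lie algebra `K / G`: the quotient of `(K, [·,·]_G)` by the span of the `g u - u`. -/
def Coinv : Type _ := K ⧸ A.coinvKer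

instance : AddCommGroup A.Coinv := inferInstanceAs (AddCommGroup (K ⧸ A.coinvKer))
instance : Module ℂ A.Coinv := inferInstanceAs (Module ℂ (K ⧸ A.coinvKer))

/-- The natural quotient map `K → K / G`. -/
def toCoinv : K →ₗ[ℂ] A.Coinv := A.coinvKer.mkQ

theorem toCoinv_surjective : Function.Surjective A.toCoinv := A.coinvKer.mkQ_surjective

theorem toCoinv_eq_zero {u : K} : A.toCoinv u = 0 ↔ u ∈ A.coinvKer :=
  Submodule.Quotient.mk_eq_zero _

theorem toCoinv_act (g : G) (u : K) : A.toCoinv (A.ρ g u) = A.toCoinv u := by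
  rw [← sub_eq_zero, ← map_sub, toCoinv_eq_zero]; exact A.sub_mem_coinvKer g u

/-- The linear map on `K / G` induced by a linear map on `K` which kills all `g u - u`. -/
def coinvLift {M : Type*} [AddCommGroup M] [Module ℂ M] (f : K →ₗ[ℂ] M)
    (hf : ∀ u ∈ A.coinvKer, f u = 0) : A.Coinv →ₗ[ℂ] M :=
  A.coinvKer.liftQ f hf

@[simp] theorem coinvLift_toCoinv {M : Type*} [AddCommGroup M] [Module ℂ M] (f : K →ₗ[ℂ] M)
    (hf : ∀ u ∈ A.coinvKer, f u = 0) (u : K) : A.coinvLift f hf (A.toCoinv u) = f u := rfl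

theorem coinv_hom_ext {M : Type*} [AddCommGroup M] [Module ℂ M] {f f' : A.Coinv →ₗ[ℂ] M}
    (h : ∀ u, f (A.toCoinv u) = f' (A.toCoinv u)) : f = f' := by
  refine LinearMap.ext fun x => ?_
  obtain ⟨u, rfl⟩ := A.toCoinv_surjective x
  exact h u

/-- The bracket of `K / G`, induced by `[·,·]_G`. -/
def coinvBracket : A.Coinv →ₗ[ℂ] A.Coinv →ₗ[ℂ] A.Coinv :=
  A.coinvLift
    { toFun := fun u => A.coinvLift (A.toCoinv ∘ₗ A.bracket u) fun _ hv =>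
        A.toCoinv_eq_zero.2 (A.bracket_right_mem u hv)
      map_add' := fun u u' => A.coinv_hom_ext fun v => by simp
      map_smul' := fun c u => A.coinv_hom_ext fun v => by simp }
    (fun u hu => A.coinv_hom_ext fun v => by simp [A.bracket_left_mem hu])

instance : Bracket A.Coinv A.Coinv := ⟨fun x y => A.coinvBracket x y⟩

theorem toCoinv_lie (u v : K) : ⁅A.toCoinv u, A.toCoinv v⁆ = A.toCoinv (A.bracket u v) := rfl

theorem coinv_lie_def (x y : A.Coinv) : ⁅x, y⁆ = A.coinvBracket x y := rfl

instance : LieRing A.Coinv where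
  add_lie x y z := by simp [coinv_lie_def]
  lie_add x y z := by simp [coinv_lie_def]
  lie_self x := by
    obtain ⟨u, rfl⟩ := A.toCoinv_surjective x
    rw [toCoinv_lie, toCoinv_eq_zero]
    have := A.coinvKer.smul_mem (2⁻¹ : ℂ) (A.bracket_add_swap_mem u u)
    rwa [← two_smul ℂ, smul_smul, inv_mul_cancel₀ two_ne_zero, one_smul] at this
  leibniz_lie x y z := by
    obtain ⟨u, rfl⟩ := A.toCoinv_surjective x
    obtain ⟨v, rfl⟩ := A.toCoinv_surjective y
    obtain ⟨w, rfl⟩ := A.toCoinv_surjective z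
    simp only [toCoinv_lie]
    rw [A.jacobi, map_add]

instance : LieAlgebra ℂ A.Coinv where
  lie_smul c x y := by simp [coinv_lie_def]

end LieAct

namespace FormAct

variable {G K : Type*} [Group G] [LieRing K] [LieAlgebra ℂ K] {F : InvForm K}
  (A : FormAct G F)

/-- The form `⟨u, v⟩_G = ∑_{g ∈ G} ⟨g u, v⟩` on `K`. -/
def sumForm : K →ₗ[ℂ] K →ₗ[ℂ] ℂ :=
  LinearMap.mk₂ ℂ (fun u v => ∑ᶠ g : G, F.form (A.ρ g u) v)
    (fun u u' v => by
      simp only [map_add, LinearMap.add_apply]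
      exact finsum_add_distrib (A.finite_form u v) (A.finite_form u' v))
    (fun c u v => by
      simp only [map_smul, LinearMap.smul_apply]
      exact (smul_finsum c _).symm)
    (fun u v v' => by
      simp only [map_add]
      exact finsum_add_distrib (A.finite_form u v) (A.finite_form u v'))
    (fun c u v => by
      simp only [map_smul]
      exact (smul_finsum c _).symm)

theorem sumForm_apply (u v : K) : A.sumForm u v = ∑ᶠ g : G, F.form (A.ρ g u) v := rfl

theorem sumForm_act_left (g : G) (u v : K) : A.sumForm (A.ρ g u) v = A.sumForm u v := by
  rw [sumForm_apply, sumForm_apply]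
  have := finsum_comp_equiv (Equiv.mulRight g) (f := fun h : G => F.form (A.ρ h u) v)
  rw [← this]
  refine finsum_congr fun h => ?_
  simp [map_mul]

theorem sumForm_symm (u v : K) : A.sumForm u v = A.sumForm v u := by
  rw [sumForm_apply, sumForm_apply, ← finsum_comp_equiv (Equiv.inv G)]
  refine finsum_congr fun g => ?_
  rw [F.symm, ← A.map_form g]
  congr 1
  exact A.act_inv_apply g u

theorem sumForm_left_mem {u : K} (hu : u ∈ A.coinvKer) (v : K) : A.sumForm u v = 0 := by
  induction hu using Submodule.span_induction with
  | mem x hx => obtain ⟨g, u, rfl⟩ := hx; simp [sumForm_act_left]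
  | zero => simp
  | add x y _ _ hx hy => simp [hx, hy]
  | smul c x _ hx => simp [hx]

theorem sumForm_invariant (u v w : K) :
    A.sumForm (A.bracket u v) w = A.sumForm u (A.bracket v w) := by
  have f1 : (Function.support fun p : G × G => F.form (A.ρ p.1 u) ⁅A.ρ p.2 v, w⁆).Finite := by
    refine ((A.finite_lie v w).biUnion fun h _ =>
      ((A.finite_form u ⁅A.ρ h v, w⁆).prod (Set.finite_singleton h))).subset ?_
    rintro ⟨g, h⟩ hgh
    simp only [Function.mem_support] at hgh
    simp only [Set.mem_iUnion, Set.mem_prod, Set.mem_singleton_iff, Set.mem_ofPred_eq]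
    exact ⟨h, fun h0 => hgh (by rw [h0, map_zero]), hgh, rfl⟩
  have h1 : A.sumForm u (A.bracket v w) =
      ∑ᶠ p : G × G, F.form (A.ρ p.1 u) ⁅A.ρ p.2 v, w⁆ := by
    rw [finsum_curry _ f1, sumForm_apply]
    refine finsum_congr fun g => ?_
    exact (F.form (A.ρ g u)).toAddMonoidHom.map_finsum (A.finite_lie v w)
  let e : G × G ≃ G × G :=
    { toFun := fun p => (p.1 * p.2, p.1)
      invFun := fun p => (p.2, p.2⁻¹ * p.1)
      left_inv := fun p => by simp
      right_inv := fun p => by simp }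
  rw [h1, ← finsum_comp_equiv e, finsum_curry _ (f1.preimage (f := e) e.injective.injOn),
    sumForm_apply]
  refine finsum_congr fun h => ?_
  have := (F.form.flip w ∘ₗ A.ρ h).toAddMonoidHom.map_finsum (A.finite_lie u v)
  simp only [LinearMap.toAddMonoidHom_coe, LinearMap.comp_apply, LinearMap.flip_apply] at this
  rw [LieAct.bracket_apply, this]
  refine finsum_congr fun k => ?_
  simp [e, A.map_lie, map_mul, F.invariant]

/-- The symmetric invariant form on `K / G` induced by `⟨·,·⟩_G`. -/
def coinvForm : InvForm A.Coinv where
  form := A.coinvLift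
    { toFun := fun u => A.coinvLift (A.sumForm u) fun v hv => by
        rw [sumForm_symm, A.sumForm_left_mem hv]
      map_add' := fun u u' => A.coinv_hom_ext fun v => by simp
      map_smul' := fun c u => A.coinv_hom_ext fun v => by simp }
    (fun u hu => A.coinv_hom_ext fun v => by simp [A.sumForm_left_mem hu])
  symm x y := by
    obtain ⟨u, rfl⟩ := A.toCoinv_surjective x
    obtain ⟨v, rfl⟩ := A.toCoinv_surjective y
    exact A.sumForm_symm u v
  invariant x y z := by
    obtain ⟨u, rfl⟩ := A.toCoinv_surjective x
    obtain ⟨v, rfl⟩ := A.toCoinv_surjective y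
    obtain ⟨w, rfl⟩ := A.toCoinv_surjective z
    exact A.sumForm_invariant u v w

theorem coinvForm_toCoinv (u v : K) : A.coinvForm.form (A.toCoinv u) (A.toCoinv v) = A.sumForm u v := rfl

end FormAct

/-! ## The untwisted affine Lie algebra -/

section Affine

open LieAlgebra LieAlgebra.LoopAlgebra

variable {K : Type*} [LieRing K] [LieAlgebra ℂ K]

theorem InvForm.isSymm (F : InvForm K) : LinearMap.BilinForm.IsSymm F.form :=
  ⟨fun u v => F.symm u v⟩

theorem InvForm.lieInvariant (F : InvForm K) :
    LinearMap.BilinForm.lieInvariant K F.form := fun x y z => by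
  rw [← F.invariant, ← lie_skew x y, map_neg, LinearMap.neg_apply]

/-- The affine Lie algebra `K ⊗ ℂ[t, t⁻¹] ⊕ ℂ 𝐤`. -/
def Affine (_F : InvForm K) : Type _ := loopAlgebra ℂ ℤ K × ℂ

namespace Affine

variable (F : InvForm K)

instance : AddCommGroup (Affine F) := inferInstanceAs (AddCommGroup (loopAlgebra ℂ ℤ K × ℂ))
instance : Module ℂ (Affine F) := inferInstanceAs (Module ℂ (loopAlgebra ℂ ℤ K × ℂ))

/-- `a(n) = a ⊗ t ^ n`, linear in `a`. -/
def mode (n : ℤ) : K →ₗ[ℂ] Affine F :=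
  LinearMap.inl ℂ (loopAlgebra ℂ ℤ K) ℂ ∘ₗ
    TensorProduct.mk ℂ (AddMonoidAlgebra ℂ ℤ) K (AddMonoidAlgebra.single n 1)

/-- The central element `𝐤`. -/
def central : Affine F := ((0, 1) : loopAlgebra ℂ ℤ K × ℂ)

/-- The bracket `[a ⊗ t ^ m + α 𝐤, b ⊗ t ^ n + β 𝐤] = [a, b] ⊗ t ^ (m + n) + m ⟨a, b⟩ δ_{m+n,0} 𝐤`
(see `lie_mode_mode`); the scalar cocycle is the residue pairing of the loop algebra. -/
instance : Bracket (Affine F) (Affine F) :=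
  ⟨fun x y => ((⁅x.1, y.1⁆, residuePairing ℂ ℤ K F.form y.1 x.1) : loopAlgebra ℂ ℤ K × ℂ)⟩

theorem lie_def (x y : Affine F) :
    ⁅x, y⁆ = ((⁅x.1, y.1⁆, residuePairing ℂ ℤ K F.form y.1 x.1) : loopAlgebra ℂ ℤ K × ℂ) := rfl

theorem residue_self (x : loopAlgebra ℂ ℤ K) : residuePairing ℂ ℤ K F.form x x = 0 := by
  have := LieModule.Cohomology.mem_twoCochain_iff.mp
    (twoCochainOfBilinear ℂ ℤ K F.form F.isSymm).property x
  simpa [twoCochainOfBilinear] using this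

theorem residue_skew (x y : loopAlgebra ℂ ℤ K) :
    residuePairing ℂ ℤ K F.form x y = - residuePairing ℂ ℤ K F.form y x := by
  have := residue_self F (x + y)
  simp only [map_add, LinearMap.add_apply, residue_self, zero_add, add_zero] at this
  linear_combination this

theorem residue_jacobi (x y z : loopAlgebra ℂ ℤ K) :
    residuePairing ℂ ℤ K F.form ⁅y, z⁆ x =
      residuePairing ℂ ℤ K F.form z ⁅x, y⁆ + residuePairing ℂ ℤ K F.form ⁅x, z⁆ y := by
  have h := (LieModule.Cohomology.mem_twoCocycle_iff_of_trivial ..).mp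
    (twoCocycleOfBilinear ℂ ℤ K F.form F.lieInvariant F.isSymm).property x y z
  simp only [twoCocycleOfBilinear_coe, twoCochainOfBilinear_apply_apply, ← map_add,
    EmbeddingLike.apply_eq_iff_eq] at h
  rw [residue_skew F _ x, residue_skew F z, residue_skew F _ y, h, neg_add]

instance : LieRing (Affine F) where
  add_lie x y z := by
    simp only [lie_def]
    exact Prod.ext (add_lie x.1 y.1 z.1) (map_add (residuePairing ℂ ℤ K F.form z.1) x.1 y.1)
  lie_add x y z := by
    simp only [lie_def]
    exact Prod.ext (lie_add x.1 y.1 z.1)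
      (LinearMap.map_add₂ (residuePairing ℂ ℤ K F.form) y.1 z.1 x.1)
  lie_self x := Prod.ext (lie_self x.1) (residue_self F x.1)
  leibniz_lie x y z := Prod.ext (LieRing.leibniz_lie x.1 y.1 z.1) (residue_jacobi F x.1 y.1 z.1)

instance : LieAlgebra ℂ (Affine F) where
  lie_smul c x y := Prod.ext (lie_smul c x.1 y.1)
    (LinearMap.map_smul₂ (residuePairing ℂ ℤ K F.form) c y.1 x.1)

theorem lie_mode_mode (a b : K) (m n : ℤ) :
    ⁅mode F m a, mode F n b⁆ =
      mode F (m + n) ⁅a, b⁆ + ((m : ℂ) * (if m + n = 0 then 1 else 0) * F.form a b) • central F := by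
  have h1 : ((mode F m a).1 : loopAlgebra ℂ ℤ K) = AddMonoidAlgebra.single m 1 ⊗ₜ[ℂ] a := rfl
  have h2 : ((mode F n b).1 : loopAlgebra ℂ ℤ K) = AddMonoidAlgebra.single n 1 ⊗ₜ[ℂ] b := rfl
  rw [lie_def, h1, h2]
  refine Prod.ext ?_ ?_
  · change ⁅AddMonoidAlgebra.single m (1 : ℂ) ⊗ₜ[ℂ] a, AddMonoidAlgebra.single n (1 : ℂ) ⊗ₜ[ℂ] b⁆ =
      AddMonoidAlgebra.single (m + n) (1 : ℂ) ⊗ₜ[ℂ] ⁅a, b⁆ + _ • (0 : loopAlgebra ℂ ℤ K)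
    rw [LieAlgebra.ExtendScalars.bracket_tmul, AddMonoidAlgebra.single_mul_single, mul_one,
      smul_zero, add_zero]
  · change residuePairing ℂ ℤ K F.form (AddMonoidAlgebra.single n (1 : ℂ) ⊗ₜ[ℂ] b)
      (AddMonoidAlgebra.single m (1 : ℂ) ⊗ₜ[ℂ] a) = 0 + _ • (1 : ℂ)
    rw [residuePairing_apply_apply, toFinsupp_single_tmul, toFinsupp_single_tmul,
      Finsupp.sum_single_index (by simp), Finsupp.single_apply, zero_add]
    by_cases h : m + n = 0
    · rw [if_pos h, if_pos (by omega), F.symm]; simp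
    · rw [if_neg h, if_neg (by omega)]; simp

theorem central_lie (x : Affine F) : ⁅central F, x⁆ = 0 := by
  rw [lie_def]
  refine Prod.ext (zero_lie x.1) ?_
  exact map_zero (residuePairing ℂ ℤ K F.form x.1)

theorem lie_central (x : Affine F) : ⁅x, central F⁆ = 0 := by
  rw [← lie_skew, central_lie, neg_zero]

variable {F}

theorem hom_ext {M : Type*} [AddCommGroup M] [Module ℂ M] {f g : Affine F →ₗ[ℂ] M}
    (h : ∀ n a, f (mode F n a) = g (mode F n a)) (hk : f (central F) = g (central F)) :
    f = g := by
  refine LinearMap.prod_ext ?_ (LinearMap.ext_ring hk)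
  refine TensorProduct.ext ?_
  refine AddMonoidAlgebra.lhom_ext' fun n => ?_
  refine LinearMap.ext_ring ?_
  exact LinearMap.ext fun a => h n a

theorem induction {p : Affine F → Prop} (hmode : ∀ n a, p (mode F n a)) (hk : p (central F))
    (hzero : p 0) (hadd : ∀ x y, p x → p y → p (x + y)) (hsmul : ∀ (c : ℂ) x, p x → p (c • x))
    (x : Affine F) : p x := by
  let N : Submodule ℂ (Affine F) :=
    { carrier := {x | p x}, zero_mem' := hzero, add_mem' := fun hx hy => hadd _ _ hx hy,
      smul_mem' := fun c x hx => hsmul c x hx }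
  have : N.mkQ = 0 := hom_ext (fun n a => (Submodule.Quotient.mk_eq_zero N).2 (hmode n a))
    ((Submodule.Quotient.mk_eq_zero N).2 hk)
  exact (Submodule.Quotient.mk_eq_zero N).1 congr($this x)

/-- The linear map of `K ⊗ ℂ[t, t⁻¹]` with `a ⊗ t ^ n ↦ c ^ n (σ a ⊗ t ^ n)`. -/
def loopMap (c : ℂˣ) (σ : K →ₗ[ℂ] K) : loopAlgebra ℂ ℤ K →ₗ[ℂ] loopAlgebra ℂ ℤ K :=
  TensorProduct.map ((AddMonoidAlgebra.basis ℤ ℂ).constr ℂ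
    fun n => ((c ^ n : ℂˣ) : ℂ) • AddMonoidAlgebra.single n 1) σ

/-- The linear map of the affine Lie algebra with `a ⊗ t ^ n ↦ c ^ n (σ a ⊗ t ^ n)` and
`𝐤 ↦ 𝐤`. -/
def twist (F : InvForm K) (c : ℂˣ) (σ : K →ₗ[ℂ] K) : Affine F →ₗ[ℂ] Affine F :=
  LinearMap.prodMap (loopMap c σ) LinearMap.id

theorem twist_mode (c : ℂˣ) (σ : K →ₗ[ℂ] K) (n : ℤ) (a : K) :
    twist F c σ (mode F n a) = ((c ^ n : ℂˣ) : ℂ) • mode F n (σ a) := by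
  refine Prod.ext ?_ ?_
  · change loopMap c σ (AddMonoidAlgebra.single n 1 ⊗ₜ[ℂ] a) =
      ((c ^ n : ℂˣ) : ℂ) • AddMonoidAlgebra.single n 1 ⊗ₜ[ℂ] σ a
    rw [loopMap, TensorProduct.map_tmul, ← AddMonoidAlgebra.basis_apply, Module.Basis.constr_basis,
      TensorProduct.smul_tmul', AddMonoidAlgebra.basis_apply]
  · exact (mul_zero _).symm

theorem twist_central (c : ℂˣ) (σ : K →ₗ[ℂ] K) : twist F c σ (central F) = central F :=
  Prod.ext (map_zero (loopMap c σ)) rfl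

theorem twist_comp (c d : ℂˣ) (σ τ : K →ₗ[ℂ] K) (x : Affine F) :
    twist F c σ (twist F d τ x) = twist F (c * d) (σ ∘ₗ τ) x := by
  suffices H : twist F c σ ∘ₗ twist F d τ = twist F (c * d) (σ ∘ₗ τ) from congr($H x)
  refine hom_ext (fun n a => ?_) (by simp only [LinearMap.comp_apply, twist_central])
  simp only [LinearMap.comp_apply, twist_mode, map_smul, smul_smul, mul_zpow, Units.val_mul]
  rw [mul_comm]

theorem twist_id (x : Affine F) : twist F 1 LinearMap.id x = x := by
  suffices H : twist F 1 LinearMap.id = LinearMap.id from congr($H x)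
  exact hom_ext (fun n a => by simp [twist_mode]) (twist_central _ _)

theorem twist_lie (c : ℂˣ) (σ : K →ₗ[ℂ] K) (h : ∀ a b : K, σ ⁅a, b⁆ = ⁅σ a, σ b⁆)
    (h' : ∀ a b, F.form (σ a) (σ b) = F.form a b) (x y : Affine F) :
    twist F c σ ⁅x, y⁆ = ⁅twist F c σ x, twist F c σ y⁆ := by
  let B : Affine F →ₗ[ℂ] Affine F →ₗ[ℂ] Affine F :=
    LinearMap.mk₂ ℂ (fun x y => ⁅x, y⁆) add_lie (fun c x y => smul_lie c x y) lie_add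
      (fun c x y => lie_smul c x y)
  have hB : ∀ x y, B x y = ⁅x, y⁆ := fun _ _ => rfl
  suffices H : B.compr₂ (twist F c σ) = B.compl₁₂ (twist F c σ) (twist F c σ) from
    congr($H x y)
  refine hom_ext (fun m a => hom_ext (fun n b => ?_) ?_) (LinearMap.ext fun y => ?_)
  · simp only [LinearMap.compr₂_apply, LinearMap.compl₁₂_apply, hB, lie_mode_mode, twist_mode,
      map_add, map_smul, LinearMap.smul_apply, twist_central, h, h', smul_add, smul_smul]
    congr 1
    · rw [zpow_add, Units.val_mul, mul_comm]
    · congr 1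
      by_cases hmn : m + n = 0
      · rw [← mul_assoc, ← Units.val_mul, ← zpow_add, add_comm n m, hmn, zpow_zero, Units.val_one,
          one_mul]
      · simp [hmn]
  · simp only [LinearMap.compr₂_apply, LinearMap.compl₁₂_apply, hB, twist_central, lie_central,
      map_zero]
  · simp only [LinearMap.compr₂_apply, LinearMap.compl₁₂_apply, hB, twist_central, central_lie,
      map_zero]

end Affine
end Affine

/-! ## The generalized twisted affine Lie algebra -/

namespace FormAct

variable {G K : Type*} [Group G] [LieRing K] [LieAlgebra ℂ K] {F : InvForm K}
  (A : FormAct G F) (φ : G →* ℂˣ)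

theorem act_injective (g : G) : Function.Injective (A.ρ g) := fun x y h => by
  have := congrArg (A.ρ g⁻¹) h
  simpa [← Module.End.mul_apply, ← map_mul] using this

/-- The action of `G` on the affine Lie algebra by
`g (a ⊗ t ^ m + β 𝐤) = φ(g) ^ m (g a ⊗ t ^ m) + β 𝐤`. -/
def affineAct : LieAct G (Affine F) where
  ρ :=
    { toFun := fun g => Affine.twist F (φ g) (A.ρ g)
      map_one' := LinearMap.ext fun x => by
        rw [map_one, map_one]; exact Affine.twist_id x
      map_mul' := fun g h => LinearMap.ext fun x => by
        rw [map_mul, map_mul]; exact (Affine.twist_comp _ _ _ _ x).symm }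
  map_lie g := Affine.twist_lie _ _ (A.map_lie g) (A.map_form g)
  finite_lie := by
    refine Affine.induction (fun m a => ?_) ?_ ?_ (fun x x' hx hx' v => ?_) (fun c x hx v => ?_)
    · refine Affine.induction (fun n b => ?_) ?_ ?_ (fun y y' hy hy' => ?_) (fun c y hy => ?_)
      · refine ((A.finite_lie a b).union (A.finite_form a b)).subset fun g hg => ?_
        by_contra hc
        simp only [Set.mem_union, Set.mem_ofPred_eq, not_or, not_not] at hc
        refine hg ?_
        simp [Affine.twist_mode, Affine.lie_mode_mode, hc.1, hc.2]
      · simp [Affine.lie_central]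
      · simp
      · refine (hy.union hy').subset fun g hg => ?_
        by_contra hc
        simp only [Set.mem_union, Set.mem_ofPred_eq, not_or, not_not] at hc
        exact hg (by rw [lie_add, hc.1, hc.2, add_zero])
      · refine hy.subset fun g hg hc => hg ?_
        rw [lie_smul, hc, smul_zero]
    · intro v
      simp [Affine.twist_central, Affine.central_lie]
    · intro v
      simp
    · refine ((hx v).union (hx' v)).subset fun g hg => ?_
      by_contra hc
      simp only [Set.mem_union, Set.mem_ofPred_eq, not_or, not_not] at hc
      exact hg (by rw [map_add, add_lie, hc.1, hc.2, add_zero])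
    · refine (hx v).subset fun g hg hc => hg ?_
      rw [map_smul, smul_lie, hc, smul_zero]

theorem affineAct_mode (g : G) (n : ℤ) (a : K) :
    (A.affineAct φ).ρ g (Affine.mode F n a) =
      ((φ g ^ n : ℂˣ) : ℂ) • Affine.mode F n (A.ρ g a) :=
  Affine.twist_mode _ _ _ _

theorem affineAct_central (g : G) :
    (A.affineAct φ).ρ g (Affine.central F) = Affine.central F :=
  Affine.twist_central _ _

theorem affineAct_bracket_mode (a b : K) (m n : ℤ) :
    (A.affineAct φ).bracket (Affine.mode F m a) (Affine.mode F n b) =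
      ∑ᶠ g : G, ((φ g ^ m : ℂˣ) : ℂ) • (Affine.mode F (m + n) ⁅A.ρ g a, b⁆ +
        ((m : ℂ) * (if m + n = 0 then 1 else 0) * F.form (A.ρ g a) b) • Affine.central F) := by
  rw [LieAct.bracket_apply]
  refine finsum_congr fun g => ?_
  rw [affineAct_mode, smul_lie, Affine.lie_mode_mode]

/-- The generalized twisted affine Lie algebra `K̂[G]`: the quotient of
`K ⊗ ℂ[t, t⁻¹] ⊕ ℂ 𝐤` with the multiplication
`[a ⊗ t ^ m + α 𝐤, b ⊗ t ^ n + β 𝐤]_G = ∑_{g ∈ G} φ(g) ^ m ([g a, b] ⊗ t ^ (m + n) +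
m ⟨g a, b⟩ δ_{m+n,0} 𝐤)` (see `affineAct_bracket_mode`) by the span of the elements
`φ(g) ^ m (g a ⊗ t ^ m) - a ⊗ t ^ m`. -/
abbrev TwistedAffine : Type _ := (A.affineAct φ).Coinv

/-- The restriction of an action to a subgroup. -/
def restrict (H : Subgroup G) : FormAct H F where
  ρ := A.ρ.comp H.subtype
  map_lie g := A.map_lie g
  finite_lie u v := (A.finite_lie u v).preimage Subtype.val_injective.injOn
  map_form g := A.map_form g
  finite_form u v := (A.finite_form u v).preimage Subtype.val_injective.injOn

/-- The Lie algebra `K / H` for `H = ker φ`. -/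
abbrev KerCoinv : Type _ := (A.restrict φ.ker).Coinv

/-- The form `⟨·,·⟩_H` on `K / H` for `H = ker φ`. -/
abbrev kerForm : InvForm (A.KerCoinv φ) := (A.restrict φ.ker).coinvForm

/-- The action of `G` on `K / H`, `H = ker φ`, with `g` sending the class of `a` to that
of `g a`. -/
def kerAct : Representation ℂ G (A.KerCoinv φ) where
  toFun g := (A.restrict φ.ker).coinvLift ((A.restrict φ.ker).toCoinv ∘ₗ A.ρ g) fun u hu => by
      induction hu using Submodule.span_induction with
      | mem x hx =>
        obtain ⟨k, u, rfl⟩ := hx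
        rw [LinearMap.comp_apply, LieAct.toCoinv_eq_zero]
        have hk : g * k * g⁻¹ ∈ φ.ker := φ.normal_ker.conj_mem k k.2 g
        have := (A.restrict φ.ker).sub_mem_coinvKer ⟨g * k * g⁻¹, hk⟩ (A.ρ g u)
        have e : A.ρ (g * k * g⁻¹) (A.ρ g u) = A.ρ g (A.ρ k u) := by
          simp only [← Module.End.mul_apply, ← map_mul, inv_mul_cancel_right]
        rw [map_sub]
        change A.ρ g (A.ρ k u) - A.ρ g u ∈ _
        rw [← e]
        exact this
      | zero => simp
      | add x y _ _ hx hy => rw [map_add, hx, hy, add_zero]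
      | smul c x _ hx => rw [map_smul, hx, smul_zero]
  map_one' := LieAct.coinv_hom_ext _ fun u => by simp
  map_mul' g h := LieAct.coinv_hom_ext _ fun u => by simp

theorem kerAct_toCoinv (g : G) (a : K) :
    A.kerAct φ g ((A.restrict φ.ker).toCoinv a) = (A.restrict φ.ker).toCoinv (A.ρ g a) := rfl

theorem kerAct_lie (g : G) (x y : A.KerCoinv φ) :
    A.kerAct φ g ⁅x, y⁆ = ⁅A.kerAct φ g x, A.kerAct φ g y⁆ := by
  obtain ⟨u, rfl⟩ := LieAct.toCoinv_surjective _ x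
  obtain ⟨v, rfl⟩ := LieAct.toCoinv_surjective _ y
  rw [kerAct_toCoinv, kerAct_toCoinv, LieAct.toCoinv_lie, LieAct.toCoinv_lie, kerAct_toCoinv]
  congr 1
  let e : φ.ker ≃ φ.ker := (MulAut.conjNormal g).toEquiv
  rw [LieAct.bracket_apply, LieAct.bracket_apply,
    ← finsum_comp_equiv e (f := fun h : φ.ker => ⁅(A.restrict φ.ker).ρ h (A.ρ g u), A.ρ g v⁆)]
  refine ((A.ρ g).toAddMonoidHom.map_finsum ((A.restrict φ.ker).finite_lie u v)).trans ?_
  refine finsum_congr fun h => ?_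
  change A.ρ g ⁅A.ρ h u, v⁆ = ⁅A.ρ (e h) (A.ρ g u), A.ρ g v⁆
  rw [A.map_lie]
  congr 1
  rw [← Module.End.mul_apply, ← Module.End.mul_apply, ← map_mul, ← map_mul]
  congr 2
  simp [e]

theorem kerAct_form (g : G) (x y : A.KerCoinv φ) :
    (A.kerForm φ).form (A.kerAct φ g x) (A.kerAct φ g y) = (A.kerForm φ).form x y := by
  obtain ⟨u, rfl⟩ := LieAct.toCoinv_surjective _ x
  obtain ⟨v, rfl⟩ := LieAct.toCoinv_surjective _ y
  rw [kerAct_toCoinv, kerAct_toCoinv]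
  let e : φ.ker ≃ φ.ker := (MulAut.conjNormal g).toEquiv
  rw [kerForm, coinvForm_toCoinv, coinvForm_toCoinv, sumForm_apply, sumForm_apply,
    ← finsum_comp_equiv e (f := fun h : φ.ker =>
      F.form ((A.restrict φ.ker).ρ h (A.ρ g u)) (A.ρ g v))]
  refine finsum_congr fun h => ?_
  change F.form (A.ρ (e h) (A.ρ g u)) (A.ρ g v) = F.form (A.ρ h u) v
  rw [← A.map_form g (A.ρ h u) v]
  congr 2
  rw [← Module.End.mul_apply, ← Module.End.mul_apply, ← map_mul, ← map_mul]
  congr 2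
  simp [e]

end FormAct

/-! ## The vacuum module `V(ℓ, 0)` -/

section Vacuum

variable {K : Type*} [LieRing K] [LieAlgebra ℂ K] (F : InvForm K) (ℓ : ℂ)

/-- The left ideal of `U(K̂)` generated by `K ⊗ ℂ[t]` and `𝐤 - ℓ`. -/
def vacuumIdeal : Submodule (UniversalEnvelopingAlgebra ℂ (Affine F))
    (UniversalEnvelopingAlgebra ℂ (Affine F)) :=
  Submodule.span _
    ({x | ∃ (n : ℤ) (a : K), 0 ≤ n ∧ x = UniversalEnvelopingAlgebra.ι ℂ (Affine.mode F n a)} ∪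
      {UniversalEnvelopingAlgebra.ι ℂ (Affine.central F) - algebraMap ℂ _ ℓ})

/-- The vacuum module `V(ℓ, 0)`, i.e. the `K̂`-module induced from the one-dimensional module
`ℂ_ℓ` of `K ⊗ ℂ[t] ⊕ ℂ 𝐤` on which `K ⊗ ℂ[t]` acts trivially and `𝐤` acts as `ℓ`. It is realized
as the quotient of `U(K̂)` by the left ideal generated by the annihilator of `ℂ_ℓ`. -/
def Vacuum : Type _ := UniversalEnvelopingAlgebra ℂ (Affine F) ⧸ vacuumIdeal F ℓ

namespace Vacuum

instance : AddCommGroup (Vacuum F ℓ) :=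
  inferInstanceAs (AddCommGroup (UniversalEnvelopingAlgebra ℂ (Affine F) ⧸ vacuumIdeal F ℓ))
instance : Module (UniversalEnvelopingAlgebra ℂ (Affine F)) (Vacuum F ℓ) :=
  inferInstanceAs (Module _ (UniversalEnvelopingAlgebra ℂ (Affine F) ⧸ vacuumIdeal F ℓ))
instance : Module ℂ (Vacuum F ℓ) :=
  inferInstanceAs (Module ℂ (UniversalEnvelopingAlgebra ℂ (Affine F) ⧸ vacuumIdeal F ℓ))
instance : IsScalarTower ℂ (UniversalEnvelopingAlgebra ℂ (Affine F)) (Vacuum F ℓ) :=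
  inferInstanceAs (IsScalarTower ℂ _ (UniversalEnvelopingAlgebra ℂ (Affine F) ⧸ vacuumIdeal F ℓ))

/-- The vacuum vector `𝟏 = 1 ⊗ 1`. -/
def one : Vacuum F ℓ := (vacuumIdeal F ℓ).mkQ 1

/-- The action of `a(n) = a ⊗ t ^ n` on `V(ℓ, 0)`. -/
def modeAct (n : ℤ) (a : K) (v : Vacuum F ℓ) : Vacuum F ℓ :=
  UniversalEnvelopingAlgebra.ι ℂ (Affine.mode F n a) • v

/-- The embedding `a ↦ a(-1) 𝟏` of `K` in `V(ℓ, 0)`. -/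
def state (a : K) : Vacuum F ℓ := modeAct F ℓ (-1) a (one F ℓ)

variable (c : ℂˣ) (σ : K →ₗ[ℂ] K) (h : ∀ a b : K, σ ⁅a, b⁆ = ⁅σ a, σ b⁆)
  (h' : ∀ a b, F.form (σ a) (σ b) = F.form a b)

/-- The endomorphism of `U(K̂)` induced by the endomorphism
`a(n) ↦ c ^ n (σ a)(n)`, `𝐤 ↦ 𝐤` of `K̂`. -/
def envTwist : UniversalEnvelopingAlgebra ℂ (Affine F) →ₐ[ℂ]
    UniversalEnvelopingAlgebra ℂ (Affine F) :=
  UniversalEnvelopingAlgebra.lift ℂ ((UniversalEnvelopingAlgebra.ι ℂ).comp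
    { Affine.twist F c σ with map_lie' := fun {x y} => Affine.twist_lie c σ h h' x y })

theorem envTwist_ι (x : Affine F) :
    envTwist F c σ h h' (UniversalEnvelopingAlgebra.ι ℂ x) =
      UniversalEnvelopingAlgebra.ι ℂ (Affine.twist F c σ x) :=
  UniversalEnvelopingAlgebra.lift_ι_apply ℂ _ x

theorem envTwist_mem {u : UniversalEnvelopingAlgebra ℂ (Affine F)} (hu : u ∈ vacuumIdeal F ℓ) :
    envTwist F c σ h h' u ∈ vacuumIdeal F ℓ := by
  induction hu using Submodule.span_induction with
  | mem x hx =>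
    rcases hx with ⟨n, a, hn, rfl⟩ | rfl
    · rw [envTwist_ι, Affine.twist_mode, ← map_smul]
      exact Submodule.subset_span (Or.inl ⟨n, _, hn, rfl⟩)
    · rw [map_sub, envTwist_ι, Affine.twist_central, AlgHom.commutes]
      exact Submodule.subset_span (Or.inr rfl)
  | zero => simp
  | add x y _ _ hx hy => rw [map_add]; exact Submodule.add_mem _ hx hy
  | smul c x _ hx => rw [smul_eq_mul, map_mul]; exact Submodule.smul_mem _ _ hx

/-- The endomorphism of `V(ℓ, 0)` with
`a₁(n₁) ⋯ a_r(n_r) 𝟏 ↦ c ^ (n₁ + ⋯ + n_r) (σ a₁)(n₁) ⋯ (σ a_r)(n_r) 𝟏`. -/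
def twist : Vacuum F ℓ →ₗ[ℂ] Vacuum F ℓ :=
  Submodule.mapQ ((vacuumIdeal F ℓ).restrictScalars ℂ) ((vacuumIdeal F ℓ).restrictScalars ℂ)
    (envTwist F c σ h h').toLinearMap fun _ hu => envTwist_mem F ℓ c σ h h' hu

theorem twist_one : twist F ℓ c σ h h' (one F ℓ) = one F ℓ :=
  congrArg (vacuumIdeal F ℓ).mkQ (map_one (envTwist F c σ h h'))

theorem twist_modeAct (n : ℤ) (a : K) (v : Vacuum F ℓ) :
    twist F ℓ c σ h h' (modeAct F ℓ n a v) =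
      ((c ^ n : ℂˣ) : ℂ) • modeAct F ℓ n (σ a) (twist F ℓ c σ h h' v) := by
  obtain ⟨u, rfl⟩ := (vacuumIdeal F ℓ).mkQ_surjective v
  refine (congrArg (vacuumIdeal F ℓ).mkQ
    (map_mul (envTwist F c σ h h') (UniversalEnvelopingAlgebra.ι ℂ (Affine.mode F n a)) u)).trans ?_
  rw [envTwist_ι, Affine.twist_mode, map_smul, smul_mul_assoc]
  rfl

/-- The homogeneous subspace of degree `n`, spanned by the vectors `a₁(n₁) ⋯ a_r(n_r) 𝟏` with
`n₁ + ⋯ + n_r = -n`. -/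
def weightSpace (n : ℤ) : Submodule ℂ (Vacuum F ℓ) :=
  Submodule.span ℂ {v | ∃ l : List (ℤ × K), (l.map Prod.fst).sum = -n ∧
    v = l.foldr (fun p v => modeAct F ℓ p.1 p.2 v) (one F ℓ)}

/-- The operator `z ^ L(0)` on `V(ℓ, 0)`, where `L(0)` is the grading operator; it acts on the
homogeneous subspace of degree `n` as `z ^ n` (see `powL0_of_mem`). -/
def powL0 (z : ℂˣ) : Vacuum F ℓ →ₗ[ℂ] Vacuum F ℓ :=
  twist F ℓ z⁻¹ LinearMap.id (fun _ _ => rfl) (fun _ _ => rfl)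

theorem modeAct_smul (n : ℤ) (a : K) (c : ℂ) (v : Vacuum F ℓ) :
    modeAct F ℓ n a (c • v) = c • modeAct F ℓ n a v := by
  rw [modeAct, modeAct, smul_algebra_smul_comm]

theorem powL0_of_mem (z : ℂˣ) (n : ℤ) {v : Vacuum F ℓ} (hv : v ∈ weightSpace F ℓ n) :
    powL0 F ℓ z v = ((z ^ n : ℂˣ) : ℂ) • v := by
  induction hv using Submodule.span_induction with
  | mem x hx =>
    obtain ⟨l, hl, rfl⟩ := hx
    rw [show n = -(l.map Prod.fst).sum by omega]
    clear hl
    induction l with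
    | nil => simpa [powL0] using twist_one F ℓ z⁻¹ LinearMap.id (fun _ _ => rfl) (fun _ _ => rfl)
    | cons p l ih =>
      rw [List.foldr_cons, powL0, twist_modeAct, ← powL0, ih, LinearMap.id_apply, modeAct_smul,
        smul_smul, ← Units.val_mul]
      congr 2
      rw [List.map_cons, List.sum_cons, neg_add, zpow_add, inv_zpow, zpow_neg z p.1]
  | zero => simp
  | add x y _ _ hx hy => rw [map_add, hx, hy, smul_add]
  | smul c x _ hx => rw [map_smul, hx, smul_comm]

/-- The automorphism of `V(ℓ, 0)` induced by an automorphism `σ` of `(K, ⟨·,·⟩)`: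
`a₁(n₁) ⋯ a_r(n_r) 𝟏 ↦ (σ a₁)(n₁) ⋯ (σ a_r)(n_r) 𝟏`. -/
def induced : Vacuum F ℓ →ₗ[ℂ] Vacuum F ℓ := twist F ℓ 1 σ h h'

theorem twist_comp (d : ℂˣ) (τ : K →ₗ[ℂ] K) (k : ∀ a b : K, τ ⁅a, b⁆ = ⁅τ a, τ b⁆)
    (k' : ∀ a b, F.form (τ a) (τ b) = F.form a b) (c' : ℂˣ) (σ' : K →ₗ[ℂ] K)
    (m : ∀ a b : K, σ' ⁅a, b⁆ = ⁅σ' a, σ' b⁆)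
    (m' : ∀ a b, F.form (σ' a) (σ' b) = F.form a b) (hc : c * d = c') (hσ : σ ∘ₗ τ = σ')
    (v : Vacuum F ℓ) :
    twist F ℓ c σ h h' (twist F ℓ d τ k k' v) = twist F ℓ c' σ' m m' v := by
  subst hc hσ
  obtain ⟨u, rfl⟩ := (vacuumIdeal F ℓ).mkQ_surjective v
  refine congrArg (vacuumIdeal F ℓ).mkQ (a₁ := envTwist F c σ h h' (envTwist F d τ k k' u))
    (a₂ := envTwist F (c * d) (σ ∘ₗ τ) m m' u) ?_
  suffices H : (envTwist F c σ h h').comp (envTwist F d τ k k') =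
      envTwist F (c * d) (σ ∘ₗ τ) m m' from congr($H u)
  refine UniversalEnvelopingAlgebra.hom_ext ℂ (LieHom.ext fun x => ?_)
  change envTwist F c σ h h' (envTwist F d τ k k' (UniversalEnvelopingAlgebra.ι ℂ x)) =
    envTwist F (c * d) (σ ∘ₗ τ) m m' (UniversalEnvelopingAlgebra.ι ℂ x)
  rw [envTwist_ι, envTwist_ι, envTwist_ι, Affine.twist_comp]

theorem twist_id (v : Vacuum F ℓ) :
    twist F ℓ 1 LinearMap.id (fun _ _ => rfl) (fun _ _ => rfl) v = v := by
  obtain ⟨u, rfl⟩ := (vacuumIdeal F ℓ).mkQ_surjective v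
  refine congrArg (vacuumIdeal F ℓ).mkQ
    (a₁ := envTwist F 1 LinearMap.id (fun _ _ => rfl) (fun _ _ => rfl) u) ?_
  suffices H : envTwist F 1 LinearMap.id (fun _ _ => rfl) (fun _ _ => rfl) = AlgHom.id ℂ _ from
    congr($H u)
  refine UniversalEnvelopingAlgebra.hom_ext ℂ (LieHom.ext fun x => ?_)
  change envTwist F 1 LinearMap.id (fun _ _ => rfl) (fun _ _ => rfl)
    (UniversalEnvelopingAlgebra.ι ℂ x) = UniversalEnvelopingAlgebra.ι ℂ x
  rw [envTwist_ι, Affine.twist_id]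

end Vacuum
end Vacuum

/-- The operators `R_g = φ(g) ^ (-L(0)) g` of a group acting on `K / ker φ`, on the vacuum module
`V(ℓ, 0)` of the affine Lie algebra of `K / ker φ`. -/
def FormAct.vacuumAct {G K : Type*} [Group G] [LieRing K] [LieAlgebra ℂ K] {F : InvForm K}
    (A : FormAct G F) (φ : G →* ℂˣ) (ℓ : ℂ) : Representation ℂ G (Vacuum (A.kerForm φ) ℓ) where
  toFun g := Vacuum.powL0 _ ℓ (φ g)⁻¹ ∘ₗ
    Vacuum.induced _ ℓ (A.kerAct φ g) (A.kerAct_lie φ g) (A.kerAct_form φ g)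
  map_one' := LinearMap.ext fun v => by
    refine (Vacuum.twist_comp _ ℓ _ _ _ _ _ _ _ _ 1 LinearMap.id (fun _ _ => rfl)
      (fun _ _ => rfl) (by simp) ?_ v).trans (Vacuum.twist_id _ ℓ v)
    rw [map_one]; rfl
  map_mul' g h := LinearMap.ext fun v => by
    let t (c : ℂˣ) (g : G) := Vacuum.twist (A.kerForm φ) ℓ c (A.kerAct φ g) (A.kerAct_lie φ g)
      (A.kerAct_form φ g)
    have key (g : G) (v) : (Vacuum.powL0 _ ℓ (φ g)⁻¹ ∘ₗ Vacuum.induced _ ℓ (A.kerAct φ g)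
        (A.kerAct_lie φ g) (A.kerAct_form φ g)) v = t (φ g) g v :=
      Vacuum.twist_comp _ ℓ _ _ _ _ _ _ _ _ _ _ _ _ (by simp) rfl v
    rw [Module.End.mul_apply, key, key, key]
    exact (Vacuum.twist_comp _ ℓ _ _ _ _ _ _ _ _ _ _ _ _ (map_mul φ g h).symm
      (map_mul (A.kerAct φ) g h).symm v).symm

/-- `R_g (a(n) v) = φ(g) ^ n (g a)(n) R_g v`. -/
theorem FormAct.vacuumAct_modeAct {G K : Type*} [Group G] [LieRing K] [LieAlgebra ℂ K]
    {F : InvForm K} (A : FormAct G F) (φ : G →* ℂˣ) (ℓ : ℂ) (g : G) (n : ℤ) (a : A.KerCoinv φ)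
    (v : Vacuum (A.kerForm φ) ℓ) :
    A.vacuumAct φ ℓ g (Vacuum.modeAct _ ℓ n a v) =
      ((φ g ^ n : ℂˣ) : ℂ) • Vacuum.modeAct _ ℓ n (A.kerAct φ g a) (A.vacuumAct φ ℓ g v) := by
  have key (v) : A.vacuumAct φ ℓ g v = Vacuum.twist (A.kerForm φ) ℓ (φ g) (A.kerAct φ g)
      (A.kerAct_lie φ g) (A.kerAct_form φ g) v :=
    Vacuum.twist_comp _ ℓ _ _ _ _ _ _ _ _ _ _ _ _ (by simp) rfl v
  rw [key, key, Vacuum.twist_modeAct]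

/-! ## Vertex algebras, `Γ`-vertex algebras and quasimodules

`VertexOperator ℂ W` is `Hom(W, W((x)))`; for `a(x) = ∑ aₙ x ^ (-n-1)` the coefficient `aₙ` is
`a[[n]]`. A formal series in `x₁, x₂` (and `x₀`) is represented by the function sending `p, q`
(and `r`) to the coefficient of `x₁ ^ (-p-1) x₂ ^ (-q-1)` (times `x₀ ^ (-r-1)`). -/

section VertexAlgebra

variable {V W : Type*} [AddCommGroup V] [Module ℂ V] [AddCommGroup W] [Module ℂ W]

/-- The coefficients of `x₀⁻¹ δ((x₁ - x₂) / x₀) a(x₁) b(x₂) w`, where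
`x₀⁻¹ δ((x₁ - x₂) / x₀) = ∑ r, x₀ ^ (-r-1) (x₁ - x₂) ^ r` and `(x₁ - x₂) ^ r` is expanded in
nonnegative powers of `x₂`. The sum over `i` is finite because `b(x₂) w ∈ W((x₂))`. -/
def jacobiFirst (a b : VertexOperator ℂ W) (w : W) (r p q : ℤ) : W :=
  ∑ᶠ i : ℕ, ((-1 : ℂ) ^ i * (Ring.choose r i : ℤ)) • (a[[p + r - i]]) ((b[[q + i]]) w)

/-- The coefficients of `x₀⁻¹ δ((x₂ - x₁) / (-x₀)) b(x₂) a(x₁) w`, where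
`x₀⁻¹ δ((x₂ - x₁) / (-x₀)) = ∑ r, (-1) ^ r x₀ ^ (-r-1) (x₂ - x₁) ^ r` and `(x₂ - x₁) ^ r` is
expanded in nonnegative powers of `x₁`. -/
def jacobiSecond (a b : VertexOperator ℂ W) (w : W) (r p q : ℤ) : W :=
  ∑ᶠ i : ℕ, ((-1 : ℂ) ^ r * (-1 : ℂ) ^ i * (Ring.choose r i : ℤ)) •
    (b[[q + r - i]]) ((a[[p + i]]) w)

/-- The coefficients of `x₂⁻¹ δ((x₁ - x₀) / x₂) Y_W(Y(u, x₀) v, x₂) w`, where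
`x₂⁻¹ δ((x₁ - x₀) / x₂) = ∑ n, x₂ ^ (-n-1) (x₁ - x₀) ^ n` and `(x₁ - x₀) ^ n` is expanded in
nonnegative powers of `x₀`; with `n = i - p - 1` one has `(-1) ^ i (n choose i) = (p choose i)`. -/
def jacobiThird (Y : V →ₗ[ℂ] VertexOperator ℂ V) (YW : V →ₗ[ℂ] VertexOperator ℂ W)
    (u v : V) (w : W) (r p q : ℤ) : W :=
  ∑ᶠ i : ℕ, ((Ring.choose p i : ℤ) : ℂ) • ((YW (((Y u)[[r + i]]) v))[[p + q - i]]) w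

/-- The product `P(x₁, x₂) D(x₁, x₂)` of a polynomial and a formal series. -/
def polyMul {M : Type*} [AddCommGroup M] [Module ℂ M] (P : MvPolynomial (Fin 2) ℂ)
    (D : ℤ → ℤ → M) (p q : ℤ) : M :=
  ∑ s ∈ P.support, P.coeff s • D (p + s 0) (q + s 1)

/-- The commutator `[a(x₁), b(x₂)]`. -/
def voCommutator (a b : VertexOperator ℂ W) (p q : ℤ) : Module.End ℂ W :=
  a[[p]] * b[[q]] - b[[q]] * a[[p]]

/-- A vertex algebra structure on `V`: the Jacobi identity is stated coefficientwise. -/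
@[ext]
structure VertexAlgebra (V : Type*) [AddCommGroup V] [Module ℂ V] where
  vac : V
  Y : V →ₗ[ℂ] VertexOperator ℂ V
  /-- `Y(𝟏, x) = 1` -/
  Y_vac : ∀ (n : ℤ) (v : V), ((Y vac)[[n]]) v = if n = -1 then v else 0
  /-- `Y(v, x) 𝟏 ∈ V[[x]]` with constant term `v` -/
  creation : ∀ v : V, (∀ n : ℤ, 0 ≤ n → ((Y v)[[n]]) vac = 0) ∧ ((Y v)[[-1]]) vac = v
  jacobi : ∀ (u v w : V) (r p q : ℤ),
    jacobiFirst (Y u) (Y v) w r p q - jacobiSecond (Y u) (Y v) w r p q =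
      jacobiThird Y Y u v w r p q

/-- A quasimodule `(W, Y_W)` for a vertex algebra. -/
structure VertexAlgebra.IsQuasimodule (𝒱 : VertexAlgebra V)
    (YW : V →ₗ[ℂ] VertexOperator ℂ W) : Prop where
  Y_vac : ∀ (n : ℤ) (w : W), ((YW 𝒱.vac)[[n]]) w = if n = -1 then w else 0
  quasiJacobi : ∀ u v : V, ∃ P : MvPolynomial (Fin 2) ℂ, P ≠ 0 ∧ ∀ (w : W) (r p q : ℤ),
    polyMul P (jacobiFirst (YW u) (YW v) w r) p q -
      polyMul P (jacobiSecond (YW u) (YW v) w r) p q =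
        polyMul P (jacobiThird 𝒱.Y YW u v w r) p q

variable {G : Type*} [Group G]

/-- `V` with `R : G → GL(V)` and `φ : G → ℂˣ` is a `G`-vertex algebra: `R_g 𝟏 = 𝟏` and
`R_g Y(v, x) R_g⁻¹ = Y(R_g v, φ(g)⁻¹ x)`. -/
structure VertexAlgebra.IsGroupVertexAlgebra (𝒱 : VertexAlgebra V) (R : Representation ℂ G V)
    (φ : G →* ℂˣ) : Prop where
  map_vac : ∀ g, R g 𝒱.vac = 𝒱.vac
  conj : ∀ g v (n : ℤ), R g * (𝒱.Y v)[[n]] * R g⁻¹ =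
    (((φ g)⁻¹ ^ (-n - 1) : ℂˣ) : ℂ) • (𝒱.Y (R g v))[[n]]

/-- A quasimodule for the `G`-vertex algebra `(V, R, φ)`: a quasimodule for the vertex algebra `V`
with `Y_W(R_g v, x) = Y_W(v, φ(g) x)` such that for all `u, v` there are `α₁, …, α_k ∈ φ(G)` with
`(x₁ - α₁ x₂) ⋯ (x₁ - α_k x₂) [Y_W(u, x₁), Y_W(v, x₂)] = 0`. -/
structure VertexAlgebra.IsGroupQuasimodule (𝒱 : VertexAlgebra V) (R : Representation ℂ G V)
    (φ : G →* ℂˣ) (YW : V →ₗ[ℂ] VertexOperator ℂ W) : Prop extends 𝒱.IsQuasimodule YW where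
  equivariant : ∀ g v (n : ℤ), (YW (R g v))[[n]] = ((φ g ^ (-n - 1) : ℂˣ) : ℂ) • (YW v)[[n]]
  gammaLocal : ∀ u v : V, ∃ l : List ℂˣ, (∀ α ∈ l, α ∈ φ.range) ∧
    polyMul (l.map fun α : ℂˣ =>
        (MvPolynomial.X 0 - MvPolynomial.C (α : ℂ) * MvPolynomial.X 1 :
          MvPolynomial (Fin 2) ℂ)).prod
      (voCommutator (YW u) (YW v)) = 0

end VertexAlgebra

/-- The characterization of the affine vertex algebra structure on `V(ℓ, 0)`: the vacuum vector is
`𝟏` and `Y(a, x) = a(x) = ∑ a(n) x ^ (-n-1)` for `a ∈ K`. -/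
structure IsAffineVertexAlgebra {K : Type*} [LieRing K] [LieAlgebra ℂ K] (F : InvForm K) (ℓ : ℂ)
    (𝒱 : VertexAlgebra (Vacuum F ℓ)) : Prop where
  vac_eq : 𝒱.vac = Vacuum.one F ℓ
  Y_state : ∀ (a : K) (n : ℤ) (v : Vacuum F ℓ),
    ((𝒱.Y (Vacuum.state F ℓ a))[[n]]) v = Vacuum.modeAct F ℓ n a v

namespace FormAct

variable {G K : Type*} [Group G] [LieRing K] [LieAlgebra ℂ K] {F : InvForm K}
  (A : FormAct G F) (φ : G →* ℂˣ)

/-- The image of `a ⊗ t ^ n` in `K̂[G]`. -/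
def twistedMode (n : ℤ) (a : K) : A.TwistedAffine φ :=
  (A.affineAct φ).toCoinv (Affine.mode F n a)

/-- The image of `𝐤` in `K̂[G]`. -/
def twistedCentral : A.TwistedAffine φ := (A.affineAct φ).toCoinv (Affine.central F)

/-- The `K̂[G]`-module `W` is restricted, i.e. `a_W(x) = ∑ a(n) x ^ (-n-1)` is in
`Hom(W, W((x)))` for all `a ∈ K`, and of level `ℓ`, i.e. `𝐤` acts as the scalar `ℓ`. -/
structure IsRestrictedOfLevel {W : Type*} [AddCommGroup W] [Module ℂ W] (ℓ : ℂ)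
    (π : A.TwistedAffine φ →ₗ⁅ℂ⁆ Module.End ℂ W) : Prop where
  restricted : ∀ (a : K) (w : W), ∃ N : ℤ, ∀ n, N ≤ n → π (A.twistedMode φ n a) w = 0
  level : ∀ w : W, π (A.twistedCentral φ) w = ℓ • w

/-- The element `ā = ā(-1) 𝟏` of `V(ℓ, 0)` for the affine Lie algebra of `K / ker φ`, where `ā`
is the image of `a ∈ K` in `K / ker φ`. -/
def barState (ℓ : ℂ) (a : K) : Vacuum (A.kerForm φ) ℓ :=
  Vacuum.state (A.kerForm φ) ℓ ((A.restrict φ.ker).toCoinv a)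

end FormAct

/-- The action on `K` of a subgroup `Γ` of `Aut(K, ⟨·,·⟩)` satisfying the finiteness condition. -/
def InvForm.subgroupAct {K : Type*} [LieRing K] [LieAlgebra ℂ K] (F : InvForm K)
    (Γ : Subgroup F.aut)
    (hΓ : ∀ a b : K, {g : Γ | ⁅(g : K ≃ₗ[ℂ] K) a, b⁆ ≠ 0}.Finite ∧
      {g : Γ | F.form ((g : K ≃ₗ[ℂ] K) a) b ≠ 0}.Finite) : FormAct Γ F where
  ρ :=
    { toFun := fun g => ((g : K ≃ₗ[ℂ] K) : K →ₗ[ℂ] K)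
      map_one' := rfl
      map_mul' := fun _ _ => rfl }
  map_lie g := g.1.2.1
  finite_lie a b := (hΓ a b).1
  map_form g := g.1.2.2
  finite_form a b := (hΓ a b).2

end

/-!
A restricted module for the twisted affine Lie algebra and a quasimodule for the affine vertex
algebra of `K / ker φ` are the same thing as an equivariant family of fields with a prescribed
commutator. What has to be shown is that the commutators in the two cases determine each other,
and that such a family extends from the generators to all of `V(ℓ, 0)`.

The fields are quasi-local: the kernel `(x₁ - x₂) ^ r a(x₁) b(x₂) - (-x₂ + x₁) ^ r b(x₂) a(x₁)`
(`jac`) is annihilated by a Laurent polynomial in `T = x₁ / x₂`, so that it is supported on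
finitely many lines `x₁ = α x₂`. The part on the diagonal `α = 1` is cut out by multiplying with a
Laurent polynomial which vanishes at the other poles and agrees with `1` to high order at `T = 1`
(`exists_multiplier`). The residues of this localized kernel are the products `aₙ b` of the fields
(`prodN`), and they do not depend on the multiplier.

Applying the same localization to the kernels of three fields, where
`[[a, b], c] = [a, [b, c]] - [b, [a, c]]`, yields Dong's lemma (`LocalOn.prodN_left`) and the
Borcherds identity (`LocalOn.borcherds`) for these products. Therefore, if fields `A a` have the
products of the generators of an affine vertex algebra (`IsAffineFields`), the operators
`c ↦ (A a)ₙ c` make the fields that are local to all `A a` into a module for the affine Lie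
algebra, in which the identity field is a vacuum vector; the universal property of the induced
module `V(ℓ, 0)` gives a linear map from `V(ℓ, 0)` to fields which carries vertex operators to
products (`IsAffineFields.fieldMap_prodN`). For the fields `a(x)` on `V(ℓ, 0)` itself, this is the
vertex algebra structure. For fields on `W`, it is a quasimodule structure, because up to factors
`x₁ - α x₂` with `α ≠ 1` the localized kernel is the kernel (`LocalOn.exists_quasiJacobi`).
Conversely, the Jacobi identity up to a nonzero polynomial forces `Y_W(uₙ v)` to be the product of
the fields of `u` and `v` (`eq_prodN_of_quasiJacobi`), since a polynomial that is nonzero on the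
diagonal acts injectively on the coefficients there; this gives uniqueness, and the products of
the generating fields of a quasimodule.

It remains to compare commutators. In the commutator of the twisted affine Lie algebra, the term
of `g ∈ Γ` is supported on the line `x₁ = φ(g) x₂`, and the terms on the diagonal, those with
`g ∈ ker φ`, add up to the bracket and the form of `K / ker φ` (`FormAct.twistedComm_localize`).
In the other direction, the diagonal part of the commutator determines all of it, because
equivariance moves every line `x₁ = φ(g) x₂` to the diagonal
(`IsAffineFields.jac_eq_twistedComm`).
-/

set_option linter.unusedSectionVars false

open scoped LaurentPolynomial
open Filter

/-! ### Binomial coefficients and three-term recursions -/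

/-- The coefficient of `y ^ t` in `(1 - y) ^ r`, for `r ∈ ℤ`. -/
noncomputable def bin (r : ℤ) (t : ℕ) : ℂ := (-1 : ℂ) ^ t * (Ring.choose r t : ℤ)

theorem bin_zero_right (r : ℤ) : bin r 0 = 1 := by simp [bin]

theorem bin_zero_succ (t : ℕ) : bin 0 (t + 1) = 0 := by
  simp [bin, Ring.choose_zero_succ]

theorem bin_succ_succ (r : ℤ) (t : ℕ) : bin (r + 1) (t + 1) = bin r (t + 1) - bin r t := by
  simp only [bin, Ring.choose_succ_succ]
  push_cast
  ring

theorem bin_neg_one (t : ℕ) : bin (-1) t = 1 := by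
  induction t with
  | zero => exact bin_zero_right _
  | succ t ih =>
    have := bin_succ_succ (-1) t
    rw [neg_add_cancel, bin_zero_succ, ih] at this
    linear_combination -this

theorem succ_mul_choose (s : ℤ) (k : ℕ) :
    ((k : ℤ) + 1) * Ring.choose s (k + 1) = (s - k) * Ring.choose s k := by
  have := Ring.choose_smul_choose s (Nat.le_succ k)
  simp at this
  linarith

theorem eventually_finsum_eq_sum {M : Type*} [AddCommMonoid M] {f : ℕ → M}
    (hf : ∃ N, ∀ n, N ≤ n → f n = 0) : ∀ᶠ n : ℕ in atTop, ∑ᶠ i, f i = ∑ i ∈ Finset.range n, f i := by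
  obtain ⟨N, hN⟩ := hf
  filter_upwards [eventually_ge_atTop N] with n hn
  refine finsum_eq_sum_of_support_subset _ fun i hi => ?_
  simp only [Finset.coe_range, Set.mem_Iio]
  by_contra h
  exact hi (hN i (by omega))

/-- A family `H k l m` that satisfies Pascal's recursion and vanishes for large `m` is determined
by its values at `k = 0`. This is the common source of all Taylor expansions of kernels below. -/
theorem pascal_expand {M : Type*} [AddCommGroup M] [Module ℂ M] {H : ℤ → ℤ → ℤ → M} {m₀ : ℤ}
    (hrec : ∀ k l m, H (k + 1) l m = H k (l + 1) m + H k l (m + 1))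
    (hvan : ∀ k l m, m₀ ≤ m → H k l m = 0) (n : ℕ) :
    ∀ k l m : ℤ, m₀ ≤ m + n →
    H k l m = ∑ i ∈ Finset.range n, ((Ring.choose k i : ℤ) : ℂ) • H 0 (l + k - i) (m + i) := by
  induction n with
  | zero => intro k l m h; simpa using hvan k l m (by simpa using h)
  | succ n ih =>
    intro k l m h
    set D : ℤ → ℤ → M := fun k l => H k l m -
      ∑ i ∈ Finset.range (n + 1), ((Ring.choose k i : ℤ) : ℂ) • H 0 (l + k - i) (m + i) with hD
    have hstep : ∀ k l, D (k + 1) l = D k (l + 1) := by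
      intro k l
      simp only [hD]
      rw [hrec, ih k l (m + 1) (by push_cast at h; linarith), Finset.sum_range_succ' _ n,
        Finset.sum_range_succ' _ n]
      have e1 : ∀ i : ℕ, l + (k + 1) - ((i + 1 : ℕ) : ℤ) = l + k - i := fun i => by
        push_cast; ring
      have e2 : ∀ i : ℕ, l + 1 + k - ((i + 1 : ℕ) : ℤ) = l + k - i := fun i => by
        push_cast; ring
      have e3 : ∀ i : ℕ, m + 1 + (i : ℤ) = m + ((i + 1 : ℕ) : ℤ) := fun i => by
        push_cast; ring
      simp only [e1, e2, e3, Ring.choose_succ_succ, Int.cast_add, add_smul, Finset.sum_add_distrib]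
      have e4 : l + (k + 1) - ((0 : ℕ) : ℤ) = l + 1 + k - ((0 : ℕ) : ℤ) := by ring
      rw [e4]
      simp only [Ring.choose_zero_right]
      abel
    have h0 : ∀ l, D 0 l = 0 := by
      intro l
      simp only [hD]
      rw [Finset.sum_range_succ' _ n, Finset.sum_eq_zero]
      · simp
      · intro i _
        simp [Ring.choose_zero_succ]
    have hall : ∀ k l, D k l = 0 := by
      intro k
      induction k using Int.induction_on with
      | zero => exact h0
      | succ k ihk => intro l; rw [hstep]; exact ihk _
      | pred k ihk =>
        intro l
        have := hstep (-(k : ℤ) - 1) (l - 1)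
        rw [sub_add_cancel, sub_add_cancel] at this
        rw [← this]; exact ihk _
    exact sub_eq_zero.1 (hall k l)

/-! ### Shift operators and Laurent polynomials -/

section Shift

variable {G W W' : Type*} [AddCommGroup G] [AddCommGroup W] [Module ℂ W] [AddCommGroup W']
  [Module ℂ W']

/-- The group algebra `ℂ[G]` acting on functions on `G` by translations. For `G = ℤⁿ`, a function
stands for the series with coefficients at `x₁ ^ (-n₁-1) x₂ ^ (-n₂-1) ⋯`, so that the translation by
`v` is the multiplication by `x ^ v`. -/
noncomputable def act : AddMonoidAlgebra ℂ G →ₐ[ℂ] Module.End ℂ (G → W) :=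
  AddMonoidAlgebra.lift ℂ (Module.End ℂ (G → W)) G
    { toFun := fun v =>
        { toFun := fun F n => F (n + v.toAdd)
          map_add' := fun _ _ => rfl
          map_smul' := fun _ _ => rfl }
      map_one' := by ext F n; simp
      map_mul' := fun v w => by ext F n; simp [add_assoc] }

theorem act_single (v : G) (c : ℂ) (F : G → W) (n : G) :
    act (AddMonoidAlgebra.single v c) F n = c • F (n + v) := by
  rw [act, AddMonoidAlgebra.lift_single]; rfl

theorem act_mul (x y : AddMonoidAlgebra ℂ G) (F : G → W) : act (x * y) F = act x (act y F) := by
  rw [map_mul]; rfl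

theorem act_comm (x y : AddMonoidAlgebra ℂ G) (F : G → W) :
    act x (act y F) = act y (act x F) := by
  rw [← act_mul, mul_comm, act_mul]

theorem act_one (F : G → W) : act 1 F = F := by rw [map_one]; rfl

theorem act_add (x y : AddMonoidAlgebra ℂ G) (F : G → W) :
    act (x + y) F = act x F + act y F := by
  rw [map_add]; rfl

theorem act_sub (x y : AddMonoidAlgebra ℂ G) (F : G → W) :
    act (x - y) F = act x F - act y F := by
  rw [map_sub]; rfl

theorem act_apply (x : AddMonoidAlgebra ℂ G) (F : G → W) (n : G) :
    act x F n = x.coeff.sum fun v c => c • F (n + v) := by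
  rw [act, AddMonoidAlgebra.lift_apply, Finsupp.sum, LinearMap.sum_apply, Finset.sum_apply]
  rfl

/-- The substitution of the translation by `v` in a Laurent polynomial. -/
noncomputable def tau (v : G) : ℂ[T;T⁻¹] →ₐ[ℂ] AddMonoidAlgebra ℂ G :=
  AddMonoidAlgebra.mapDomainAlgHom ℂ ℂ (zmultiplesHom G v)

theorem tau_single (v : G) (s : ℤ) (c : ℂ) :
    tau v (AddMonoidAlgebra.single s c) = AddMonoidAlgebra.single (s • v) c :=
  AddMonoidAlgebra.mapDomain_single

theorem act_tau_apply (v : G) (g : ℂ[T;T⁻¹]) (F : G → W) (n : G) :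
    act (tau v g) F n = g.coeff.sum fun s c => c • F (n + s • v) := by
  induction g using AddMonoidAlgebra.induction_linear with
  | zero => simp
  | add f g hf hg =>
    rw [map_add, act_add, Pi.add_apply, hf, hg, AddMonoidAlgebra.coeff_add,
      Finsupp.sum_add_index'] <;> intros <;> simp [add_smul]
  | single s c => 
    rw [tau_single, act_single, AddMonoidAlgebra.coeff_single, Finsupp.sum_single_index]
    simp

end Shift

/-! ### Divisibility of Laurent polynomials by powers of `T - 1` -/

section Laurent

open LaurentPolynomial

/-- The Laurent polynomial `T - 1`, whose zero is the diagonal `x₁ = x₂` when `T = x₁ / x₂`. -/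
noncomputable def tOne : ℂ[T;T⁻¹] := T 1 - 1

/-- The diagonal operator `∑ cₛ Tˢ ↦ ∑ χ(s) cₛ Tˢ`. -/
noncomputable def theta (χ : ℤ → ℂ) : ℂ[T;T⁻¹] →ₗ[ℂ] ℂ[T;T⁻¹] :=
  (AddMonoidAlgebra.basis ℤ ℂ).constr ℂ fun s => AddMonoidAlgebra.single s (χ s)

theorem theta_single (χ : ℤ → ℂ) (s : ℤ) (c : ℂ) :
    theta χ (AddMonoidAlgebra.single s c) = AddMonoidAlgebra.single s (χ s * c) := by
  have h : (AddMonoidAlgebra.single s c : ℂ[T;T⁻¹]) = c • AddMonoidAlgebra.basis ℤ ℂ s := by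
    rw [AddMonoidAlgebra.basis_apply, AddMonoidAlgebra.smul_single', mul_one]
  rw [h, map_smul, theta, Module.Basis.constr_basis, AddMonoidAlgebra.smul_single', mul_comm]

theorem theta_ext {χ : ℤ → ℂ} {L : ℂ[T;T⁻¹] →ₗ[ℂ] ℂ[T;T⁻¹]}
    (h : ∀ s c, L (AddMonoidAlgebra.single s c) = AddMonoidAlgebra.single s (χ s * c))
    (g : ℂ[T;T⁻¹]) : L g = theta χ g := by
  induction g using AddMonoidAlgebra.induction_linear with
  | zero => simp only [map_zero]
  | add f g hf hg => rw [map_add, map_add, hf, hg]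
  | single s c => rw [h, theta_single]

theorem theta_one_fun (g : ℂ[T;T⁻¹]) : theta (fun _ => 1) g = g :=
  (theta_ext (L := LinearMap.id) (fun s c => by rw [one_mul]; rfl) g).symm

theorem sum_theta {M : Type*} [AddCommGroup M] [Module ℂ M] (χ : ℤ → ℂ) (g : ℂ[T;T⁻¹])
    (f : ℤ → M) : ((theta χ g).coeff.sum fun s c => c • f s) =
      g.coeff.sum fun s c => (χ s * c) • f s := by
  induction g using AddMonoidAlgebra.induction_linear with
  | zero => simp
  | add g h hg hh =>
    rw [map_add, AddMonoidAlgebra.coeff_add, AddMonoidAlgebra.coeff_add, Finsupp.sum_add_index',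
      Finsupp.sum_add_index', hg, hh] <;> intros <;> simp [mul_add, add_smul]
  | single s c =>
    rw [theta_single, AddMonoidAlgebra.coeff_single, AddMonoidAlgebra.coeff_single,
      Finsupp.sum_single_index, Finsupp.sum_single_index] <;> simp

/-- The Euler operator `T d/dT` is a derivation. -/
theorem euler_mul (f g : ℂ[T;T⁻¹]) :
    theta (fun s => s) (f * g) = theta (fun s => s) f * g + f * theta (fun s => s) g := by
  induction f using AddMonoidAlgebra.induction_linear with
  | zero => simp only [zero_mul, map_zero, add_zero]
  | add f f' hf hf' => rw [add_mul, map_add, hf, hf', map_add]; ring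
  | single s c =>
    induction g using AddMonoidAlgebra.induction_linear with
    | zero => simp only [mul_zero, map_zero, add_zero]
    | add f f' hf hf' => rw [mul_add, map_add, hf, hf', map_add]; ring
    | single t d =>
      rw [AddMonoidAlgebra.single_mul_single, theta_single, theta_single, theta_single,
        AddMonoidAlgebra.single_mul_single, AddMonoidAlgebra.single_mul_single,
        ← AddMonoidAlgebra.single_add]
      congr 1
      push_cast
      ring

theorem pow_dvd_derivation {A : Type*} [CommRing A] {D : A → A}
    (hD : ∀ f g, D (f * g) = D f * g + f * D g) (p : A) (K : ℕ) (x : A) :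
    p ^ K ∣ D (p ^ (K + 1) * x) := by
  induction K generalizing x with
  | zero => simp
  | succ K ih =>
    rw [pow_succ' p (K + 1), mul_assoc, hD]
    refine dvd_add ((dvd_mul_right (p ^ (K + 1)) x).mul_left _) ?_
    have h := mul_dvd_mul_left p (ih x)
    rwa [← pow_succ' p K] at h

/-- The Euler operator lowers orders of vanishing by at most `1`. -/
theorem pow_pred_dvd_euler {p g : ℂ[T;T⁻¹]} {K : ℕ} (h : p ^ K ∣ g) :
    p ^ (K - 1) ∣ theta (fun s => s) g := by
  rcases K with _ | K
  · simp
  · obtain ⟨x, rfl⟩ := h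
    exact pow_dvd_derivation euler_mul p K x

/-- If `u` agrees with `1` to order `M` at `T = 1`, then its Taylor coefficients there (computed
with `χ k s` equal to `s choose k` or `-s choose k`) vanish to order `M - k` for `1 ≤ k`. -/
theorem pow_dvd_theta {χ : ℕ → ℤ → ℂ} (h0 : ∀ s, χ 0 s = 1) (h1 : χ 1 0 = 0)
    (hstep : ∀ k, ∃ α β : ℂ, ∀ s, χ (k + 1) s = (α * s + β) * χ k s) {u : ℂ[T;T⁻¹]} {M : ℕ}
    (hu : tOne ^ M ∣ u - 1) (k : ℕ) : tOne ^ (M - (k + 1)) ∣ theta (χ (k + 1)) u := by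
  induction k with
  | zero =>
    obtain ⟨α, β, h⟩ := hstep 0
    have hβ : β = 0 := by simpa [h1, h0] using (h 0).symm
    have e1 : theta (fun s => (s : ℂ)) (1 : ℂ[T;T⁻¹]) = 0 := by
      rw [← single_zero_one_eq_one, theta_single]; simp
    have e : theta (χ (0 + 1)) u = α • theta (fun s => (s : ℂ)) (u - 1) := by
      rw [map_sub, e1, sub_zero]
      refine (theta_ext (L := α • theta (fun s => (s : ℂ))) (fun s c => ?_) u).symm
      rw [LinearMap.smul_apply, theta_single, AddMonoidAlgebra.smul_single', h, hβ, h0]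
      congr 1; ring
    rw [e]
    exact (pow_pred_dvd_euler hu).trans (Dvd.intro_left (C α) (by rw [smul_eq_C_mul]))
  | succ k ih =>
    obtain ⟨α, β, h⟩ := hstep (k + 1)
    have e : theta (χ (k + 1 + 1)) u =
        α • theta (fun s => (s : ℂ)) (theta (χ (k + 1)) u) + β • theta (χ (k + 1)) u := by
      refine (theta_ext (L := α • theta (fun s => (s : ℂ)) ∘ₗ theta (χ (k + 1)) +
        β • theta (χ (k + 1))) (fun s c => ?_) u).symm
      rw [LinearMap.add_apply, LinearMap.smul_apply, LinearMap.smul_apply, LinearMap.comp_apply,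
        theta_single, theta_single, AddMonoidAlgebra.smul_single', AddMonoidAlgebra.smul_single',
        ← AddMonoidAlgebra.single_add, h]
      congr 1; ring
    rw [e, smul_eq_C_mul, smul_eq_C_mul]
    refine dvd_add (Dvd.dvd.mul_left ?_ _) (Dvd.dvd.mul_left ?_ _)
    · exact pow_pred_dvd_euler (K := M - (k + 1)) ih
    · exact (pow_dvd_pow _ (by omega)).trans ih

theorem choose_pos_step (k : ℕ) : ∃ α β : ℂ, ∀ s : ℤ,
    ((Ring.choose s (k + 1) : ℤ) : ℂ) = (α * s + β) * (Ring.choose s k : ℤ) := by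
  refine ⟨((k : ℂ) + 1)⁻¹, -(k : ℂ) * ((k : ℂ) + 1)⁻¹, fun s => ?_⟩
  have h := congrArg (Int.cast (R := ℂ)) (succ_mul_choose s k)
  have hk : (k : ℂ) + 1 ≠ 0 := Nat.cast_add_one_ne_zero k
  push_cast at h
  field_simp
  linear_combination h

theorem choose_neg_step (k : ℕ) : ∃ α β : ℂ, ∀ s : ℤ,
    ((Ring.choose (-s) (k + 1) : ℤ) : ℂ) = (α * s + β) * (Ring.choose (-s) k : ℤ) := by
  obtain ⟨α, β, h⟩ := choose_pos_step k
  exact ⟨-α, β, fun s => by rw [h]; push_cast; ring⟩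

/-- A multiplier that agrees with `1` to order `M` on the diagonal and vanishes to order `K` at all
zeros of `G`. -/
theorem exists_multiplier {G : ℂ[T;T⁻¹]} (hG : IsCoprime tOne G) (M K : ℕ) :
    ∃ e : ℂ[T;T⁻¹], G ^ K ∣ e ∧ tOne ^ M ∣ e - 1 := by
  obtain ⟨a, b, h⟩ := hG.pow (m := M) (n := K)
  exact ⟨b * G ^ K, Dvd.intro_left _ rfl, -a, by linear_combination h⟩

theorem isCoprime_T_sub_C {α β : ℂ} (h : α ≠ β) :
    IsCoprime (T 1 - C α : ℂ[T;T⁻¹]) (T 1 - C β) := by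
  refine ⟨-C (α - β)⁻¹, C (α - β)⁻¹, ?_⟩
  have h' : (C (α - β)⁻¹ * C (α - β) : ℂ[T;T⁻¹]) = 1 := by
    rw [← map_mul, inv_mul_cancel₀ (sub_ne_zero.2 h), map_one]
  rw [map_sub] at h'
  linear_combination h'

theorem tOne_eq : tOne = T 1 - C 1 := by rw [map_one]; rfl

theorem pow_tOne_dvd_invert {u : ℂ[T;T⁻¹]} {M : ℕ} (h : tOne ^ M ∣ u - 1) :
    tOne ^ M ∣ invert u - 1 := by
  obtain ⟨x, hx⟩ := h
  have e : invert tOne = -(T (-1)) * tOne := by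
    rw [tOne, map_sub, map_one, invert_T, mul_sub, neg_mul, ← T_add]
    simp
    ring
  have := congrArg invert hx
  rw [map_sub, map_one, map_mul, map_pow, e, mul_pow] at this
  rw [this]
  exact ⟨(-(T (-1))) ^ M * invert x, by ring⟩

end Laurent

/-! ### Expansions of powers of differences -/

section Expansion

variable {G W : Type*} [AddCommGroup G] [AddCommGroup W] [Module ℂ W]

/-- `X` vanishes far out along every ray in direction `v`. -/
def NilAlong (v : G) (X : G → W) : Prop := ∀ n, ∃ N : ℕ, ∀ t : ℕ, N ≤ t → X (n + t • v) = 0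

/-- The operator `(1 - S) ^ r`, expanded in nonnegative powers of the translation `S` by `v`. -/
noncomputable def expand (v : G) (r : ℤ) (X : G → W) (n : G) : W :=
  ∑ᶠ t : ℕ, bin r t • X (n + t • v)

variable {v : G} {X Y : G → W}

theorem expand_eventually (hX : NilAlong v X) (r : ℤ) (n : G) : ∀ᶠ N : ℕ in atTop,
    expand v r X n = ∑ t ∈ Finset.range N, bin r t • X (n + t • v) := by
  obtain ⟨N, hN⟩ := hX n
  exact eventually_finsum_eq_sum ⟨N, fun t ht => by rw [hN t ht, smul_zero]⟩

theorem expand_zero (X : G → W) : expand v 0 X = X := by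
  ext n
  rw [expand, finsum_eq_single _ 0]
  · simp [bin_zero_right]
  · intro t ht
    obtain ⟨t, rfl⟩ := Nat.exists_eq_succ_of_ne_zero ht
    rw [Nat.succ_eq_add_one, bin_zero_succ, zero_smul]

/-- The recursion `(1 - S) ^ (r + 1) = (1 - S) (1 - S) ^ r`. -/
theorem expand_succ (hX : NilAlong v X) (r : ℤ) (n : G) :
    expand v (r + 1) X n = expand v r X n - expand v r X (n + v) := by
  obtain ⟨N, h1, h2, h3⟩ := ((tendsto_add_atTop_nat 1).eventually (expand_eventually hX (r + 1) n)
    |>.and (((tendsto_add_atTop_nat 1).eventually (expand_eventually hX r n)).and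
      (expand_eventually hX r (n + v)))).exists
  rw [h1, h2, h3, Finset.sum_range_succ' _ N, Finset.sum_range_succ' _ N, bin_zero_right,
    bin_zero_right, add_sub_right_comm, ← Finset.sum_sub_distrib]
  congr 1
  refine Finset.sum_congr rfl fun t _ => ?_
  rw [bin_succ_succ, sub_smul, succ_nsmul', add_assoc]

theorem eq_zero_of_nilAlong (hX : NilAlong v X) (h : ∀ n, X n = X (n + v)) : X = 0 := by
  ext n
  obtain ⟨N, hN⟩ := hX n
  have : ∀ t : ℕ, X n = X (n + t • v) := by
    intro t
    induction t with
    | zero => simp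
    | succ t ih => rw [ih, h, add_assoc, succ_nsmul]
  rw [this N, hN N le_rfl]; rfl

theorem NilAlong.sub (hX : NilAlong v X) (hY : NilAlong v Y) : NilAlong v (X - Y) := by
  intro n
  obtain ⟨N, hN⟩ := hX n
  obtain ⟨M, hM⟩ := hY n
  exact ⟨max N M, fun t ht => by
    rw [Pi.sub_apply, hN t (le_of_max_le_left ht), hM t (le_of_max_le_right ht), sub_zero]⟩

/-- The recursion `Z (r + 1) = (1 - S) Z r` and the initial value determine `Z`. -/
theorem expand_unique {Z Z' : ℤ → G → W} (hZ : ∀ r, NilAlong v (Z r)) (hZ' : ∀ r, NilAlong v (Z' r))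
    (h : ∀ r n, Z (r + 1) n = Z r n - Z r (n + v))
    (h' : ∀ r n, Z' (r + 1) n = Z' r n - Z' r (n + v)) (h0 : Z 0 = Z' 0) (r : ℤ) : Z r = Z' r := by
  induction r using Int.induction_on with
  | zero => exact h0
  | succ r ih => ext n; rw [h, h', ih]
  | pred r ih =>
    rw [← sub_eq_zero]
    refine eq_zero_of_nilAlong ((hZ _).sub (hZ' _)) fun n => ?_
    have e := h (-(r : ℤ) - 1) n
    have e' := h' (-(r : ℤ) - 1) n
    rw [sub_add_cancel] at e e'
    rw [ih, e'] at e
    simp only [Pi.sub_apply]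
    rw [← sub_eq_zero] at e ⊢
    rw [← neg_eq_zero, ← e]
    abel

theorem expand_add (hX : NilAlong v X) (hY : NilAlong v Y) (r : ℤ) :
    expand v r (X + Y) = expand v r X + expand v r Y := by
  have hXY : NilAlong v (X + Y) := by
    intro n
    obtain ⟨N, hN⟩ := hX n
    obtain ⟨M, hM⟩ := hY n
    exact ⟨max N M, fun t ht => by
      rw [Pi.add_apply, hN t (le_of_max_le_left ht), hM t (le_of_max_le_right ht), add_zero]⟩
  ext n
  obtain ⟨N, h1, h2, h3⟩ := (expand_eventually hXY r n |>.and ((expand_eventually hX r n).and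
    (expand_eventually hY r n))).exists
  rw [Pi.add_apply, h1, h2, h3, ← Finset.sum_add_distrib]
  simp

theorem expand_smul (c : ℂ) (r : ℤ) (X : G → W) : expand v r (c • X) = c • expand v r X := by
  ext n
  rw [Pi.smul_apply, expand, expand, smul_finsum]
  exact finsum_congr fun t => smul_comm _ _ _

/-- Expansions in two directions commute on a class of functions stable under both. -/
theorem expand_comm {w : G} {𝒯 : (G → W) → Prop} (hv : ∀ X, 𝒯 X → NilAlong v X)
    (hw : ∀ X, 𝒯 X → NilAlong w X) (hev : ∀ r X, 𝒯 X → 𝒯 (expand v r X))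
    (hew : ∀ r X, 𝒯 X → 𝒯 (expand w r X)) (hX : 𝒯 X) (r p : ℤ) :
    expand v r (expand w p X) = expand w p (expand v r X) := by
  refine expand_unique (v := v) (Z := fun r => expand v r (expand w p X))
    (Z' := fun r => expand w p (expand v r X)) (fun r => hv _ (hev _ _ (hew _ _ hX)))
    (fun r => hv _ (hew _ _ (hev _ _ hX))) (fun r n => expand_succ (hv _ (hew _ _ hX)) r n)
    (fun r n => ?_) (by simp only [expand_zero]) r
  refine congrFun (expand_unique (v := w) (Z := fun p => expand w p (expand v (r + 1) X))
    (Z' := fun p n => expand w p (expand v r X) n - expand w p (expand v r X) (n + v))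
    (fun p => hw _ (hew _ _ (hev _ _ hX))) (fun p => ?_)
    (fun p n => expand_succ (hw _ (hev _ _ hX)) p n) (fun p n => ?_) ?_ p) n
  · intro n
    obtain ⟨N, hN⟩ := hw _ (hew p _ (hev r _ hX)) n
    obtain ⟨M, hM⟩ := hw _ (hew p _ (hev r _ hX)) (n + v)
    exact ⟨max N M, fun t ht => by
      change _ - _ = _
      rw [hN t (le_of_max_le_left ht), add_right_comm, hM t (le_of_max_le_right ht), sub_zero]⟩
  · simp only [expand_succ (hw _ (hev _ _ hX)), add_right_comm n w v]
    abel
  · ext n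
    simp only [expand_zero, expand_succ (hv _ hX)]

end Expansion

/-! ### The kernel of a pair of fields -/

section Pair

variable {W : Type*} [AddCommGroup W] [Module ℂ W]

theorem VertexOperator.exists_trunc (a : VertexOperator ℂ W) (w : W) :
    ∃ N : ℤ, ∀ n, N ≤ n → (a[[n]]) w = 0 :=
  ⟨-HahnSeries.order ((HahnModule.of ℂ).symm (a w)), fun n hn =>
    ncoeff_eq_zero_of_lt_order _ _ _ (by omega)⟩

theorem VertexOperator.ext_ncoeff {a b : VertexOperator ℂ W}
    (h : ∀ n w, (a[[n]]) w = (b[[n]]) w) : a = b := by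
  refine HVertexOperator.coeff_inj (funext fun n => LinearMap.ext fun w => ?_)
  rw [coeff_eq_ncoeff, coeff_eq_ncoeff, h]

theorem VertexOperator.ncoeff_add (a b : VertexOperator ℂ W) (n : ℤ) (w : W) :
    ((a + b)[[n]]) w = (a[[n]]) w + (b[[n]]) w := by
  rw [map_add]; rfl

theorem VertexOperator.ncoeff_smul (c : ℂ) (a : VertexOperator ℂ W) (n : ℤ) (w : W) :
    ((c • a)[[n]]) w = c • (a[[n]]) w := by
  rw [map_smul]; rfl

theorem VertexOperator.ncoeff_zero (n : ℤ) (w : W) :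
    ((0 : VertexOperator ℂ W)[[n]]) w = 0 := by
  rw [map_zero]; rfl

theorem VertexOperator.ncoeff_sum {ι : Type*} (s : Finset ι) (a : ι → VertexOperator ℂ W) (n : ℤ)
    (w : W) : ((∑ i ∈ s, a i)[[n]]) w = ∑ i ∈ s, ((a i)[[n]]) w := by
  rw [map_sum, Finset.sum_apply, LinearMap.sum_apply]

/-- The vertex operator with modes `f n`. -/
noncomputable def VertexOperator.ofModes (f : ℤ → Module.End ℂ W)
    (hf : ∀ w, ∃ N : ℤ, ∀ n, N ≤ n → f n w = 0) : VertexOperator ℂ W :=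
  of_coeff (fun n => f (-n - 1)) fun w => by
    obtain ⟨N, hN⟩ := hf w
    refine ⟨-N, fun n hn => ?_⟩
    by_contra h
    exact hn (hN _ (by omega))

theorem VertexOperator.ofModes_ncoeff (f : ℤ → Module.End ℂ W)
    (hf : ∀ w, ∃ N : ℤ, ∀ n, N ≤ n → f n w = 0) (n : ℤ) : (ofModes f hf)[[n]] = f n := by
  rw [ofModes, ncoeff_of_coeff]
  congr 1; ring

/-- The coefficients of `a(x₁) b(x₂) w`. -/
noncomputable def prodFun (a b : VertexOperator ℂ W) (w : W) (n : ℤ × ℤ) : W :=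
  (a[[n.1]]) ((b[[n.2]]) w)

theorem nilAlong_prodFun (a b : VertexOperator ℂ W) (w : W) :
    NilAlong ((-1, 1) : ℤ × ℤ) (prodFun a b w) := by
  rintro ⟨i, j⟩
  obtain ⟨N, hN⟩ := b.exists_trunc w
  refine ⟨(N - j).toNat, fun t ht => ?_⟩
  simp only [prodFun, Prod.smul_mk, Prod.mk_add_mk]
  rw [hN _ (by simp only [nsmul_eq_mul]; omega), map_zero]

theorem jacobiFirst_eq (a b : VertexOperator ℂ W) (w : W) (r p q : ℤ) :
    jacobiFirst a b w r p q = expand ((-1, 1) : ℤ × ℤ) r (prodFun a b w) (p + r, q) := by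
  rw [jacobiFirst, expand]
  refine finsum_congr fun t => ?_
  simp [prodFun, bin, sub_eq_add_neg]

theorem jacobiSecond_eq (a b : VertexOperator ℂ W) (w : W) (r p q : ℤ) :
    jacobiSecond a b w r p q = (-1 : ℂ) ^ r • jacobiFirst b a w r q p := by
  rw [jacobiSecond, jacobiFirst, smul_finsum]
  refine finsum_congr fun t => ?_
  rw [smul_smul, mul_assoc]

/-- The coefficients of the kernel
`(x₁ - x₂) ^ r a(x₁) b(x₂) w - (-x₂ + x₁) ^ r b(x₂) a(x₁) w`. -/
noncomputable def jac (a b : VertexOperator ℂ W) (w : W) (r : ℤ) (n : ℤ × ℤ) : W :=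
  jacobiFirst a b w r n.1 n.2 - jacobiSecond a b w r n.1 n.2

theorem jac_zero (a b : VertexOperator ℂ W) (w : W) (n : ℤ × ℤ) :
    jac a b w 0 n = (a[[n.1]]) ((b[[n.2]]) w) - (b[[n.2]]) ((a[[n.1]]) w) := by
  simp [jac, jacobiSecond_eq, jacobiFirst_eq, expand_zero, prodFun]

theorem jacobiFirst_succ (a b : VertexOperator ℂ W) (w : W) (r p q : ℤ) :
    jacobiFirst a b w (r + 1) p q = jacobiFirst a b w r (p + 1) q - jacobiFirst a b w r p (q + 1) := by
  rw [jacobiFirst_eq, jacobiFirst_eq, jacobiFirst_eq, expand_succ (nilAlong_prodFun a b w)]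
  congr 2 <;> simp <;> ring

theorem jac_succ (a b : VertexOperator ℂ W) (w : W) (r : ℤ) (n : ℤ × ℤ) :
    jac a b w (r + 1) n = jac a b w r (n.1 + 1, n.2) - jac a b w r (n.1, n.2 + 1) := by
  simp only [jac, jacobiSecond_eq, jacobiFirst_succ, zpow_add_one₀ (show (-1 : ℂ) ≠ 0 by simp)]
  simp only [mul_neg_one, neg_smul, smul_sub]
  abel

theorem jac_swap (a b : VertexOperator ℂ W) (w : W) (r p q : ℤ) :
    jac b a w r (q, p) = -((-1 : ℂ) ^ r • jac a b w r (p, q)) := by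
  simp only [jac, jacobiSecond_eq, smul_sub, smul_smul, ← mul_zpow]
  simp

theorem jacobiFirst_add_right (a b b' : VertexOperator ℂ W) (w : W) (r p q : ℤ) :
    jacobiFirst a (b + b') w r p q = jacobiFirst a b w r p q + jacobiFirst a b' w r p q := by
  simp only [jacobiFirst_eq]
  rw [← Pi.add_apply, ← expand_add (nilAlong_prodFun a b w) (nilAlong_prodFun a b' w)]
  congr 1
  ext n
  simp [prodFun]

theorem jacobiFirst_add_left (a a' b : VertexOperator ℂ W) (w : W) (r p q : ℤ) :
    jacobiFirst (a + a') b w r p q = jacobiFirst a b w r p q + jacobiFirst a' b w r p q := by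
  simp only [jacobiFirst_eq]
  rw [← Pi.add_apply, ← expand_add (nilAlong_prodFun a b w) (nilAlong_prodFun a' b w)]
  congr 1

theorem jacobiFirst_add_vec (a b : VertexOperator ℂ W) (w w' : W) (r p q : ℤ) :
    jacobiFirst a b (w + w') r p q = jacobiFirst a b w r p q + jacobiFirst a b w' r p q := by
  simp only [jacobiFirst_eq]
  rw [← Pi.add_apply, ← expand_add (nilAlong_prodFun a b w) (nilAlong_prodFun a b w')]
  congr 1
  ext n
  simp [prodFun]

theorem jacobiFirst_smul_right (c : ℂ) (a b : VertexOperator ℂ W) (w : W) (r p q : ℤ) :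
    jacobiFirst a (c • b) w r p q = c • jacobiFirst a b w r p q := by
  simp only [jacobiFirst_eq]
  rw [← Pi.smul_apply, ← expand_smul]
  congr 1
  ext n
  simp [prodFun]

theorem jacobiFirst_smul_left (c : ℂ) (a b : VertexOperator ℂ W) (w : W) (r p q : ℤ) :
    jacobiFirst (c • a) b w r p q = c • jacobiFirst a b w r p q := by
  simp only [jacobiFirst_eq]
  rw [← Pi.smul_apply, ← expand_smul]
  congr 1

theorem jacobiFirst_smul_vec (c : ℂ) (a b : VertexOperator ℂ W) (w : W) (r p q : ℤ) :
    jacobiFirst a b (c • w) r p q = c • jacobiFirst a b w r p q := by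
  simp only [jacobiFirst_eq]
  rw [← Pi.smul_apply, ← expand_smul]
  congr 1
  ext n
  simp [prodFun]

/-- The kernel as a function which is linear in both fields and in the vector. -/
noncomputable def jacLin (r : ℤ) : VertexOperator ℂ W →ₗ[ℂ] VertexOperator ℂ W →ₗ[ℂ] W →ₗ[ℂ]
    ℤ × ℤ → W :=
  LinearMap.mk₂ ℂ (fun a b =>
      { toFun := fun w => jac a b w r
        map_add' := fun w w' => by
          ext n; simp only [jac, jacobiSecond_eq, jacobiFirst_add_vec, Pi.add_apply, smul_add]; abel
        map_smul' := fun c w => by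
          ext n
          simp only [jac, jacobiSecond_eq, jacobiFirst_smul_vec, Pi.smul_apply, smul_sub,
            RingHom.id_apply, smul_comm c] })
    (fun a a' b => by
      ext w n
      simp only [jac, jacobiSecond_eq, jacobiFirst_add_left, jacobiFirst_add_right,
        LinearMap.coe_mk, AddHom.coe_mk, LinearMap.add_apply, Pi.add_apply, smul_add]
      abel)
    (fun c a b => by
      ext w n
      simp only [jac, jacobiSecond_eq, jacobiFirst_smul_left, jacobiFirst_smul_right,
        LinearMap.coe_mk, AddHom.coe_mk, LinearMap.smul_apply, Pi.smul_apply, smul_sub,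
        smul_comm c])
    (fun a b b' => by
      ext w n
      simp only [jac, jacobiSecond_eq, jacobiFirst_add_left, jacobiFirst_add_right,
        LinearMap.coe_mk, AddHom.coe_mk, LinearMap.add_apply, Pi.add_apply, smul_add]
      abel)
    (fun c a b => by
      ext w n
      simp only [jac, jacobiSecond_eq, jacobiFirst_smul_left, jacobiFirst_smul_right,
        LinearMap.coe_mk, AddHom.coe_mk, LinearMap.smul_apply, Pi.smul_apply, smul_sub,
        smul_comm c])

theorem jacLin_apply (r : ℤ) (a b : VertexOperator ℂ W) (w : W) : jacLin r a b w = jac a b w r := rfl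

/-- For a fixed exponent of `x₁`, the kernel is a Laurent series in `x₂`; hence its residues in `x₁`
are fields. -/
theorem jac_trunc (a b : VertexOperator ℂ W) (w : W) (r i : ℤ) :
    ∃ M : ℤ, ∀ j, M ≤ j → jac a b w r (i, j) = 0 := by
  obtain ⟨N, hN⟩ := b.exists_trunc w
  obtain ⟨L, hL⟩ := a.exists_trunc w
  choose M hM using fun t : ℕ => b.exists_trunc ((a[[i + t]]) w)
  refine ⟨max N ((∑ t ∈ Finset.range (L - i).toNat, |M t|) + (L - i) - r), fun j hj => ?_⟩
  have h1 : jacobiFirst a b w r i j = 0 := by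
    rw [jacobiFirst]
    refine finsum_eq_zero_of_forall_eq_zero fun t => ?_
    rw [hN _ (by have := le_of_max_le_left hj; omega), map_zero, smul_zero]
  have h2 : jacobiSecond a b w r i j = 0 := by
    rw [jacobiSecond]
    refine finsum_eq_zero_of_forall_eq_zero fun t => ?_
    by_cases ht : L ≤ i + t
    · rw [hL _ ht, map_zero, smul_zero]
    · have hs : |M t| ≤ ∑ t ∈ Finset.range (L - i).toNat, |M t| :=
        Finset.single_le_sum (f := fun t => |M t|) (fun _ _ => abs_nonneg _)
          (Finset.mem_range.2 (by omega))
      have := le_abs_self (M t)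
      have := le_of_max_le_right hj
      rw [hM t _ (by omega), smul_zero]
  simp only [jac, h1, h2, sub_zero]

end Pair

/-! ### Products of quasi-local fields -/

section Products

variable {W : Type*} [AddCommGroup W] [Module ℂ W]

/-- Multiplication of a formal series in `x₁, x₂` by a Laurent polynomial in `T = x₁ / x₂`. -/
noncomputable def mulT (g : ℂ[T;T⁻¹]) : Module.End ℂ (ℤ × ℤ → W) := act (tau (1, -1) g)

theorem mulT_apply (g : ℂ[T;T⁻¹]) (F : ℤ × ℤ → W) (i j : ℤ) :
    mulT g F (i, j) = g.coeff.sum fun s c => c • F (i + s, j - s) := by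
  rw [mulT, act_tau_apply]
  simp [sub_eq_add_neg]

theorem mulT_single (s : ℤ) (c : ℂ) (F : ℤ × ℤ → W) (i j : ℤ) :
    mulT (AddMonoidAlgebra.single s c) F (i, j) = c • F (i + s, j - s) := by
  rw [mulT_apply, AddMonoidAlgebra.coeff_single, Finsupp.sum_single_index]
  simp

theorem mulT_mul (g h : ℂ[T;T⁻¹]) (F : ℤ × ℤ → W) : mulT (g * h) F = mulT g (mulT h F) := by
  rw [mulT, map_mul, act_mul]; rfl

theorem mulT_comm (g h : ℂ[T;T⁻¹]) (F : ℤ × ℤ → W) : mulT g (mulT h F) = mulT h (mulT g F) := by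
  rw [← mulT_mul, mul_comm, mulT_mul]

theorem mulT_add (g h : ℂ[T;T⁻¹]) (F : ℤ × ℤ → W) : mulT (g + h) F = mulT g F + mulT h F := by
  rw [mulT, map_add, act_add]; rfl

theorem mulT_sub (g h : ℂ[T;T⁻¹]) (F : ℤ × ℤ → W) : mulT (g - h) F = mulT g F - mulT h F := by
  rw [mulT, map_sub, act_sub]; rfl

theorem mulT_one (F : ℤ × ℤ → W) : mulT 1 F = F := by
  rw [mulT, map_one, act_one]

theorem mulT_tOne (F : ℤ × ℤ → W) (i j : ℤ) :
    mulT tOne F (i, j) = F (i + 1, j - 1) - F (i, j) := by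
  rw [tOne, mulT_sub, mulT_one, Pi.sub_apply, LaurentPolynomial.T, mulT_single, one_smul]

variable {a b c : VertexOperator ℂ W}

/-- The Laurent polynomial `g` annihilates the kernel with exponent `r` of the fields `a, b`. -/
def KillsAt (g : ℂ[T;T⁻¹]) (a b : VertexOperator ℂ W) (r : ℤ) : Prop :=
  ∀ w, mulT g (jac a b w r) = 0

theorem KillsAt.mul_left {g : ℂ[T;T⁻¹]} {r : ℤ} (h : KillsAt g a b r) (g' : ℂ[T;T⁻¹]) :
    KillsAt (g' * g) a b r := fun w => by rw [mulT_mul, h w, map_zero]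

theorem KillsAt.of_dvd {g g' : ℂ[T;T⁻¹]} {r : ℤ} (h : KillsAt g a b r) (hg : g ∣ g') :
    KillsAt g' a b r := by
  obtain ⟨u, rfl⟩ := hg
  rw [mul_comm]
  exact h.mul_left u

theorem KillsAt.add {g g' : ℂ[T;T⁻¹]} {r : ℤ} (h : KillsAt g a b r) (h' : KillsAt g' a b r) :
    KillsAt (g + g') a b r := fun w => by rw [mulT_add, h w, h' w, add_zero]

theorem KillsAt.sub {g g' : ℂ[T;T⁻¹]} {r : ℤ} (h : KillsAt g a b r) (h' : KillsAt g' a b r) :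
    KillsAt (g - g') a b r := fun w => by rw [mulT_sub, h w, h' w, sub_zero]

/-- Multiplication by `(x₁ / x₂ - 1) ^ l` raises the exponent of `x₁ - x₂` by `l`, up to the shift
by `x₂ ^ (-l)`. -/
theorem mulT_tOne_pow_mul {F : ℤ → ℤ × ℤ → W}
    (hF : ∀ r i j, F (r + 1) (i, j) = F r (i + 1, j) - F r (i, j + 1)) (l : ℕ) (g : ℂ[T;T⁻¹])
    (r i j : ℤ) : mulT (tOne ^ l * g) (F r) (i, j) = mulT g (F (r + l)) (i, j - l) := by
  induction l generalizing r j with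
  | zero => simp
  | succ l ih =>
    have : mulT tOne (F r) = fun n => F (r + 1) (n.1, n.2 - 1) := by
      ext ⟨i, j⟩
      rw [mulT_tOne, hF]
      simp
    rw [pow_succ, mul_assoc, mul_comm tOne, ← mul_assoc, mulT_mul, this,
      show r + (l + 1 : ℕ) = r + 1 + l by push_cast; ring,
      show j - (l + 1 : ℕ) = j - 1 - l by push_cast; ring, ← ih, mulT_apply, mulT_apply]
    simp only [sub_right_comm]

theorem mulT_tOne_pow_mul_jac (l : ℕ) (g : ℂ[T;T⁻¹]) (w : W) (r i j : ℤ) :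
    mulT (tOne ^ l * g) (jac a b w r) (i, j) = mulT g (jac a b w (r + l)) (i, j - l) :=
  mulT_tOne_pow_mul (F := jac a b w) (fun r i j => jac_succ a b w r (i, j)) l g r i j

theorem killsAt_tOne_pow_mul {l : ℕ} {g : ℂ[T;T⁻¹]} {r : ℤ} :
    KillsAt (tOne ^ l * g) a b r ↔ KillsAt g a b (r + l) := by
  refine ⟨fun h w => ?_, fun h w => ?_⟩
  · ext ⟨i, j⟩
    have := congrFun (h w) (i, j + l)
    rwa [mulT_tOne_pow_mul_jac, add_sub_cancel_right] at this
  · ext ⟨i, j⟩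
    rw [mulT_tOne_pow_mul_jac, h w]; rfl

theorem KillsAt.mono {g : ℂ[T;T⁻¹]} {r r' : ℤ} (h : KillsAt g a b r) (hr : r ≤ r') :
    KillsAt g a b r' := by
  obtain ⟨l, rfl⟩ := Int.le.dest hr
  exact killsAt_tOne_pow_mul.1 (h.mul_left _)

/-- If the kernel has a pole of order `N` on the diagonal, the kernel with exponent `n` has one of
order `N - n`. -/
theorem KillsAt.of_order {G g : ℂ[T;T⁻¹]} {N l : ℕ} {n : ℤ} (h : KillsAt (tOne ^ N * G) a b 0)
    (hG : G ∣ g) (hn : (N : ℤ) ≤ n + l) : KillsAt (tOne ^ l * g) a b n := by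
  rw [killsAt_tOne_pow_mul] at h ⊢
  exact (h.mono (by omega)).of_dvd hG

theorem KillsAt.of_order_zero {G g : ℂ[T;T⁻¹]} {N : ℕ} {n : ℤ} (h : KillsAt (tOne ^ N * G) a b 0)
    (hG : G ∣ g) (hn : (N : ℤ) ≤ n) : KillsAt g a b n := by
  have := h.of_order (l := 0) hG (by simpa using hn)
  simpa using this

theorem KillsAt.of_coprime {f g h : ℂ[T;T⁻¹]} {r : ℤ} (hf : KillsAt (f * h) a b r)
    (hg : KillsAt (g * h) a b r) (hfg : IsCoprime f g) : KillsAt h a b r := by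
  obtain ⟨u, v, huv⟩ := hfg
  have := (hf.mul_left u).add (hg.mul_left v)
  rwa [show u * (f * h) + v * (g * h) = (u * f + v * g) * h by ring, huv, one_mul] at this

/-- Exchanging the fields replaces `T = x₁ / x₂` by `T⁻¹`. -/
theorem KillsAt.swap {g : ℂ[T;T⁻¹]} {r : ℤ} (h : KillsAt g a b r) :
    KillsAt (LaurentPolynomial.invert g) b a r := by
  have key : ∀ (g : ℂ[T;T⁻¹]) (w : W) (i j : ℤ), mulT (LaurentPolynomial.invert g) (jac b a w r) (i, j) =
      -((-1 : ℂ) ^ r • mulT g (jac a b w r) (j, i)) := by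
    intro g w i j
    induction g using AddMonoidAlgebra.induction_linear with
    | zero => simp [mulT]
    | add f g hf hg =>
      rw [map_add, mulT_add, mulT_add, Pi.add_apply, Pi.add_apply, hf, hg, smul_add, neg_add]
    | single s c =>
      rw [LaurentPolynomial.invert, AddMonoidAlgebra.domCongr_single, mulT_single, mulT_single,
        jac_swap, smul_neg, smul_comm]
      congr 5
      · simp [sub_eq_add_neg]
  intro w
  ext ⟨i, j⟩
  rw [key, h w]
  simp

/-- The field in `x₂` that is the residue in `x₁` of `x₁ ^ i e(x₁ / x₂)` times the kernel with
exponent `r`. -/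
noncomputable def kerField (e : ℂ[T;T⁻¹]) (a b : VertexOperator ℂ W) (i r : ℤ) :
    VertexOperator ℂ W :=
  ofModes (fun j => LinearMap.proj (i, j) ∘ₗ mulT e ∘ₗ jacLin r a b) fun w => by
    choose M hM using fun s : ℤ => jac_trunc a b w r (i + s)
    refine ⟨∑ s ∈ e.coeff.support, |M s + s|, fun j hj => ?_⟩
    change mulT e (jac a b w r) (i, j) = 0
    rw [mulT_apply]
    refine Finset.sum_eq_zero fun s hs => ?_
    have h1 := Finset.single_le_sum (f := fun s => |M s + s|) (fun _ _ => abs_nonneg _) hs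
    have h2 := le_abs_self (M s + s)
    beta_reduce at h1
    beta_reduce
    rw [hM s _ (by omega), smul_zero]

theorem kerField_ncoeff (e : ℂ[T;T⁻¹]) (a b : VertexOperator ℂ W) (i r j : ℤ) (w : W) :
    ((kerField e a b i r)[[j]]) w = mulT e (jac a b w r) (i, j) := by
  rw [kerField, ofModes_ncoeff]; rfl

theorem kerField_congr {e e' : ℂ[T;T⁻¹]} {r : ℤ} (h : KillsAt (e - e') a b r) (i : ℤ) :
    kerField e a b i r = kerField e' a b i r := by
  refine ext_ncoeff fun j w => ?_
  have := congrFun (h w) (i, j)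
  rw [mulT_sub] at this
  rw [kerField_ncoeff, kerField_ncoeff]
  exact sub_eq_zero.1 this

theorem kerField_eq_zero {e : ℂ[T;T⁻¹]} {r : ℤ} (h : KillsAt e a b r) (i : ℤ) :
    kerField e a b i r = 0 := by
  refine ext_ncoeff fun j w => ?_
  rw [kerField_ncoeff, h w, ncoeff_zero]; rfl

/-- The multiplier `e` is admissible for the `n`-th product of `a` and `b`: it vanishes at all poles
of the kernel off the diagonal, and agrees with `1` on the diagonal to sufficiently high order. -/
def Admissible (a b : VertexOperator ℂ W) (n : ℤ) (e : ℂ[T;T⁻¹]) : Prop :=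
  ∃ (N : ℕ) (G : ℂ[T;T⁻¹]) (M : ℕ), IsCoprime tOne G ∧ KillsAt (tOne ^ N * G) a b 0 ∧ G ∣ e ∧
    tOne ^ M ∣ e - 1 ∧ (N : ℤ) ≤ n + M

/-- The residues do not depend on the multiplier. -/
theorem Admissible.kerField_eq {n : ℤ} {e e' : ℂ[T;T⁻¹]} (h : Admissible a b n e)
    (h' : Admissible a b n e') : kerField e a b 0 n = kerField e' a b 0 n := by
  wlog hM : h.choose_spec.choose_spec.choose ≤ h'.choose_spec.choose_spec.choose generalizing e e'
  · exact (this h' h (by omega)).symm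
  obtain ⟨hG, hK, hGe, hMe, hn⟩ := h.choose_spec.choose_spec.choose_spec
  obtain ⟨hG', hK', hGe', hMe', hn'⟩ := h'.choose_spec.choose_spec.choose_spec
  set N := h.choose
  set N' := h'.choose
  set G := h.choose_spec.choose
  set G' := h'.choose_spec.choose
  set M := h.choose_spec.choose_spec.choose
  set M' := h'.choose_spec.choose_spec.choose
  refine kerField_congr ?_ 0
  obtain ⟨s, hs⟩ : tOne ^ M ∣ e - e' := by
    have := dvd_sub hMe ((pow_dvd_pow tOne hM).trans hMe')
    rwa [sub_sub_sub_cancel_right] at this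
  -- `e - e'` is annihilated modulo both `G` and a power of `T - 1`, which are coprime
  have h1 : KillsAt (G * (e - e')) a b n := by
    rw [hs, show G * (tOne ^ M * s) = tOne ^ M * (G * s) by ring]
    exact hK.of_order (Dvd.intro _ rfl) hn
  have h2 : KillsAt (tOne ^ (N + N' + n.natAbs) * (e - e')) a b n := by
    rw [mul_sub]
    exact (hK.of_order hGe (by omega)).sub (hK'.of_order hGe' (by omega))
  exact h2.of_coprime h1 (hG.pow_left)

open Classical in
/-- The `n`-th product `aₙ b` of quasi-local fields, that is, the coefficient of `x₀ ^ (-n-1)` in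
`Y(a, x₀) b`; it is the residue in `x₁` of `(x₁ - x₂) ^ n` times the kernel of `a, b`, localized at
the diagonal by an admissible multiplier (and `0` if there is no such multiplier). -/
noncomputable def prodN (a b : VertexOperator ℂ W) (n : ℤ) : VertexOperator ℂ W :=
  if h : ∃ e, Admissible a b n e then kerField h.choose a b 0 n else 0

theorem prodN_eq {n : ℤ} {e : ℂ[T;T⁻¹]} (h : Admissible a b n e) :
    prodN a b n = kerField e a b 0 n := by
  have h' : ∃ e, Admissible a b n e := ⟨e, h⟩
  rw [prodN, dif_pos h']
  exact h'.choose_spec.kerField_eq h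

/-- The kernel of `a, b` is annihilated by a nonzero Laurent polynomial in `x₁ / x₂`, written with
the pole on the diagonal `T = 1` separated from the other poles. -/
def QuasiLocal (a b : VertexOperator ℂ W) : Prop :=
  ∃ (N : ℕ) (G : ℂ[T;T⁻¹]), IsCoprime tOne G ∧ KillsAt (tOne ^ N * G) a b 0

theorem QuasiLocal.common {a b a' b' : VertexOperator ℂ W} (h : QuasiLocal a b)
    (h' : QuasiLocal a' b') : ∃ (N : ℕ) (G : ℂ[T;T⁻¹]), IsCoprime tOne G ∧
      KillsAt (tOne ^ N * G) a b 0 ∧ KillsAt (tOne ^ N * G) a' b' 0 := by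
  obtain ⟨N, G, hG, h⟩ := h
  obtain ⟨N', G', hG', h'⟩ := h'
  refine ⟨N + N', G * G', hG.mul_right hG', ?_, ?_⟩
  · rw [show tOne ^ (N + N') * (G * G') = tOne ^ N' * G' * (tOne ^ N * G) by ring]
    exact h.mul_left _
  · rw [show tOne ^ (N + N') * (G * G') = tOne ^ N * G * (tOne ^ N' * G') by ring]
    exact h'.mul_left _

theorem KillsAt.add_left {a a' b : VertexOperator ℂ W} {g : ℂ[T;T⁻¹]} {r : ℤ}
    (h : KillsAt g a b r) (h' : KillsAt g a' b r) : KillsAt g (a + a') b r := fun w => by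
  rw [← jacLin_apply, map_add, LinearMap.add_apply, LinearMap.add_apply, map_add, jacLin_apply,
    jacLin_apply, h w, h' w, add_zero]

theorem KillsAt.add_right {a b b' : VertexOperator ℂ W} {g : ℂ[T;T⁻¹]} {r : ℤ}
    (h : KillsAt g a b r) (h' : KillsAt g a b' r) : KillsAt g a (b + b') r := fun w => by
  rw [← jacLin_apply, map_add, LinearMap.add_apply, map_add, jacLin_apply,
    jacLin_apply, h w, h' w, add_zero]

theorem KillsAt.smul_left {g : ℂ[T;T⁻¹]} {r : ℤ} (h : KillsAt g a b r) (c : ℂ) :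
    KillsAt g (c • a) b r := fun w => by
  rw [← jacLin_apply, map_smul, LinearMap.smul_apply, LinearMap.smul_apply, map_smul, jacLin_apply,
    h w, smul_zero]

theorem KillsAt.smul_right {g : ℂ[T;T⁻¹]} {r : ℤ} (h : KillsAt g a b r) (c : ℂ) :
    KillsAt g a (c • b) r := fun w => by
  rw [← jacLin_apply, map_smul, LinearMap.smul_apply, map_smul, jacLin_apply,
    h w, smul_zero]

theorem prodN_add_left {a a' b : VertexOperator ℂ W} (h : QuasiLocal a b) (h' : QuasiLocal a' b)
    (n : ℤ) : prodN (a + a') b n = prodN a b n + prodN a' b n := by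
  obtain ⟨N, G, hG, h, h'⟩ := h.common h'
  obtain ⟨e, he, heM⟩ := exists_multiplier hG (N + n.natAbs) 1
  rw [pow_one] at he
  have hN : (N : ℤ) ≤ n + (N + n.natAbs : ℕ) := by omega
  rw [prodN_eq ⟨N, G, _, hG, h, he, heM, hN⟩, prodN_eq ⟨N, G, _, hG, h', he, heM, hN⟩,
    prodN_eq ⟨N, G, _, hG, h.add_left h', he, heM, hN⟩]
  refine ext_ncoeff fun j w => ?_
  rw [ncoeff_add]
  simp only [kerField_ncoeff, ← jacLin_apply, map_add, LinearMap.add_apply, Pi.add_apply]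

theorem prodN_add_right {a b b' : VertexOperator ℂ W} (h : QuasiLocal a b) (h' : QuasiLocal a b')
    (n : ℤ) : prodN a (b + b') n = prodN a b n + prodN a b' n := by
  obtain ⟨N, G, hG, h, h'⟩ := h.common h'
  obtain ⟨e, he, heM⟩ := exists_multiplier hG (N + n.natAbs) 1
  rw [pow_one] at he
  have hN : (N : ℤ) ≤ n + (N + n.natAbs : ℕ) := by omega
  rw [prodN_eq ⟨N, G, _, hG, h, he, heM, hN⟩, prodN_eq ⟨N, G, _, hG, h', he, heM, hN⟩,
    prodN_eq ⟨N, G, _, hG, h.add_right h', he, heM, hN⟩]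
  refine ext_ncoeff fun j w => ?_
  rw [ncoeff_add]
  simp only [kerField_ncoeff, ← jacLin_apply, map_add, LinearMap.add_apply, Pi.add_apply]

theorem QuasiLocal.exists_admissible (h : QuasiLocal a b) (n : ℤ) : ∃ e, ∃ (N : ℕ) (G : ℂ[T;T⁻¹])
    (M : ℕ), IsCoprime tOne G ∧ KillsAt (tOne ^ N * G) a b 0 ∧ G ∣ e ∧
    tOne ^ M ∣ e - 1 ∧ (N : ℤ) ≤ n + M := by
  obtain ⟨N, G, hG, h⟩ := h
  obtain ⟨e, he, heM⟩ := exists_multiplier hG (N + n.natAbs) 1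
  exact ⟨e, N, G, _, hG, h, by rwa [pow_one] at he, heM, by omega⟩

theorem prodN_smul_left (h : QuasiLocal a b) (c : ℂ) (n : ℤ) :
    prodN (c • a) b n = c • prodN a b n := by
  obtain ⟨e, N, G, M, hG, h, h1, h2, h3⟩ := h.exists_admissible n
  rw [prodN_eq ⟨N, G, M, hG, h, h1, h2, h3⟩, prodN_eq ⟨N, G, M, hG, h.smul_left c, h1, h2, h3⟩]
  refine ext_ncoeff fun j w => ?_
  rw [ncoeff_smul]
  simp only [kerField_ncoeff, ← jacLin_apply, map_smul, LinearMap.smul_apply, Pi.smul_apply]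

theorem prodN_smul_right (h : QuasiLocal a b) (c : ℂ) (n : ℤ) :
    prodN a (c • b) n = c • prodN a b n := by
  obtain ⟨e, N, G, M, hG, h, h1, h2, h3⟩ := h.exists_admissible n
  rw [prodN_eq ⟨N, G, M, hG, h, h1, h2, h3⟩, prodN_eq ⟨N, G, M, hG, h.smul_right c, h1, h2, h3⟩]
  refine ext_ncoeff fun j w => ?_
  rw [ncoeff_smul]
  simp only [kerField_ncoeff, ← jacLin_apply, map_smul, LinearMap.smul_apply, Pi.smul_apply]

theorem prodN_eq_zero {N : ℕ} {G : ℂ[T;T⁻¹]} (hG : IsCoprime tOne G)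
    (h : KillsAt (tOne ^ N * G) a b 0) {n : ℤ} (hn : (N : ℤ) ≤ n) : prodN a b n = 0 := by
  obtain ⟨e, he, heM⟩ := exists_multiplier hG (N + n.natAbs) 1
  rw [pow_one] at he
  rw [prodN_eq ⟨N, G, _, hG, h, he, heM, by omega⟩]
  exact kerField_eq_zero (h.of_order_zero he hn) 0

/-- The field `x ^ h a(x)`. -/
noncomputable def VertexOperator.shift (h : ℤ) (a : VertexOperator ℂ W) : VertexOperator ℂ W :=
  ofModes (fun n => a[[n + h]]) fun w => by
    obtain ⟨N, hN⟩ := a.exists_trunc w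
    exact ⟨N - h, fun n hn => hN _ (by omega)⟩

theorem VertexOperator.shift_ncoeff (h n : ℤ) : (shift h a)[[n]] = a[[n + h]] := by
  rw [shift, ofModes_ncoeff]

theorem jac_shift_left (h : ℤ) (w : W) (r i j : ℤ) :
    jac (shift h a) b w r (i, j) = jac a b w r (i + h, j) := by
  simp only [jac, jacobiFirst, jacobiSecond, shift_ncoeff]
  congr 1 <;> refine finsum_congr fun t => ?_ <;> congr 4 <;> ring_nf

theorem jac_shift_right (h : ℤ) (w : W) (r i j : ℤ) :
    jac a (shift h b) w r (i, j) = jac a b w r (i, j + h) := by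
  simp only [jac, jacobiFirst, jacobiSecond, shift_ncoeff]
  congr 1 <;> refine finsum_congr fun t => ?_ <;> congr 4 <;> ring_nf

/-- Taylor expansion in `x₀ = x₁ - x₂` of the factor `x₁ ^ p`. -/
theorem kerField_taylor {e : ℂ[T;T⁻¹]} {m : ℤ} (h : KillsAt e a b m) (p r : ℤ) {n : ℕ}
    (hn : m ≤ r + n) : kerField e a b p r = ∑ i ∈ Finset.range n, ((Ring.choose p i : ℤ) : ℂ) •
      shift (p - i) (kerField e a b 0 (r + i)) := by
  refine ext_ncoeff fun j w => ?_
  have := pascal_expand (H := fun k l m => mulT e (jac a b w m) (k, l)) (m₀ := m)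
    (fun k l m => ?_) (fun k l m' hm => by rw [h.mono hm w]; rfl) n p j r hn
  · rw [kerField_ncoeff, ncoeff_sum, this]
    refine Finset.sum_congr rfl fun i _ => ?_
    rw [ncoeff_smul, shift_ncoeff, kerField_ncoeff, add_sub_assoc]
  · simp only [mulT_apply, jac_succ, smul_sub, Finsupp.sum_sub]
    simp only [add_right_comm, sub_add_eq_add_sub, add_sub_cancel]

/-- The identity operator as a constant field. -/
noncomputable def VertexOperator.idField : VertexOperator ℂ W :=
  ofModes (fun n => if n = -1 then 1 else 0) fun w => ⟨0, fun n hn => by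
    rw [if_neg (by omega)]; rfl⟩

theorem VertexOperator.idField_ncoeff (n : ℤ) (w : W) :
    ((idField : VertexOperator ℂ W)[[n]]) w = if n = -1 then w else 0 := by
  rw [idField, ofModes_ncoeff]
  split_ifs <;> rfl

theorem killsAt_id_left : KillsAt 1 idField a 0 := fun w => by
  ext ⟨i, j⟩
  rw [mulT_one, jac_zero, idField_ncoeff, idField_ncoeff]
  split_ifs <;> simp

theorem killsAt_id_right : KillsAt 1 a idField 0 := fun w => by
  ext ⟨i, j⟩
  rw [mulT_one, jac_zero, idField_ncoeff, idField_ncoeff]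
  split_ifs <;> simp

theorem admissible_one (h : KillsAt 1 a b 0) (n : ℤ) : Admissible a b n 1 :=
  ⟨0, 1, n.natAbs, isCoprime_one_right, by simpa using h, dvd_rfl, by simp, by omega⟩

theorem prodN_idField (n : ℤ) : prodN idField a n = if n = -1 then a else 0 := by
  rw [prodN_eq (admissible_one killsAt_id_left n)]
  rcases le_or_gt 0 n with hn | hn
  · rw [if_neg (by omega), kerField_eq_zero (killsAt_id_left.mono hn)]
  refine ext_ncoeff fun j w => ?_
  have h2 : jacobiSecond idField a w n 0 j = 0 := by
    rw [jacobiSecond]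
    refine finsum_eq_zero_of_forall_eq_zero fun t => ?_
    rw [idField_ncoeff, if_neg (by omega), map_zero, smul_zero]
  rw [kerField_ncoeff, mulT_one, jac]
  dsimp only
  rw [h2, sub_zero, jacobiFirst, finsum_eq_single _ 0]
  · rw [idField_ncoeff]
    by_cases h : n = -1 <;> simp [h]
  · intro t ht
    rw [idField_ncoeff, if_neg (by omega), smul_zero]

theorem prodN_idField_right (n : ℤ) (hn : -1 ≤ n) : prodN a idField n = if n = -1 then a else 0 := by
  rw [prodN_eq (admissible_one killsAt_id_right n)]
  rcases le_or_gt 0 n with hn | hn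
  · rw [if_neg (by omega), kerField_eq_zero (killsAt_id_right.mono hn)]
  obtain rfl : n = -1 := by omega
  refine ext_ncoeff fun j w => ?_
  rw [kerField_ncoeff, mulT_one, jac, jacobiFirst_eq, jacobiSecond_eq, jacobiFirst_eq, expand, expand]
  simp only [bin_neg_one, one_smul, prodFun, if_true]
  rcases lt_or_ge j 0 with hj | hj
  · rw [finsum_eq_single _ (-1 - j).toNat, finsum_eq_zero_of_forall_eq_zero]
    · simp [idField_ncoeff, show max (-1 - j) 0 = -1 - j by omega]
    · intro t
      simp only [idField_ncoeff]
      rw [if_neg]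
      simp; omega
    · intro t ht
      simp only [idField_ncoeff]
      rw [if_neg, map_zero]
      simp; omega
  · rw [finsum_eq_zero_of_forall_eq_zero, finsum_eq_single _ j.toNat]
    · simp [idField_ncoeff, hj]
    · intro t ht
      simp only [idField_ncoeff]
      rw [if_neg]
      simp; omega
    · intro t
      simp only [idField_ncoeff]
      rw [if_neg, map_zero]
      simp; omega

/-- The field `a(z x)`. -/
noncomputable def VertexOperator.dilate (z : ℂˣ) (a : VertexOperator ℂ W) : VertexOperator ℂ W :=
  ofModes (fun n => ((z ^ (-n - 1) : ℂˣ) : ℂ) • a[[n]]) fun w => by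
    obtain ⟨N, hN⟩ := a.exists_trunc w
    exact ⟨N, fun n hn => by rw [LinearMap.smul_apply, hN _ hn, smul_zero]⟩

theorem VertexOperator.dilate_ncoeff (z : ℂˣ) (n : ℤ) :
    (dilate z a)[[n]] = ((z ^ (-n - 1) : ℂˣ) : ℂ) • a[[n]] := by
  rw [dilate, ofModes_ncoeff]

theorem jacobiFirst_dilate (z : ℂˣ) (w : W) (r p q : ℤ) :
    jacobiFirst (dilate z a) (dilate z b) w r p q =
      ((z ^ (-p - q - r - 2) : ℂˣ) : ℂ) • jacobiFirst a b w r p q := by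
  simp only [jacobiFirst, dilate_ncoeff, LinearMap.smul_apply, map_smul]
  rw [smul_finsum]
  refine finsum_congr fun t => ?_
  rw [smul_smul, smul_smul, smul_smul,
    show -p - q - r - 2 = -(p + r - t) - 1 + (-(q + t) - 1) by ring, zpow_add, Units.val_mul]
  congr 1
  ring

theorem jac_dilate (z : ℂˣ) (w : W) (r : ℤ) (n : ℤ × ℤ) :
    jac (dilate z a) (dilate z b) w r n =
      ((z ^ (-n.1 - n.2 - r - 2) : ℂˣ) : ℂ) • jac a b w r n := by
  rw [jac, jac, jacobiSecond_eq, jacobiSecond_eq, jacobiFirst_dilate, jacobiFirst_dilate, smul_sub,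
    smul_comm, show -n.2 - n.1 = -n.1 - n.2 by ring]

theorem mulT_jac_dilate (z : ℂˣ) (g : ℂ[T;T⁻¹]) (w : W) (r i j : ℤ) :
    mulT g (jac (dilate z a) (dilate z b) w r) (i, j) =
      ((z ^ (-i - j - r - 2) : ℂˣ) : ℂ) • mulT g (jac a b w r) (i, j) := by
  rw [mulT_apply, mulT_apply, Finsupp.smul_sum]
  refine Finsupp.sum_congr fun s _ => ?_
  rw [jac_dilate, smul_comm]
  congr 4
  ring

theorem KillsAt.dilate {g : ℂ[T;T⁻¹]} {r : ℤ} (h : KillsAt g a b r) (z : ℂˣ) :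
    KillsAt g (dilate z a) (dilate z b) r := fun w => by
  ext ⟨i, j⟩
  rw [mulT_jac_dilate, h w]
  simp

theorem prodN_dilate (h : QuasiLocal a b) (z : ℂˣ) (n : ℤ) :
    prodN (dilate z a) (dilate z b) n = ((z ^ (-n - 1) : ℂˣ) : ℂ) • dilate z (prodN a b n) := by
  obtain ⟨e, N, G, M, hG, h, h1, h2, h3⟩ := h.exists_admissible n
  rw [prodN_eq ⟨N, G, M, hG, h, h1, h2, h3⟩, prodN_eq ⟨N, G, M, hG, h.dilate z, h1, h2, h3⟩]
  refine ext_ncoeff fun j w => ?_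
  rw [ncoeff_smul, dilate_ncoeff, LinearMap.smul_apply, kerField_ncoeff, kerField_ncoeff,
    mulT_jac_dilate, smul_smul]
  congr 1
  rw [← Units.val_mul, ← zpow_add]
  congr 2; ring

end Products

/-! ### Kernels of triples of fields -/

section Triple

variable {W : Type*} [AddCommGroup W] [Module ℂ W]

theorem NilAlong.act {G : Type*} [AddCommGroup G] {v : G} {X : G → W} (hX : NilAlong v X)
    (x : AddMonoidAlgebra ℂ G) : NilAlong v (act x X) := by
  intro n
  choose N hN using fun u : G => hX (n + u)
  refine ⟨∑ u ∈ x.coeff.support, N u, fun t ht => ?_⟩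
  rw [act_apply]
  refine Finset.sum_eq_zero fun u hu => ?_
  have := Finset.single_le_sum (f := N) (fun _ _ => Nat.zero_le _) hu
  beta_reduce
  rw [add_right_comm, hN u t (by omega), smul_zero]

theorem map_expand {G : Type*} [AddCommGroup G] {v : G} {X : G → W} (hX : NilAlong v X)
    (f : W →ₗ[ℂ] W) (r : ℤ) (n : G) : f (expand v r X n) = expand v r (fun n => f (X n)) n := by
  have hfX : NilAlong v fun n => f (X n) := fun n => by
    obtain ⟨N, hN⟩ := hX n
    exact ⟨N, fun t ht => by beta_reduce; rw [hN t ht, map_zero]⟩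
  obtain ⟨N, h1, h2⟩ := ((expand_eventually hX r n).and (expand_eventually hfX r n)).exists
  rw [h1, h2, map_sum]
  simp only [map_smul]

/-- Functions on `ℤ³` whose series is a Laurent series in `x₃`, with coefficients that are Laurent
series in `x₂`, with no condition on the exponents of `x₁`. Such series can be multiplied by
powers of differences of the variables expanded in the region `|x₁| > |x₂| > |x₃|`. -/
def Tame (X : ℤ × ℤ × ℤ → W) : Prop :=
  (∃ N : ℤ, ∀ i j k, N ≤ k → X (i, j, k) = 0) ∧ ∀ k, ∃ M : ℤ, ∀ i j, M ≤ j → X (i, j, k) = 0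

theorem Tame.nil12 {X : ℤ × ℤ × ℤ → W} (hX : Tame X) : NilAlong (-1, 1, 0) X := by
  rintro ⟨i, j, k⟩
  obtain ⟨M, hM⟩ := hX.2 k
  refine ⟨(M - j).toNat, fun t ht => ?_⟩
  have : ((i, j, k) + t • (-1, 1, 0) : ℤ × ℤ × ℤ) = (i - t, j + t, k) := by
    simp [sub_eq_add_neg]
  rw [this, hM _ _ (by omega)]

theorem Tame.nil13 {X : ℤ × ℤ × ℤ → W} (hX : Tame X) : NilAlong (-1, 0, 1) X := by
  rintro ⟨i, j, k⟩
  obtain ⟨N, hN⟩ := hX.1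
  refine ⟨(N - k).toNat, fun t ht => ?_⟩
  have : ((i, j, k) + t • (-1, 0, 1) : ℤ × ℤ × ℤ) = (i - t, j, k + t) := by
    simp [sub_eq_add_neg]
  rw [this, hN _ _ _ (by omega)]

theorem Tame.nil23 {X : ℤ × ℤ × ℤ → W} (hX : Tame X) : NilAlong (0, -1, 1) X := by
  rintro ⟨i, j, k⟩
  obtain ⟨N, hN⟩ := hX.1
  refine ⟨(N - k).toNat, fun t ht => ?_⟩
  have : ((i, j, k) + t • (0, -1, 1) : ℤ × ℤ × ℤ) = (i, j - t, k + t) := by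
    simp [sub_eq_add_neg]
  rw [this, hN _ _ _ (by omega)]

theorem tame_expand {X : ℤ × ℤ × ℤ → W} (hX : Tame X) {α β γ : ℤ} (hγ : 0 ≤ γ)
    (h : γ = 0 → 0 ≤ β) (r : ℤ) : Tame (expand (α, β, γ) r X) := by
  obtain ⟨N, hN⟩ := hX.1
  choose M hM using hX.2
  have e : ∀ (i j k : ℤ) (t : ℕ), ((i, j, k) + t • (α, β, γ) : ℤ × ℤ × ℤ) =
      (i + t * α, j + t * β, k + t * γ) := fun i j k t => by simp
  refine ⟨⟨N, fun i j k hk => ?_⟩, fun k => ?_⟩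
  · refine finsum_eq_zero_of_forall_eq_zero fun t => ?_
    rw [e, hN _ _ _ (by nlinarith), smul_zero]
  · rcases hγ.eq_or_lt with hγ | hγ
    · refine ⟨M k, fun i j hj => finsum_eq_zero_of_forall_eq_zero fun t => ?_⟩
      have := h hγ.symm
      rw [e, ← hγ, mul_zero, add_zero, hM k _ _ (by nlinarith), smul_zero]
    · refine ⟨∑ t ∈ Finset.range (N - k).toNat, |M (k + t * γ) - t * β|, fun i j hj =>
        finsum_eq_zero_of_forall_eq_zero fun t => ?_⟩
      rw [e]
      by_cases ht : (N - k).toNat ≤ t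
      · rw [hN _ _ _ (by nlinarith [show N - k ≤ t by omega]), smul_zero]
      · have h1 := Finset.single_le_sum (f := fun t : ℕ => |M (k + t * γ) - t * β|)
          (fun _ _ => abs_nonneg _) (Finset.mem_range.2 (not_le.1 ht))
        have h2 := le_abs_self (M (k + t * γ) - t * β)
        beta_reduce at h1
        rw [hM _ _ _ (by linarith), smul_zero]

theorem tame_expand_comm {X : ℤ × ℤ × ℤ → W} (hX : Tame X) (r p q : ℤ) :
    (expand (-1, 1, 0) r (expand (-1, 0, 1) p X) = expand (-1, 0, 1) p (expand (-1, 1, 0) r X)) ∧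
    (expand (-1, 1, 0) r (expand (0, -1, 1) q X) = expand (0, -1, 1) q (expand (-1, 1, 0) r X)) ∧
    (expand (-1, 0, 1) p (expand (0, -1, 1) q X) = expand (0, -1, 1) q (expand (-1, 0, 1) p X)) :=
  ⟨expand_comm (𝒯 := Tame) (fun _ h => h.nil12) (fun _ h => h.nil13)
    (fun _ _ h => tame_expand h (by norm_num) (by norm_num) _)
    (fun _ _ h => tame_expand h (by norm_num) (by norm_num) _) hX r p,
  expand_comm (𝒯 := Tame) (fun _ h => h.nil12) (fun _ h => h.nil23)
    (fun _ _ h => tame_expand h (by norm_num) (by norm_num) _)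
    (fun _ _ h => tame_expand h (by norm_num) (by norm_num) _) hX r q,
  expand_comm (𝒯 := Tame) (fun _ h => h.nil13) (fun _ h => h.nil23)
    (fun _ _ h => tame_expand h (by norm_num) (by norm_num) _)
    (fun _ _ h => tame_expand h (by norm_num) (by norm_num) _) hX p q⟩

/-- A family `F r p q` of functions on `ℤ³` of the form
`(x₁ - x₂) ^ r (x₁ - x₃) ^ p (x₂ - x₃) ^ q F`, where the value at `(i, j, k)` is the
residue of the product with `x₁ ^ i x₂ ^ j x₃ ^ k`. -/
structure IsKernelFamily (F : ℤ → ℤ → ℤ → ℤ × ℤ × ℤ → W) : Prop where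
  rel12 : ∀ r p q i j k, F (r + 1) p q (i, j, k) = F r p q (i + 1, j, k) - F r p q (i, j + 1, k)
  rel13 : ∀ r p q i j k, F r (p + 1) q (i, j, k) = F r p q (i + 1, j, k) - F r p q (i, j, k + 1)
  rel23 : ∀ r p q i j k, F r p (q + 1) (i, j, k) = F r p q (i, j + 1, k) - F r p q (i, j, k + 1)

/-- The expansions of `(x₁ - x₂) ^ r (x₁ - x₃) ^ p (x₂ - x₃) ^ q X` in the region
`|x₁| > |x₂| > |x₃|`. -/
noncomputable def tri (X : ℤ × ℤ × ℤ → W) (r p q : ℤ) (n : ℤ × ℤ × ℤ) : W :=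
  expand (-1, 1, 0) r (expand (-1, 0, 1) p (expand (0, -1, 1) q X)) (n.1 + r + p, n.2.1 + q, n.2.2)

theorem tame_expand3 {X : ℤ × ℤ × ℤ → W} (hX : Tame X) (r p q : ℤ) :
    Tame (expand (-1, 1, 0) r (expand (-1, 0, 1) p (expand (0, -1, 1) q X))) :=
  tame_expand (tame_expand (tame_expand hX (by norm_num) (by norm_num) _) (by norm_num)
    (by norm_num) _) (by norm_num) (by norm_num) _

theorem tame_tri {X : ℤ × ℤ × ℤ → W} (hX : Tame X) (r p q : ℤ) : Tame (tri X r p q) := by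
  obtain ⟨⟨N, hN⟩, h⟩ := tame_expand3 hX r p q
  refine ⟨⟨N, fun i j k hk => hN _ _ _ hk⟩, fun k => ?_⟩
  obtain ⟨M, hM⟩ := h k
  exact ⟨M - q, fun i j hj => hM _ _ (by dsimp only; omega)⟩

theorem isKernelFamily_tri {X : ℤ × ℤ × ℤ → W} (hX : Tame X) : IsKernelFamily (tri X) where
  rel12 r p q i j k := by
    have h : Tame (expand (-1, 0, 1) p (expand (0, -1, 1) q X)) :=
      tame_expand (tame_expand hX (by norm_num) (by norm_num) _) (by norm_num) (by norm_num) _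
    simp only [tri]
    rw [expand_succ h.nil12]
    simp only [Prod.mk_add_mk]
    ring_nf
  rel13 r p q i j k := by
    have h : Tame (expand (0, -1, 1) q X) := tame_expand hX (by norm_num) (by norm_num) _
    simp only [tri]
    rw [(tame_expand_comm h r (p + 1) 0).1, (tame_expand_comm h r p 0).1, expand_succ
      (tame_expand h (by norm_num) (by norm_num) _).nil13]
    simp only [Prod.mk_add_mk]
    ring_nf
  rel23 r p q i j k := by
    have h : Tame (expand (-1, 0, 1) p X) := tame_expand hX (by norm_num) (by norm_num) _
    simp only [tri]
    rw [(tame_expand_comm hX 0 p (q + 1)).2.2, (tame_expand_comm hX 0 p q).2.2,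
      (tame_expand_comm h r 0 (q + 1)).2.1,
      (tame_expand_comm h r 0 q).2.1, expand_succ (tame_expand h (by norm_num) (by norm_num) _).nil23]
    simp only [Prod.mk_add_mk]
    ring_nf

/-- The exchange of the variables `x₁` and `x₂`; the sign comes from
`(x₂ - x₁) ^ r = (-1) ^ r (x₁ - x₂) ^ r`. -/
noncomputable def swap12 (F : ℤ → ℤ → ℤ → ℤ × ℤ × ℤ → W) (r p q : ℤ) (n : ℤ × ℤ × ℤ) : W :=
  (-1 : ℂ) ^ r • F r q p (n.2.1, n.1, n.2.2)

/-- The exchange of the variables `x₂` and `x₃`; the sign comes from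
`(x₃ - x₂) ^ q = (-1) ^ q (x₂ - x₃) ^ q`. -/
noncomputable def swap23 (F : ℤ → ℤ → ℤ → ℤ × ℤ × ℤ → W) (r p q : ℤ) (n : ℤ × ℤ × ℤ) : W :=
  (-1 : ℂ) ^ q • F p r q (n.1, n.2.2, n.2.1)

theorem IsKernelFamily.sub {F F' : ℤ → ℤ → ℤ → ℤ × ℤ × ℤ → W} (h : IsKernelFamily F)
    (h' : IsKernelFamily F') : IsKernelFamily (F - F') where
  rel12 r p q i j k := by simp only [Pi.sub_apply, h.rel12, h'.rel12]; abel
  rel13 r p q i j k := by simp only [Pi.sub_apply, h.rel13, h'.rel13]; abel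
  rel23 r p q i j k := by simp only [Pi.sub_apply, h.rel23, h'.rel23]; abel

theorem neg_one_zpow_succ (r : ℤ) : (-1 : ℂ) ^ (r + 1) = -(-1) ^ r := by
  rw [zpow_add_one₀ (by norm_num)]; ring

theorem IsKernelFamily.swap12 {F : ℤ → ℤ → ℤ → ℤ × ℤ × ℤ → W} (h : IsKernelFamily F) :
    IsKernelFamily (swap12 F) where
  rel12 r p q i j k := by
    simp only [_root_.swap12, h.rel12, neg_one_zpow_succ, neg_smul, smul_sub]; abel
  rel13 r p q i j k := by simp only [_root_.swap12, h.rel23, smul_sub]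
  rel23 r p q i j k := by simp only [_root_.swap12, h.rel13, smul_sub]

theorem IsKernelFamily.swap23 {F : ℤ → ℤ → ℤ → ℤ × ℤ × ℤ → W} (h : IsKernelFamily F) :
    IsKernelFamily (swap23 F) where
  rel12 r p q i j k := by simp only [_root_.swap23, h.rel13, smul_sub]
  rel13 r p q i j k := by simp only [_root_.swap23, h.rel12, smul_sub]
  rel23 r p q i j k := by
    simp only [_root_.swap23, h.rel23, neg_one_zpow_succ, neg_smul, smul_sub]; abel

theorem IsKernelFamily.act {F : ℤ → ℤ → ℤ → ℤ × ℤ × ℤ → W} (h : IsKernelFamily F)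
    (x : AddMonoidAlgebra ℂ (ℤ × ℤ × ℤ)) : IsKernelFamily fun r p q => act x (F r p q) where
  rel12 r p q i j k := by
    simp only [act_apply, ← Finsupp.sum_sub]
    refine Finsupp.sum_congr fun v _ => ?_
    rw [← smul_sub]
    simp only [Prod.add_def, h.rel12, add_right_comm]
  rel13 r p q i j k := by
    simp only [act_apply, ← Finsupp.sum_sub]
    refine Finsupp.sum_congr fun v _ => ?_
    rw [← smul_sub]
    simp only [Prod.add_def, h.rel13, add_right_comm]
  rel23 r p q i j k := by
    simp only [act_apply, ← Finsupp.sum_sub]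
    refine Finsupp.sum_congr fun v _ => ?_
    rw [← smul_sub]
    simp only [Prod.add_def, h.rel23, add_right_comm]

namespace IsKernelFamily

variable {F : ℤ → ℤ → ℤ → ℤ × ℤ × ℤ → W} (h : IsKernelFamily F)

include h

theorem eq_zero12 (hn : ∀ r p q, NilAlong (-1, 1, 0) (F r p q)) {p q : ℤ} (h0 : F 0 p q = 0)
    (r : ℤ) : F r p q = 0 := by
  induction r using Int.induction_on with
  | zero => exact h0
  | succ r ih => ext ⟨i, j, k⟩; rw [h.rel12, ih]; simp
  | pred r ih =>
    refine eq_zero_of_nilAlong (hn _ _ _) fun ⟨i, j, k⟩ => ?_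
    have := h.rel12 (-r - 1) p q (i - 1) j k
    rw [sub_add_cancel, ih, sub_add_cancel] at this
    simpa [sub_eq_add_neg] using sub_eq_zero.1 this.symm

theorem eq_zero13 (hn : ∀ r p q, NilAlong (-1, 0, 1) (F r p q)) {r q : ℤ} (h0 : F r 0 q = 0)
    (p : ℤ) : F r p q = 0 := by
  induction p using Int.induction_on with
  | zero => exact h0
  | succ p ih => ext ⟨i, j, k⟩; rw [h.rel13, ih]; simp
  | pred p ih =>
    refine eq_zero_of_nilAlong (hn _ _ _) fun ⟨i, j, k⟩ => ?_
    have := h.rel13 r (-p - 1) q (i - 1) j k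
    rw [sub_add_cancel, ih, sub_add_cancel] at this
    simpa [sub_eq_add_neg] using sub_eq_zero.1 this.symm

theorem eq_zero23 (hn : ∀ r p q, NilAlong (0, -1, 1) (F r p q)) {r p : ℤ} (h0 : F r p 0 = 0)
    (q : ℤ) : F r p q = 0 := by
  induction q using Int.induction_on with
  | zero => exact h0
  | succ q ih => ext ⟨i, j, k⟩; rw [h.rel23, ih]; simp
  | pred q ih =>
    refine eq_zero_of_nilAlong (hn _ _ _) fun ⟨i, j, k⟩ => ?_
    have := h.rel23 r p (-q - 1) i (j - 1) k
    rw [sub_add_cancel, ih, sub_add_cancel] at this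
    simpa [sub_eq_add_neg] using sub_eq_zero.1 this.symm

theorem eq_zero12_of_nonneg {p q : ℤ} (h0 : F 0 p q = 0) {r : ℤ} (hr : 0 ≤ r) : F r p q = 0 := by
  obtain ⟨r, rfl⟩ := Int.eq_ofNat_of_zero_le hr
  clear hr
  induction r with
  | zero => exact h0
  | succ r ih => ext ⟨i, j, k⟩; rw [Nat.cast_succ, h.rel12, ih]; simp

theorem eq_zero23_of_nonneg {r p : ℤ} (h0 : F r p 0 = 0) {q : ℤ} (hq : 0 ≤ q) : F r p q = 0 := by
  obtain ⟨q, rfl⟩ := Int.eq_ofNat_of_zero_le hq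
  clear hq
  induction q with
  | zero => exact h0
  | succ q ih => ext ⟨i, j, k⟩; rw [Nat.cast_succ, h.rel23, ih]; simp

end IsKernelFamily

/-- Multiplication by a Laurent polynomial in `x₁ / x₂`. -/
noncomputable def mul12 (g : ℂ[T;T⁻¹]) : Module.End ℂ (ℤ × ℤ × ℤ → W) := act (tau (1, -1, 0) g)

/-- Multiplication by a Laurent polynomial in `x₁ / x₃`. -/
noncomputable def mul13 (g : ℂ[T;T⁻¹]) : Module.End ℂ (ℤ × ℤ × ℤ → W) := act (tau (1, 0, -1) g)

/-- Multiplication by a Laurent polynomial in `x₂ / x₃`. -/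
noncomputable def mul23 (g : ℂ[T;T⁻¹]) : Module.End ℂ (ℤ × ℤ × ℤ → W) := act (tau (0, 1, -1) g)

theorem mul12_apply (g : ℂ[T;T⁻¹]) (F : ℤ × ℤ × ℤ → W) (i j k : ℤ) :
    mul12 g F (i, j, k) = mulT g (fun n => F (n.1, n.2, k)) (i, j) := by
  rw [mul12, act_tau_apply, mulT_apply]
  simp [sub_eq_add_neg]

theorem mul13_apply (g : ℂ[T;T⁻¹]) (F : ℤ × ℤ × ℤ → W) (i j k : ℤ) :
    mul13 g F (i, j, k) = mulT g (fun n => F (n.1, j, n.2)) (i, k) := by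
  rw [mul13, act_tau_apply, mulT_apply]
  simp [sub_eq_add_neg]

theorem mul23_apply (g : ℂ[T;T⁻¹]) (F : ℤ × ℤ × ℤ → W) (i j k : ℤ) :
    mul23 g F (i, j, k) = mulT g (fun n => F (i, n.1, n.2)) (j, k) := by
  rw [mul23, act_tau_apply, mulT_apply]
  simp [sub_eq_add_neg]

/-- The coefficients of `a(x₁) b(x₂) c(x₃) w`. -/
noncomputable def prodFun₃ (a b c : VertexOperator ℂ W) (w : W) (n : ℤ × ℤ × ℤ) : W :=
  (a[[n.1]]) ((b[[n.2.1]]) ((ncoeff c (n.2.2)) w))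

theorem tame_prodFun₃ (a b c : VertexOperator ℂ W) (w : W) : Tame (prodFun₃ a b c w) := by
  refine ⟨?_, fun k => ?_⟩
  · obtain ⟨N, hN⟩ := c.exists_trunc w
    exact ⟨N, fun i j k hk => by simp only [prodFun₃, hN k hk, map_zero]⟩
  · obtain ⟨M, hM⟩ := b.exists_trunc ((ncoeff c (k)) w)
    exact ⟨M, fun i j hj => by simp only [prodFun₃, hM j hj, map_zero]⟩

theorem tri_zero (X : ℤ × ℤ × ℤ → W) : tri X 0 0 0 = X := by
  ext ⟨i, j, k⟩
  simp only [tri, expand_zero, add_zero]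

variable (a b c : VertexOperator ℂ W) (w : W)

/-- The kernel of `[a(x₁), b(x₂)] c(x₃) w`. -/
noncomputable def commLeft : ℤ → ℤ → ℤ → ℤ × ℤ × ℤ → W :=
  tri (prodFun₃ a b c w) - swap12 (tri (prodFun₃ b a c w))

/-- The kernel of `a(x₁) [b(x₂), c(x₃)] w`. -/
noncomputable def commRight : ℤ → ℤ → ℤ → ℤ × ℤ × ℤ → W :=
  tri (prodFun₃ a b c w) - swap23 (tri (prodFun₃ a c b w))

/-- The kernel of `[[a(x₁), b(x₂)], c(x₃)] w`. -/
noncomputable def kerLeft : ℤ → ℤ → ℤ → ℤ × ℤ × ℤ → W :=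
  commLeft a b c w - swap23 (swap12 (commRight c a b w))

/-- The kernel of `[a(x₁), [b(x₂), c(x₃)]] w`. -/
noncomputable def kerRight : ℤ → ℤ → ℤ → ℤ × ℤ × ℤ → W :=
  commRight a b c w - swap12 (swap23 (commLeft b c a w))

theorem isKernelFamily_commLeft : IsKernelFamily (commLeft a b c w) :=
  (isKernelFamily_tri (tame_prodFun₃ a b c w)).sub
    (isKernelFamily_tri (tame_prodFun₃ b a c w)).swap12

theorem isKernelFamily_commRight : IsKernelFamily (commRight a b c w) :=
  (isKernelFamily_tri (tame_prodFun₃ a b c w)).sub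
    (isKernelFamily_tri (tame_prodFun₃ a c b w)).swap23

theorem isKernelFamily_kerLeft : IsKernelFamily (kerLeft a b c w) :=
  (isKernelFamily_commLeft a b c w).sub (isKernelFamily_commRight c a b w).swap12.swap23

theorem isKernelFamily_kerRight : IsKernelFamily (kerRight a b c w) :=
  (isKernelFamily_commRight a b c w).sub (isKernelFamily_commLeft b c a w).swap23.swap12

theorem neg_one_zpow_mul_self (r : ℤ) : (-1 : ℂ) ^ r * (-1) ^ r = 1 := by
  rw [← mul_zpow]; simp

/-- The Jacobi identity for the iterated commutators of three fields. -/
theorem kerLeft_eq : kerLeft a b c w = kerRight a b c w - swap12 (kerRight b a c w) := by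
  ext r p q ⟨i, j, k⟩
  have h1 : (-1 : ℂ) ^ r * (-1) ^ p * (-1) ^ q = (-1) ^ q * (-1) ^ p * (-1) ^ r := by ring
  simp only [kerLeft, kerRight, commLeft, commRight, swap12, swap23, Pi.sub_apply, smul_sub,
    smul_smul]
  simp only [← mul_assoc, neg_one_zpow_mul_self, one_mul, h1]
  abel

variable {a b c w}

theorem NilAlong.comp_swap12 {X : ℤ × ℤ × ℤ → W} {α β γ : ℤ} (hX : NilAlong (α, β, γ) X) (z : ℂ) :
    NilAlong (β, α, γ) fun n => z • X (n.2.1, n.1, n.2.2) := by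
  intro n
  obtain ⟨N, hN⟩ := hX (n.2.1, n.1, n.2.2)
  refine ⟨N, fun t ht => ?_⟩
  have := hN t ht
  simp only [Prod.smul_mk, Prod.add_def] at this ⊢
  rw [this, smul_zero]

theorem NilAlong.comp_swap23 {X : ℤ × ℤ × ℤ → W} {α β γ : ℤ} (hX : NilAlong (α, β, γ) X) (z : ℂ) :
    NilAlong (α, γ, β) fun n => z • X (n.1, n.2.2, n.2.1) := by
  intro n
  obtain ⟨N, hN⟩ := hX (n.1, n.2.2, n.2.1)
  refine ⟨N, fun t ht => ?_⟩
  have := hN t ht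
  simp only [Prod.smul_mk, Prod.add_def] at this ⊢
  rw [this, smul_zero]

theorem mul12_commLeft {f : ℂ[T;T⁻¹]} (h : KillsAt f a b 0) (c : VertexOperator ℂ W) (w : W)
    {r : ℤ} (hr : 0 ≤ r) (p q : ℤ) : mul12 f (commLeft a b c w r p q) = 0 := by
  have hF : IsKernelFamily fun r p q => mul12 f (commLeft a b c w r p q) :=
    (isKernelFamily_commLeft a b c w).act _
  have t1 := tame_tri (tame_prodFun₃ a b c w)
  have t2 := tame_tri (tame_prodFun₃ b a c w)
  have h13 : ∀ r p q, NilAlong (-1, 0, 1) (mul12 f (commLeft a b c w r p q)) := fun r p q =>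
    ((t1 r p q).nil13.sub ((t2 r q p).nil23.comp_swap12 _)).act _
  have h23 : ∀ r p q, NilAlong (0, -1, 1) (mul12 f (commLeft a b c w r p q)) := fun r p q =>
    ((t1 r p q).nil23.sub ((t2 r q p).nil13.comp_swap12 _)).act _
  refine hF.eq_zero12_of_nonneg (hF.eq_zero13 h13 (hF.eq_zero23 h23 ?_ q) p) hr
  ext ⟨i, j, k⟩
  rw [mul12_apply]
  have := congrFun (h ((ncoeff c k) w)) (i, j)
  refine Eq.trans (congrArg (fun F => mulT f F (i, j)) ?_) this
  ext ⟨i, j⟩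
  simp only [commLeft, Pi.sub_apply, swap12, tri_zero, jac_zero, prodFun₃, zpow_zero, one_smul]

theorem mul23_commRight {f : ℂ[T;T⁻¹]} (h : KillsAt f b c 0) (a : VertexOperator ℂ W) (w : W)
    (r p : ℤ) {q : ℤ} (hq : 0 ≤ q) : mul23 f (commRight a b c w r p q) = 0 := by
  have hF : IsKernelFamily fun r p q => mul23 f (commRight a b c w r p q) :=
    (isKernelFamily_commRight a b c w).act _
  have t1 := tame_tri (tame_prodFun₃ a b c w)
  have t2 := tame_tri (tame_prodFun₃ a c b w)
  have h12 : ∀ r p q, NilAlong (-1, 1, 0) (mul23 f (commRight a b c w r p q)) := fun r p q =>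
    ((t1 r p q).nil12.sub ((t2 p r q).nil13.comp_swap23 _)).act _
  have h13 : ∀ r p q, NilAlong (-1, 0, 1) (mul23 f (commRight a b c w r p q)) := fun r p q =>
    ((t1 r p q).nil13.sub ((t2 p r q).nil12.comp_swap23 _)).act _
  refine hF.eq_zero23_of_nonneg (hF.eq_zero13 h13 (hF.eq_zero12 h12 ?_ r) p) hq
  ext ⟨i, j, k⟩
  rw [mul23_apply]
  have e : (fun n : ℤ × ℤ => commRight a b c w 0 0 0 (i, n.1, n.2)) =
      fun n => (a[[i]]) (jac b c w 0 n) := by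
    ext ⟨j, k⟩
    simp only [commRight, Pi.sub_apply, swap23, tri_zero, jac_zero, prodFun₃, zpow_zero, one_smul,
      map_sub]
  have := congrArg (a[[i]]) (congrFun (h w) (j, k))
  rw [mulT_apply, map_finsuppSum] at this
  rw [e, mulT_apply]
  simpa only [map_smul, Pi.zero_apply, map_zero] using this

theorem mul12_kerLeft {f : ℂ[T;T⁻¹]} (h : KillsAt f a b 0) (c : VertexOperator ℂ W) (w : W)
    {r : ℤ} (hr : 0 ≤ r) (p q : ℤ) : mul12 f (kerLeft a b c w r p q) = 0 := by
  have e : kerLeft a b c w r p q = commLeft a b c w r p q -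
    swap23 (swap12 (commRight c a b w)) r p q := rfl
  rw [e, map_sub, mul12_commLeft h c w hr, zero_sub, neg_eq_zero]
  ext ⟨i, j, k⟩
  have := congrFun (mul23_commRight h c w p q hr) (k, i, j)
  rw [mul23_apply, mulT_apply] at this
  rw [mul12_apply, mulT_apply]
  refine Eq.trans ?_ ((congrArg (((-1 : ℂ) ^ q * (-1) ^ p) • ·) this).trans (by simp))
  simp only [Finsupp.smul_sum, swap12, swap23, smul_smul]
  exact Finsupp.sum_congr fun s _ => congrArg (· • _) (by ring)

theorem mul23_kerRight {f : ℂ[T;T⁻¹]} (h : KillsAt f b c 0) (a : VertexOperator ℂ W) (w : W)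
    (r p : ℤ) {q : ℤ} (hq : 0 ≤ q) : mul23 f (kerRight a b c w r p q) = 0 := by
  have e : kerRight a b c w r p q = commRight a b c w r p q -
    swap12 (swap23 (commLeft b c a w)) r p q := rfl
  rw [e, map_sub, mul23_commRight h a w r p hq, zero_sub, neg_eq_zero]
  ext ⟨i, j, k⟩
  have := congrFun (mul12_commLeft h a w hq r p) (j, k, i)
  rw [mul12_apply, mulT_apply] at this
  rw [mul23_apply, mulT_apply]
  refine Eq.trans ?_ ((congrArg (((-1 : ℂ) ^ r * (-1) ^ p) • ·) this).trans (by simp))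
  simp only [Finsupp.smul_sum, swap12, swap23, smul_smul]
  exact Finsupp.sum_congr fun s _ => congrArg (· • _) (by ring)

theorem mul12_kerLeft_of_le {e G : ℂ[T;T⁻¹]} {N : ℕ} (h : KillsAt (tOne ^ N * G) a b 0)
    (hG : G ∣ e) (c : VertexOperator ℂ W) (w : W) {r : ℤ} (hr : N ≤ r) (p q : ℤ) :
    mul12 e (kerLeft a b c w r p q) = 0 := by
  obtain ⟨u, rfl⟩ := hG
  ext ⟨i, j, k⟩
  have := congrFun (mul12_kerLeft (h.mul_left u) c w (show 0 ≤ r - N by omega) p q) (i, j + N, k)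
  rw [mul12_apply, show u * (tOne ^ N * G) = tOne ^ N * (G * u) by ring,
    mulT_tOne_pow_mul (F := fun r n => kerLeft a b c w r p q (n.1, n.2, k))
      (fun r i j => (isKernelFamily_kerLeft a b c w).rel12 r p q i j k), sub_add_cancel,
    add_sub_cancel_right] at this
  rw [mul12_apply, this]
  rfl

theorem mul23_kerRight_of_le {e G : ℂ[T;T⁻¹]} {N : ℕ} (h : KillsAt (tOne ^ N * G) b c 0)
    (hG : G ∣ e) (a : VertexOperator ℂ W) (w : W) (r p : ℤ) {q : ℤ} (hq : N ≤ q) :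
    mul23 e (kerRight a b c w r p q) = 0 := by
  obtain ⟨u, rfl⟩ := hG
  ext ⟨i, j, k⟩
  have := congrFun (mul23_kerRight (h.mul_left u) a w r p (show 0 ≤ q - N by omega)) (i, j, k + N)
  rw [mul23_apply, show u * (tOne ^ N * G) = tOne ^ N * (G * u) by ring,
    mulT_tOne_pow_mul (F := fun q n => kerRight a b c w r p q (i, n.1, n.2))
      (fun q j k => (isKernelFamily_kerRight a b c w).rel23 r p q i j k), sub_add_cancel,
    add_sub_cancel_right] at this
  rw [mul23_apply, this]
  rfl

/-! ### Kernels of triples as kernels of pairs -/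

theorem nilAlong_jacobiFirst_left (a b c : VertexOperator ℂ W) (w : W) (r : ℤ)
    (f : ℤ → ℤ × ℤ) : NilAlong ((-1, 1) : ℤ × ℤ)
      fun n => jacobiFirst a b ((ncoeff c n.2) w) r (f n.1).1 (f n.1).2 := by
  rintro ⟨i, j⟩
  obtain ⟨N, hN⟩ := c.exists_trunc w
  refine ⟨(N - j).toNat, fun t ht => ?_⟩
  have e : ((i, j) + t • (-1, 1) : ℤ × ℤ) = (i - t, j + t) := by simp [sub_eq_add_neg]
  rw [e]
  beta_reduce
  rw [hN _ (by dsimp only; omega)]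
  simp [jacobiFirst]

theorem jacobiFirst_kerField_left (a b c : VertexOperator ℂ W) (w : W) (m n i j k : ℤ) :
    jacobiFirst (kerField 1 a b i m) c w n j k = commLeft a b c w m 0 n (i, j, k) := by
  have e1 : tri (prodFun₃ a b c w) m 0 n (i, j, k) = expand ((-1, 1) : ℤ × ℤ) n
      (fun x => jacobiFirst a b ((ncoeff c x.2) w) m i x.1) (j + n, k) := by
    rw [tri, expand_zero, (tame_expand_comm (tame_prodFun₃ a b c w) m 0 n).2.1, expand, expand]
    refine finsum_congr fun t => ?_
    rw [jacobiFirst_eq, expand, expand]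
    congr 1
    refine finsum_congr fun s => ?_
    simp only [prodFun, prodFun₃, Prod.smul_mk, Prod.mk_add_mk, add_zero, smul_zero]
  have e2 : tri (prodFun₃ b a c w) m n 0 (j, i, k) = expand ((-1, 1) : ℤ × ℤ) n
      (fun x => jacobiFirst b a ((ncoeff c x.2) w) m x.1 i) (j + n, k) := by
    rw [tri, expand_zero, (tame_expand_comm (tame_prodFun₃ b a c w) m n 0).1, expand, expand]
    refine finsum_congr fun t => ?_
    rw [jacobiFirst_eq, expand, expand]
    congr 1
    refine finsum_congr fun s => ?_
    simp only [prodFun, prodFun₃, Prod.smul_mk, Prod.mk_add_mk, add_zero, smul_zero]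
    congr 2; ring_nf
  have e3 : prodFun (kerField 1 a b i m) c w =
      (fun x => jacobiFirst a b ((ncoeff c x.2) w) m i x.1) +
        (-(-1 : ℂ) ^ m) • fun x => jacobiFirst b a ((ncoeff c x.2) w) m x.1 i := by
    ext x
    rw [prodFun, kerField_ncoeff, mulT_one, jac, jacobiSecond_eq, Pi.add_apply, Pi.smul_apply,
      neg_smul, sub_eq_add_neg]
  have n1 := nilAlong_jacobiFirst_left a b c w m fun x => (i, x)
  have n2 : NilAlong ((-1, 1) : ℤ × ℤ)
      ((-(-1 : ℂ) ^ m) • fun x : ℤ × ℤ => jacobiFirst b a ((ncoeff c x.2) w) m x.1 i) := fun x => by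
    obtain ⟨N, hN⟩ := nilAlong_jacobiFirst_left b a c w m (fun x => (x, i)) x
    exact ⟨N, fun t ht => by rw [Pi.smul_apply]; exact (congrArg _ (hN t ht)).trans (smul_zero _)⟩
  rw [jacobiFirst_eq, e3, expand_add n1 n2, expand_smul, Pi.add_apply, Pi.smul_apply, ← e1, ← e2,
    commLeft, Pi.sub_apply, Pi.sub_apply, Pi.sub_apply, Pi.sub_apply, swap12, neg_smul,
    sub_eq_add_neg]

theorem jacobiFirst_kerField_right (a b c : VertexOperator ℂ W) (w : W) (m n i j k : ℤ) :
    jacobiFirst c (kerField 1 a b i m) w n k j = commRight c a b w 0 n m (k, i, j) := by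
  have e1 : tri (prodFun₃ c a b w) 0 n m (k, i, j) = expand ((-1, 1) : ℤ × ℤ) n
      (fun x => (ncoeff c x.1) (jacobiFirst a b w m i x.2)) (k + n, j) := by
    rw [tri, expand_zero, expand, expand]
    refine finsum_congr fun t => ?_
    rw [jacobiFirst_eq, map_expand (nilAlong_prodFun a b w), expand, expand]
    congr 1
    refine finsum_congr fun s => ?_
    simp only [prodFun, prodFun₃, Prod.smul_mk, Prod.mk_add_mk, add_zero, smul_zero]
  have e2 : tri (prodFun₃ c b a w) n 0 m (k, j, i) = expand ((-1, 1) : ℤ × ℤ) n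
      (fun x => (ncoeff c x.1) (jacobiFirst b a w m x.2 i)) (k + n, j) := by
    rw [tri, expand_zero, expand, expand]
    refine finsum_congr fun t => ?_
    rw [jacobiFirst_eq, map_expand (nilAlong_prodFun b a w), expand, expand]
    congr 1
    refine finsum_congr fun s => ?_
    simp only [prodFun, prodFun₃, Prod.smul_mk, Prod.mk_add_mk, add_zero, smul_zero]
    congr 2; ring_nf
  have e3 : prodFun c (kerField 1 a b i m) w =
      (fun x => (ncoeff c x.1) (jacobiFirst a b w m i x.2)) +
        (-(-1 : ℂ) ^ m) • fun x => (ncoeff c x.1) (jacobiFirst b a w m x.2 i) := by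
    ext x
    rw [prodFun, kerField_ncoeff, mulT_one, jac, jacobiSecond_eq, Pi.add_apply, Pi.smul_apply,
      neg_smul, ← sub_eq_add_neg, map_sub, map_smul]
  have n1 : NilAlong ((-1, 1) : ℤ × ℤ)
      fun x => (ncoeff c x.1) (jacobiFirst a b w m i x.2) := by
    rintro ⟨k, j⟩
    obtain ⟨N, hN⟩ := b.exists_trunc w
    refine ⟨(N - j).toNat, fun t ht => ?_⟩
    have e : ((k, j) + t • (-1, 1) : ℤ × ℤ) = (k - t, j + t) := by simp [sub_eq_add_neg]
    rw [e]
    beta_reduce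
    rw [jacobiFirst]
    refine (congrArg _ (finsum_eq_zero_of_forall_eq_zero fun s => ?_)).trans (map_zero _)
    rw [hN _ (by dsimp only; omega), map_zero, smul_zero]
  have n2 := (nilAlong_prodFun c (kerField 1 a b i m) w).sub n1
  rw [e3, add_sub_cancel_left] at n2
  rw [jacobiFirst_eq, e3, expand_add n1 n2, expand_smul, Pi.add_apply, Pi.smul_apply, ← e1, ← e2,
    commRight, Pi.sub_apply, Pi.sub_apply, Pi.sub_apply, Pi.sub_apply, swap23, neg_smul,
    sub_eq_add_neg]

/-- The kernel of three fields is the kernel of a pair in which the first field is a residue of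
the kernel of `a, b`. -/
theorem kerLeft_eq_jac (a b c : VertexOperator ℂ W) (w : W) (m n i j k : ℤ) :
    kerLeft a b c w m 0 n (i, j, k) = jac (kerField 1 a b i m) c w n (j, k) := by
  rw [jac, jacobiSecond_eq]
  dsimp only
  rw [jacobiFirst_kerField_left, jacobiFirst_kerField_right]
  simp only [kerLeft, Pi.sub_apply, swap12, swap23, zpow_zero, one_smul]

theorem kerRight_eq_jac (a b c : VertexOperator ℂ W) (w : W) (p q i j k : ℤ) :
    kerRight a b c w 0 p q (i, j, k) = jac a (kerField 1 b c j q) w p (i, k) := by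
  rw [jac, jacobiSecond_eq]
  dsimp only
  rw [jacobiFirst_kerField_left, jacobiFirst_kerField_right]
  simp only [kerRight, Pi.sub_apply, swap12, swap23, zpow_zero, one_smul]

end Triple

/-! ### Dong's lemma and residues of kernels of triples -/

section Borcherds

variable {W : Type*} [AddCommGroup W] [Module ℂ W] {a b c : VertexOperator ℂ W}

theorem kerField_add (e e' : ℂ[T;T⁻¹]) (a b : VertexOperator ℂ W) (i r : ℤ) :
    kerField (e + e') a b i r = kerField e a b i r + kerField e' a b i r := by
  refine ext_ncoeff fun j w => ?_
  rw [ncoeff_add, kerField_ncoeff, kerField_ncoeff, kerField_ncoeff, mulT_add]; rfl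

theorem kerField_single (s : ℤ) (z : ℂ) (a b : VertexOperator ℂ W) (i r : ℤ) :
    kerField (AddMonoidAlgebra.single s z) a b i r = z • shift (-s) (kerField 1 a b (i + s) r) := by
  refine ext_ncoeff fun j w => ?_
  rw [ncoeff_smul, kerField_ncoeff, shift_ncoeff, kerField_ncoeff, mulT_one, mulT_single,
    sub_eq_add_neg]

theorem kerField_zero (a b : VertexOperator ℂ W) (i r : ℤ) : kerField 0 a b i r = 0 :=
  kerField_eq_zero (fun w => by rw [mulT, map_zero, map_zero]; rfl) i

theorem jac_add_left (a a' b : VertexOperator ℂ W) (w : W) (r : ℤ) :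
    jac (a + a') b w r = jac a b w r + jac a' b w r := by
  simp only [← jacLin_apply, map_add, LinearMap.add_apply]

theorem jac_add_right (a b b' : VertexOperator ℂ W) (w : W) (r : ℤ) :
    jac a (b + b') w r = jac a b w r + jac a b' w r := by
  simp only [← jacLin_apply, map_add, LinearMap.add_apply]

theorem jac_smul_left (z : ℂ) (a b : VertexOperator ℂ W) (w : W) (r : ℤ) :
    jac (z • a) b w r = z • jac a b w r := by
  simp only [← jacLin_apply, map_smul, LinearMap.smul_apply]

theorem jac_smul_right (z : ℂ) (a b : VertexOperator ℂ W) (w : W) (r : ℤ) :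
    jac a (z • b) w r = z • jac a b w r := by
  simp only [← jacLin_apply, map_smul, LinearMap.smul_apply]

theorem jac_sum_left {ι : Type*} (s : Finset ι) (a : ι → VertexOperator ℂ W)
    (b : VertexOperator ℂ W) (w : W) (r : ℤ) :
    jac (∑ i ∈ s, a i) b w r = ∑ i ∈ s, jac (a i) b w r := by
  simp only [← jacLin_apply, map_sum, LinearMap.sum_apply]

theorem jac_sum_right {ι : Type*} (s : Finset ι) (a : VertexOperator ℂ W)
    (b : ι → VertexOperator ℂ W) (w : W) (r : ℤ) :
    jac a (∑ i ∈ s, b i) w r = ∑ i ∈ s, jac a (b i) w r := by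
  simp only [← jacLin_apply, map_sum, LinearMap.sum_apply]

theorem jac_zero_left (b : VertexOperator ℂ W) (w : W) (r : ℤ) : jac 0 b w r = 0 := by
  simp only [← jacLin_apply, map_zero, LinearMap.zero_apply]

theorem jac_zero_right (a : VertexOperator ℂ W) (w : W) (r : ℤ) : jac a 0 w r = 0 := by
  simp only [← jacLin_apply, map_zero, LinearMap.zero_apply]

theorem mul12_kerLeft_eq_jac (e : ℂ[T;T⁻¹]) (a b c : VertexOperator ℂ W) (w : W) (m n i j k : ℤ) :
    mul12 e (kerLeft a b c w m 0 n) (i, j, k) = jac (kerField e a b i m) c w n (j, k) := by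
  rw [mul12_apply]
  induction e using AddMonoidAlgebra.induction_linear with
  | zero => rw [kerField_zero, jac_zero_left, mulT, map_zero, map_zero]; rfl
  | add e e' he he' => rw [mulT_add, kerField_add, jac_add_left, Pi.add_apply, he, he']; rfl
  | single s z =>
    rw [mulT_single, kerField_single, jac_smul_left, Pi.smul_apply, jac_shift_left, kerLeft_eq_jac,
      sub_eq_add_neg]

theorem mul23_kerRight_eq_jac (e : ℂ[T;T⁻¹]) (a b c : VertexOperator ℂ W) (w : W) (p q i j k : ℤ) :
    mul23 e (kerRight a b c w 0 p q) (i, j, k) = jac a (kerField e b c j q) w p (i, k) := by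
  rw [mul23_apply]
  induction e using AddMonoidAlgebra.induction_linear with
  | zero => rw [kerField_zero, jac_zero_right, mulT, map_zero, map_zero]; rfl
  | add e e' he he' => rw [mulT_add, kerField_add, jac_add_right, Pi.add_apply, he, he']; rfl
  | single s z =>
    rw [mulT_single, kerField_single, jac_smul_right, Pi.smul_apply, jac_shift_right,
      kerRight_eq_jac, sub_eq_add_neg]

theorem mul12_comm13 (e e' : ℂ[T;T⁻¹]) (F : ℤ × ℤ × ℤ → W) :
    mul12 e (mul13 e' F) = mul13 e' (mul12 e F) := act_comm _ _ _

theorem mul12_comm23 (e e' : ℂ[T;T⁻¹]) (F : ℤ × ℤ × ℤ → W) :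
    mul12 e (mul23 e' F) = mul23 e' (mul12 e F) := act_comm _ _ _

theorem mul13_comm23 (e e' : ℂ[T;T⁻¹]) (F : ℤ × ℤ × ℤ → W) :
    mul13 e (mul23 e' F) = mul23 e' (mul13 e F) := act_comm _ _ _

theorem mul13_swap23 {f : ℂ[T;T⁻¹]} {F : ℤ → ℤ → ℤ → ℤ × ℤ × ℤ → W} {r p q : ℤ}
    (h : mul12 f (F p r q) = 0) : mul13 f (swap23 F r p q) = 0 := by
  ext ⟨i, j, k⟩
  have := congrFun h (i, k, j)
  rw [mul12_apply, mulT_apply] at this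
  rw [mul13_apply, mulT_apply]
  refine Eq.trans ?_ ((congrArg ((-1 : ℂ) ^ q • ·) this).trans (by simp))
  simp only [Finsupp.smul_sum, swap23, smul_smul]
  exact Finsupp.sum_congr fun s _ => congrArg (· • _) (by ring)

theorem mul13_swap12 {f : ℂ[T;T⁻¹]} {F : ℤ → ℤ → ℤ → ℤ × ℤ × ℤ → W} {r p q : ℤ}
    (h : mul23 f (F r q p) = 0) : mul13 f (swap12 F r p q) = 0 := by
  ext ⟨i, j, k⟩
  have := congrFun h (j, i, k)
  rw [mul23_apply, mulT_apply] at this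
  rw [mul13_apply, mulT_apply]
  refine Eq.trans ?_ ((congrArg ((-1 : ℂ) ^ r • ·) this).trans (by simp))
  simp only [Finsupp.smul_sum, swap12, smul_smul]
  exact Finsupp.sum_congr fun s _ => congrArg (· • _) (by ring)

theorem mul23_swap12_swap23 {f : ℂ[T;T⁻¹]} {F : ℤ → ℤ → ℤ → ℤ × ℤ × ℤ → W} {r p q : ℤ}
    (h : mul12 f (F q r p) = 0) : mul23 f (swap12 (swap23 F) r p q) = 0 := by
  ext ⟨i, j, k⟩
  have := congrFun h (j, k, i)
  rw [mul12_apply, mulT_apply] at this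
  rw [mul23_apply, mulT_apply]
  refine Eq.trans ?_ ((congrArg (((-1 : ℂ) ^ r * (-1) ^ p) • ·) this).trans (by simp))
  simp only [Finsupp.smul_sum, swap12, swap23, smul_smul]
  exact Finsupp.sum_congr fun s _ => congrArg (· • _) (by ring)

theorem kerLeft_eq_comm (a b c : VertexOperator ℂ W) (w : W) :
    kerLeft a b c w = (commRight a b c w + swap23 (commLeft a c b w)) -
      (swap12 (commRight b a c w) + swap12 (swap23 (commLeft b c a w))) := by
  ext r p q ⟨i, j, k⟩
  have h1 : (-1 : ℂ) ^ r * (-1) ^ p * (-1) ^ q = (-1) ^ q * (-1) ^ p * (-1) ^ r := by ring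
  simp only [kerLeft, commLeft, commRight, swap12, swap23, Pi.sub_apply, Pi.add_apply, smul_sub,
    smul_smul]
  simp only [← mul_assoc, h1]
  abel

/-- The iterated commutator `[[a, b], c]` is a combination of terms with an inner commutator of
`b, c` and terms with an inner commutator of `a, c`; so it has poles at those of the pairs `a, c`
and `b, c`. -/
theorem mul13_mul23_kerLeft {f : ℂ[T;T⁻¹]} (hac : KillsAt f a c 0) (hbc : KillsAt f b c 0) (w : W)
    (r : ℤ) {p q : ℤ} (hp : 0 ≤ p) (hq : 0 ≤ q) :
    mul13 f (mul23 f (kerLeft a b c w r p q)) = 0 := by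
  have e : kerLeft a b c w r p q = (commRight a b c w r p q + swap23 (commLeft a c b w) r p q) -
      (swap12 (commRight b a c w) r p q + swap12 (swap23 (commLeft b c a w)) r p q) := by
    rw [kerLeft_eq_comm]; rfl
  have h1 := mul23_commRight hbc a w r p hq
  have h2 := mul13_swap23 (mul12_commLeft hac b w hp r q)
  have h3 := mul13_swap12 (mul23_commRight hac b w r q hp)
  have h4 := mul23_swap12_swap23 (mul12_commLeft hbc a w hq r p)
  rw [e, map_sub, map_add, map_add, h1, h4, add_zero, zero_add, map_sub, mul13_comm23, h2,
    mul13_comm23, h3, map_zero, sub_zero]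

theorem tOne_dvd_T_sub_one (s : ℤ) : tOne ∣ (LaurentPolynomial.T s - 1 : ℂ[T;T⁻¹]) := by
  open LaurentPolynomial in
  have key : ∀ n : ℕ, tOne ∣ (T (n : ℤ) - 1 : ℂ[T;T⁻¹]) := fun n => by
    have := sub_dvd_pow_sub_pow (T 1 : ℂ[T;T⁻¹]) 1 n
    rwa [one_pow, T_pow, mul_one] at this
  obtain ⟨n, rfl | rfl⟩ := s.eq_nat_or_neg
  · exact key n
  · have : (LaurentPolynomial.T (-n : ℤ) - 1 : ℂ[T;T⁻¹]) =
        -LaurentPolynomial.T (-n : ℤ) * (LaurentPolynomial.T (n : ℤ) - 1) := by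
      rw [mul_sub, neg_mul, ← LaurentPolynomial.T_add]; simp
      ring
    rw [this]
    exact (key n).mul_left _

/-- A Laurent polynomial takes values at `x₂ / x₃` and `x₁ / x₃` whose difference is divisible by
`x₁ / x₂ - 1`. -/
theorem tau_tOne_dvd (f : ℂ[T;T⁻¹]) :
    (tau ((1, -1, 0) : ℤ × ℤ × ℤ) tOne) ∣
      tau ((0, 1, -1) : ℤ × ℤ × ℤ) f - tau ((1, 0, -1) : ℤ × ℤ × ℤ) f := by
  induction f using AddMonoidAlgebra.induction_linear with
  | zero => simp only [map_zero, sub_zero, dvd_zero]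
  | add f f' h h' => rw [map_add, map_add, add_sub_add_comm]; exact dvd_add h h'
  | single s z =>
    have e : tau ((0, 1, -1) : ℤ × ℤ × ℤ) (AddMonoidAlgebra.single s z) -
        tau ((1, 0, -1) : ℤ × ℤ × ℤ) (AddMonoidAlgebra.single s z) =
        -(tau ((0, 1, -1) : ℤ × ℤ × ℤ) (AddMonoidAlgebra.single s z)) *
          tau ((1, -1, 0) : ℤ × ℤ × ℤ) (LaurentPolynomial.T s - 1) := by
      rw [map_sub, map_one, LaurentPolynomial.T, tau_single, tau_single, tau_single, mul_sub,
        mul_one, neg_mul, AddMonoidAlgebra.single_mul_single, mul_one]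
      have : s • ((0, 1, -1) : ℤ × ℤ × ℤ) + s • (1, -1, 0) = s • (1, 0, -1) := by simp
      rw [this]
      ring
    rw [e]
    exact Dvd.dvd.mul_left (map_dvd _ (tOne_dvd_T_sub_one s)) _

/-- Dong's lemma: residues of the kernel of `a, b` are quasi-local with respect to `c`. -/
theorem killsAt_kerField_left {N L : ℕ} {G e : ℂ[T;T⁻¹]} {m : ℤ}
    (hab : KillsAt (tOne ^ N * G) a b 0) (hac : KillsAt (tOne ^ N * G) a c 0)
    (hbc : KillsAt (tOne ^ N * G) b c 0) (he : G ∣ e) (hL : N ≤ m + L) (i : ℤ) :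
    KillsAt ((tOne ^ N * G) ^ (1 + L)) (kerField e a b i m) c 0 := by
  set f := tOne ^ N * G with hf
  intro w
  ext ⟨j, k⟩
  have e1 : mulT (f ^ (1 + L)) (jac (kerField e a b i m) c w 0) (j, k) =
      mul23 (f ^ (1 + L)) (mul12 e (kerLeft a b c w m 0 0)) (i, j, k) := by
    rw [mul23_apply]
    simp only [mul12_kerLeft_eq_jac]
  rw [e1]
  set X := kerLeft a b c w m 0 0 with hX
  -- modulo `f (x₁ / x₃)`, the power `f (x₂ / x₃) ^ L` is a multiple of `(x₁ / x₂ - 1) ^ L`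
  obtain ⟨y, hy⟩ := tau_tOne_dvd f
  obtain ⟨z, hz⟩ := sub_dvd_pow_sub_pow (tau ((0, 1, -1) : ℤ × ℤ × ℤ) f)
    (tau ((0, 1, -1) : ℤ × ℤ × ℤ) f - tau ((1, 0, -1) : ℤ × ℤ × ℤ) f) L
  rw [sub_sub_cancel, hy, mul_pow, sub_eq_iff_eq_add] at hz
  have h1 : mul13 f (mul23 f X) = 0 := mul13_mul23_kerLeft hac hbc w m le_rfl le_rfl
  have h2 : mul12 (tOne ^ L * e) X = 0 := by
    ext ⟨i, j, k⟩
    rw [mul12_apply, mulT_tOne_pow_mul (F := fun r n => kerLeft a b c w r 0 0 (n.1, n.2, k))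
      (fun r i j => (isKernelFamily_kerLeft a b c w).rel12 r 0 0 i j k), ← mul12_apply,
      mul12_kerLeft_of_le hab he c w (by omega)]
    rfl
  have e2 : mul23 (f ^ (1 + L)) (mul12 e X) =
      act (z * tau (1, -1, 0) e) (mul13 f (mul23 f X)) +
        act (tau (0, 1, -1) f * y ^ L) (mul12 (tOne ^ L * e) X) := by
    simp only [mul12, mul13, mul23, ← act_mul, ← act_add]
    congr 2
    simp only [pow_add, pow_one, map_mul, map_pow, hz]
    ring
  rw [e2, h1, h2, map_zero, map_zero, add_zero]
  rfl

theorem KillsAt.symm_of_dvd {f : ℂ[T;T⁻¹]} (hf : LaurentPolynomial.invert f ∣ f) {r : ℤ}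
    (h : KillsAt f a b r) : KillsAt f b a r := h.swap.of_dvd hf

theorem killsAt_kerField_right {N L : ℕ} {G e : ℂ[T;T⁻¹]} {m : ℤ}
    (hinv : LaurentPolynomial.invert (tOne ^ N * G) ∣ tOne ^ N * G)
    (hab : KillsAt (tOne ^ N * G) a b 0) (hac : KillsAt (tOne ^ N * G) a c 0)
    (hbc : KillsAt (tOne ^ N * G) b c 0) (he : G ∣ e) (hL : N ≤ m + L) (i : ℤ) :
    KillsAt ((tOne ^ N * G) ^ (1 + L)) a (kerField e b c i m) 0 := by
  refine (killsAt_kerField_left hbc (hab.symm_of_dvd hinv) (hac.symm_of_dvd hinv) he hL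
    i).symm_of_dvd ?_
  rw [map_pow]
  exact pow_dvd_pow_of_dvd hinv _

/-- The residue of the kernel of `[[a, b], c]`, localized at the diagonals of all pairs, is the
iterated product `(aₘ b)ₙ c`. The residue in `x₁` is taken by Taylor expansion of the kernel of
`a, b` at `x₁ = x₂`; the multiplier `e(x₁ / x₃)` agrees with `1` at the diagonal to the order `M`,
so that its higher Taylor coefficients do not contribute. -/
theorem kerLeft_residue {N L M : ℕ} {G e : ℂ[T;T⁻¹]} (hG : IsCoprime tOne G)
    (hab : KillsAt (tOne ^ N * G) a b 0) (hac : KillsAt (tOne ^ N * G) a c 0)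
    (hbc : KillsAt (tOne ^ N * G) b c 0) (he : G ^ (1 + L) ∣ e) (heM : tOne ^ M ∣ e - 1)
    {m n : ℤ} (hL : N ≤ m + L) (hL0 : 0 < L) (hLM : L ≤ M) (hM : N * (1 + L) + L ≤ n + M)
    (w : W) (k : ℤ) :
    mul12 e (mul13 e (mul23 e (kerLeft a b c w m 0 n))) (0, 0, k) =
      ((prodN (prodN a b m) c n)[[k]]) w := by
  have hGe : G ∣ e := (Dvd.intro_left (G ^ L) (by ring)).trans he
  have hkill : ∀ i : ℕ, KillsAt (tOne ^ (N * (1 + L)) * G ^ (1 + L))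
      (kerField e a b 0 (m + i)) c 0 := fun i => by
    have := killsAt_kerField_left (m := m + i) hab hac hbc hGe (L := L) (by omega) 0
    rwa [mul_pow, ← pow_mul] at this
  have hpab : prodN a b m = kerField e a b 0 m :=
    prodN_eq ⟨N, G, M, hG, hab, hGe, heM, by omega⟩
  have h0 := hkill 0
  rw [Nat.cast_zero, add_zero] at h0
  have hpc : prodN (kerField e a b 0 m) c n = kerField (e * e) (kerField e a b 0 m) c 0 n := by
    refine prodN_eq ⟨_, _, M, hG.pow_right, h0, he.mul_right _, ?_, by push_cast; omega⟩
    rw [show e * e - 1 = (e - 1) * (e + 1) by ring]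
    exact heM.mul_right _
  rw [mul12_comm13, mul12_comm23, mul13_apply, mulT_apply]
  have step : ∀ s : ℤ, mul23 e (mul12 e (kerLeft a b c w m 0 n)) (0 + s, 0, k - s) =
      ∑ i ∈ Finset.range L, ((Ring.choose s i : ℤ) : ℂ) •
        mulT e (jac (kerField e a b 0 (m + i)) c w n) (-i + s, k - s) := by
    intro s
    have e1 : (fun x : ℤ × ℤ => mul12 e (kerLeft a b c w m 0 n) (0 + s, x.1, x.2)) =
        ∑ i ∈ Finset.range L, ((Ring.choose s i : ℤ) : ℂ) • fun x : ℤ × ℤ =>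
          jac (kerField e a b 0 (m + i)) c w n (x.1 + (s - i), x.2) := by
      ext ⟨x, y⟩
      rw [mul12_kerLeft_eq_jac, zero_add, kerField_taylor (m := N)
        (hab.of_order_zero hGe le_rfl) s m hL, jac_sum_left, Finset.sum_apply, Finset.sum_apply]
      refine Finset.sum_congr rfl fun i _ => ?_
      rw [jac_smul_left, Pi.smul_apply, jac_shift_left]; rfl
    rw [mul23_apply, e1, map_sum, Finset.sum_apply]
    refine Finset.sum_congr rfl fun i _ => ?_
    rw [map_smul, Pi.smul_apply, mulT_apply, mulT_apply]
    congr 2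
    ext t z
    simp only
    congr 3
    ring
  -- the sum over the terms of the multiplier gives its Taylor coefficients at `1`
  simp only [step, Finset.smul_sum]
  rw [Finsupp.sum, Finset.sum_comm]
  have term : ∀ i : ℕ, (∑ s ∈ e.coeff.support, e.coeff s • ((Ring.choose s i : ℤ) : ℂ) •
      mulT e (jac (kerField e a b 0 (m + i)) c w n) (-i + s, k - s)) =
      mulT (theta (fun s => ((Ring.choose s i : ℤ) : ℂ)) e * e)
        (jac (kerField e a b 0 (m + i)) c w n) (-i, k) := by
    intro i
    rw [mulT_mul, mulT_apply, sum_theta _ _ fun s =>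
      mulT e (jac (kerField e a b 0 (m + i)) c w n) (-i + s, k - s)]
    exact Finset.sum_congr rfl fun s _ => by rw [smul_smul, mul_comm]
  rw [Finset.sum_congr rfl fun i _ => term i]
  obtain ⟨L', rfl⟩ := Nat.exists_eq_add_of_lt hL0
  rw [zero_add, Finset.sum_range_succ', Finset.sum_eq_zero, zero_add]
  · have e1 : theta (fun s => ((Ring.choose s 0 : ℤ) : ℂ)) e = e := by
      simp only [Ring.choose_zero_right, Int.cast_one, theta_one_fun]
    rw [e1, hpab, hpc, kerField_ncoeff]
    simp
  -- the Taylor coefficients of positive order vanish on the diagonal to an order exceeding the pole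
  · intro i hi
    rw [Finset.mem_range] at hi
    obtain ⟨x, hx⟩ := pow_dvd_theta (χ := fun i s => ((Ring.choose s i : ℤ) : ℂ)) (by simp)
      (by simp) choose_pos_step heM i
    rw [hx, mul_assoc, (hkill (i + 1)).of_order (Dvd.dvd.mul_left he x)
      (by push_cast [Nat.sub_add_comm] at hM ⊢; omega)]
    rfl

/-- The residue of the kernel of `[a, [b, c]]`, localized at the diagonals of all pairs, is the
iterated product `aₚ (b_q c)`; the residue in `x₂` is taken by Taylor expansion at `x₂ = x₃`.
After this expansion the poles in `x₁` are those of the pair `a, b_q c`, which `e(x₁ / x₃)`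
removes; so the multiplier `u` in `x₁ / x₂` only has to agree with `1` on the diagonal. The
generality in `u` is needed because exchanging `x₁` and `x₂` turns a multiplier into its
composition with `T ↦ T⁻¹`. -/
theorem kerRight_residue {N L M : ℕ} {G e u : ℂ[T;T⁻¹]} (hG : IsCoprime tOne G)
    (hinv : LaurentPolynomial.invert (tOne ^ N * G) ∣ tOne ^ N * G)
    (hab : KillsAt (tOne ^ N * G) a b 0) (hac : KillsAt (tOne ^ N * G) a c 0)
    (hbc : KillsAt (tOne ^ N * G) b c 0) (he : G ^ (1 + L) ∣ e) (heM : tOne ^ M ∣ e - 1)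
    (huM : tOne ^ M ∣ u - 1)
    {p q : ℤ} (hL : N ≤ q + L) (hL0 : 0 < L) (hLM : L ≤ M) (hM : N * (1 + L) + L ≤ p + M)
    (w : W) (k : ℤ) :
    mul12 u (mul13 e (mul23 e (kerRight a b c w 0 p q))) (0, 0, k) =
      ((prodN a (prodN b c q) p)[[k]]) w := by
  have hGe : G ∣ e := (Dvd.intro_left (G ^ L) (by ring)).trans he
  have hkill : ∀ i : ℕ, KillsAt (tOne ^ (N * (1 + L)) * G ^ (1 + L))
      a (kerField e b c 0 (q + i)) 0 := fun i => by
    have := killsAt_kerField_right (m := q + i) hinv hab hac hbc hGe (L := L) (by omega) 0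
    rwa [mul_pow, ← pow_mul] at this
  have hpbc : prodN b c q = kerField e b c 0 q :=
    prodN_eq ⟨N, G, M, hG, hbc, hGe, heM, by omega⟩
  have h0 := hkill 0
  rw [Nat.cast_zero, add_zero] at h0
  have hpa : prodN a (kerField e b c 0 q) p = kerField (u * e) a (kerField e b c 0 q) 0 p := by
    refine prodN_eq ⟨_, _, M, hG.pow_right, h0, he.mul_left _, ?_, by push_cast; omega⟩
    rw [show u * e - 1 = (u - 1) * e + (e - 1) by ring]
    exact dvd_add (huM.mul_right _) heM
  rw [mul12_apply, mulT_apply]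
  have step : ∀ s : ℤ, mul13 e (mul23 e (kerRight a b c w 0 p q)) (0 + s, 0 - s, k) =
      ∑ i ∈ Finset.range L, ((Ring.choose (-s) i : ℤ) : ℂ) •
        mulT e (jac a (kerField e b c 0 (q + i)) w p) (0 + s, k - i - s) := by
    intro s
    have e1 : (fun x : ℤ × ℤ => mul23 e (kerRight a b c w 0 p q) (x.1, 0 - s, x.2)) =
        ∑ i ∈ Finset.range L, ((Ring.choose (-s) i : ℤ) : ℂ) • fun x : ℤ × ℤ =>
          jac a (kerField e b c 0 (q + i)) w p (x.1, x.2 + (-s - i)) := by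
      ext ⟨x, y⟩
      rw [mul23_kerRight_eq_jac, zero_sub, kerField_taylor (m := N)
        (hbc.of_order_zero hGe le_rfl) (-s) q hL, jac_sum_right, Finset.sum_apply,
        Finset.sum_apply]
      refine Finset.sum_congr rfl fun i _ => ?_
      rw [jac_smul_right, Pi.smul_apply, jac_shift_right]; rfl
    rw [mul13_apply, e1, map_sum, Finset.sum_apply]
    refine Finset.sum_congr rfl fun i _ => ?_
    rw [map_smul, Pi.smul_apply, mulT_apply, mulT_apply]
    congr 2
    ext t z
    simp only
    congr 3
    ring
  -- the sum over the terms of the multiplier gives its Taylor coefficients at `1`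
  simp only [step, Finset.smul_sum]
  rw [Finsupp.sum, Finset.sum_comm]
  have term : ∀ i : ℕ, (∑ s ∈ u.coeff.support, u.coeff s • ((Ring.choose (-s) i : ℤ) : ℂ) •
      mulT e (jac a (kerField e b c 0 (q + i)) w p) (0 + s, k - i - s)) =
      mulT (theta (fun s => ((Ring.choose (-s) i : ℤ) : ℂ)) u * e)
        (jac a (kerField e b c 0 (q + i)) w p) (0, k - i) := by
    intro i
    rw [mulT_mul, mulT_apply, sum_theta _ _ fun s =>
      mulT e (jac a (kerField e b c 0 (q + i)) w p) (0 + s, k - i - s)]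
    exact Finset.sum_congr rfl fun s _ => by rw [smul_smul, mul_comm]
  rw [Finset.sum_congr rfl fun i _ => term i]
  obtain ⟨L', rfl⟩ := Nat.exists_eq_add_of_lt hL0
  rw [zero_add, Finset.sum_range_succ', Finset.sum_eq_zero, zero_add]
  · have e1 : theta (fun s => ((Ring.choose (-s) 0 : ℤ) : ℂ)) u = u := by
      simp only [Ring.choose_zero_right, Int.cast_one, theta_one_fun]
    rw [e1, hpbc, hpa, kerField_ncoeff]
    simp
  -- the Taylor coefficients of positive order vanish on the diagonal to an order exceeding the pole
  · intro i hi
    rw [Finset.mem_range] at hi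
    obtain ⟨x, hx⟩ := pow_dvd_theta (χ := fun i s => ((Ring.choose (-s) i : ℤ) : ℂ)) (by simp)
      (by simp) choose_neg_step huM i
    rw [hx, mul_assoc, (hkill (i + 1)).of_order (Dvd.dvd.mul_left he x)
      (by push_cast [Nat.sub_add_comm] at hM ⊢; omega)]
    rfl

end Borcherds

/-! ### The Borcherds identity -/

section BorcherdsIdentity

variable {W : Type*} [AddCommGroup W] [Module ℂ W] {a b c : VertexOperator ℂ W}

/-- Expansion of `(x₁ - x₃) ^ p = ((x₂ - x₃) + (x₁ - x₂)) ^ p` in powers of `x₁ - x₂`. -/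
theorem IsKernelFamily.expand_left {F : ℤ → ℤ → ℤ → ℤ × ℤ × ℤ → W} (h : IsKernelFamily F) {m₀ : ℤ}
    (hv : ∀ r p q, m₀ ≤ r → F r p q = 0) (r p q : ℤ) {n : ℕ} (hn : m₀ ≤ r + n) :
    F r p q = ∑ i ∈ Finset.range n, ((Ring.choose p i : ℤ) : ℂ) • F (r + i) 0 (q + p - i) := by
  refine pascal_expand (H := fun k l m => F m k l) (fun k l m => ?_) (fun k l m => hv m k l) n p q r
    hn
  ext ⟨i, j, k'⟩
  rw [Pi.add_apply, h.rel13, h.rel23, h.rel12]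
  abel

theorem neg_one_zpow_add_nat (r : ℤ) (i : ℕ) : (-1 : ℂ) ^ (r + i) = (-1) ^ r * (-1) ^ i := by
  rw [zpow_add₀ (by norm_num), zpow_natCast]

/-- Expansion of `(x₁ - x₂) ^ r = ((x₁ - x₃) - (x₂ - x₃)) ^ r` in powers of `x₂ - x₃`. -/
theorem IsKernelFamily.expand_right {F : ℤ → ℤ → ℤ → ℤ × ℤ × ℤ → W} (h : IsKernelFamily F) {m₀ : ℤ}
    (hv : ∀ r p q, m₀ ≤ q → F r p q = 0) (r p q : ℤ) {n : ℕ} (hn : m₀ ≤ q + n) :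
    F r p q = ∑ i ∈ Finset.range n, bin r i • F 0 (p + r - i) (q + i) := by
  have := pascal_expand (H := fun k l m => (-1 : ℂ) ^ m • F k l m) (fun k l m => ?_)
    (fun k l m hm => by rw [hv k l m hm, smul_zero]) n r p q hn
  · have h2 := congrArg ((-1 : ℂ) ^ q • ·) this
    simp only [Finset.smul_sum, smul_smul, neg_one_zpow_mul_self, one_smul] at h2
    rw [h2]
    refine Finset.sum_congr rfl fun i _ => ?_
    rw [neg_one_zpow_add_nat, bin]
    congr 1
    linear_combination ((Ring.choose r i : ℤ) : ℂ) * (-1) ^ i * neg_one_zpow_mul_self q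
  · ext ⟨i, j, k'⟩
    simp only [Pi.add_apply, Pi.smul_apply]
    rw [h.rel13, h.rel23, h.rel12, neg_one_zpow_succ]
    module

theorem mul12_swap (g : ℂ[T;T⁻¹]) (z : ℂ) (X : ℤ × ℤ × ℤ → W) :
    mul12 g (fun n => z • X (n.2.1, n.1, n.2.2)) =
      fun n => z • mul12 (LaurentPolynomial.invert g) X (n.2.1, n.1, n.2.2) := by
  ext ⟨i, j, k⟩
  rw [mul12_apply, mul12_apply]
  induction g using AddMonoidAlgebra.induction_linear with
  | zero => simp [mulT]
  | add g h hg hh =>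
    rw [map_add, mulT_add, mulT_add, Pi.add_apply, Pi.add_apply, hg, hh, smul_add]
  | single s c =>
    rw [LaurentPolynomial.invert, AddMonoidAlgebra.domCongr_single, mulT_single, mulT_single,
      smul_comm]
    simp [sub_eq_add_neg]

theorem mul13_swap (g : ℂ[T;T⁻¹]) (z : ℂ) (X : ℤ × ℤ × ℤ → W) :
    mul13 g (fun n => z • X (n.2.1, n.1, n.2.2)) =
      fun n => z • mul23 g X (n.2.1, n.1, n.2.2) := by
  ext ⟨i, j, k⟩
  rw [mul13_apply, mul23_apply, mulT_apply, mulT_apply, Finsupp.smul_sum]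
  exact Finsupp.sum_congr fun s _ => smul_comm _ _ _

theorem mul23_swap (g : ℂ[T;T⁻¹]) (z : ℂ) (X : ℤ × ℤ × ℤ → W) :
    mul23 g (fun n => z • X (n.2.1, n.1, n.2.2)) =
      fun n => z • mul13 g X (n.2.1, n.1, n.2.2) := by
  ext ⟨i, j, k⟩
  rw [mul13_apply, mul23_apply, mulT_apply, mulT_apply, Finsupp.smul_sum]
  exact Finsupp.sum_congr fun s _ => smul_comm _ _ _

/-- The right-hand sides of the Borcherds identity, as residues of the localized kernel of
`[a, [b, c]]`. -/
theorem kerRight_expand {N L M : ℕ} {G e u : ℂ[T;T⁻¹]} (hG : IsCoprime tOne G)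
    (hinv : LaurentPolynomial.invert (tOne ^ N * G) ∣ tOne ^ N * G)
    (hab : KillsAt (tOne ^ N * G) a b 0) (hac : KillsAt (tOne ^ N * G) a c 0)
    (hbc : KillsAt (tOne ^ N * G) b c 0) (he : G ^ (1 + L) ∣ e) (heM : tOne ^ M ∣ e - 1)
    (huM : tOne ^ M ∣ u - 1) {r p q : ℤ} {n : ℕ} (hL : N ≤ q + L) (hL0 : 0 < L) (hLn : L ≤ n)
    (hLM : L ≤ M) (hM : N * (1 + L) + L ≤ p + r - n + M) (w : W) (k : ℤ) :
    mul12 u (mul13 e (mul23 e (kerRight a b c w r p q))) (0, 0, k) =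
      ∑ i ∈ Finset.range n, bin r i • ((prodN a (prodN b c (q + i)) (p + r - i))[[k]]) w := by
  have hGe : G ∣ e := (Dvd.intro_left (G ^ L) (by ring)).trans he
  have hF : IsKernelFamily fun r p q => mul12 u (mul13 e (mul23 e (kerRight a b c w r p q))) :=
    (((isKernelFamily_kerRight a b c w).act _).act _).act _
  have := hF.expand_right (m₀ := N) (fun r p q hq => by
    rw [mul23_kerRight_of_le hbc hGe a w r p hq, map_zero, map_zero]) r p q (n := n) (by omega)
  rw [this, Finset.sum_apply]
  refine Finset.sum_congr rfl fun i hi => ?_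
  rw [Finset.mem_range] at hi
  rw [Pi.smul_apply, kerRight_residue hG hinv hab hac hbc he heM huM (by omega) hL0 hLM (by omega)]

/-- The Borcherds identity for the products of mutually quasi-local fields. Both sides are
residues of the kernel of `[[a, b], c] = [a, [b, c]] - [b, [a, c]]`, localized at the three
diagonals by the same multiplier. -/
theorem borcherds {N : ℕ} {G : ℂ[T;T⁻¹]} (hG : IsCoprime tOne G)
    (hinv : LaurentPolynomial.invert (tOne ^ N * G) ∣ tOne ^ N * G)
    (hab : KillsAt (tOne ^ N * G) a b 0) (hac : KillsAt (tOne ^ N * G) a c 0)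
    (hbc : KillsAt (tOne ^ N * G) b c 0) (r p q : ℤ) : ∀ᶠ n : ℕ in atTop,
    ∑ i ∈ Finset.range n, ((Ring.choose p i : ℤ) : ℂ) • prodN (prodN a b (r + i)) c (q + p - i) =
      ∑ i ∈ Finset.range n, bin r i • prodN a (prodN b c (q + i)) (p + r - i) -
        (-1 : ℂ) ^ r • ∑ i ∈ Finset.range n, bin r i • prodN b (prodN a c (p + i)) (q + r - i) := by
  set L : ℕ := 1 + N + r.natAbs + p.natAbs + q.natAbs with hL
  filter_upwards [eventually_ge_atTop L] with n hn
  set M : ℕ := N * (1 + L) + L + n + r.natAbs + p.natAbs + q.natAbs with hM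
  obtain ⟨e, he, heM⟩ := exists_multiplier hG M (1 + L)
  have hGe : G ∣ e := (Dvd.intro_left (G ^ L) (by ring)).trans he
  have hM' : (M : ℤ) = N * (1 + L) + L + n + r.natAbs + p.natAbs + q.natAbs := by
    rw [hM]; push_cast; rfl
  refine ext_ncoeff fun k w => ?_
  rw [map_sub, map_smul]
  simp only [Pi.sub_apply, LinearMap.sub_apply, Pi.smul_apply, LinearMap.smul_apply, ncoeff_sum,
    ncoeff_smul]
  rw [← kerRight_expand hG hinv hab hac hbc he heM heM (L := L) (M := M) (by omega) (by omega) hn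
      (by omega) (by omega),
    ← kerRight_expand hG hinv (hab.symm_of_dvd hinv) hbc hac he heM (pow_tOne_dvd_invert heM)
      (L := L) (M := M) (by omega) (by omega) hn (by omega) (by omega)]
  have hF : IsKernelFamily fun r p q => mul12 e (mul13 e (mul23 e (kerLeft a b c w r p q))) :=
    (((isKernelFamily_kerLeft a b c w).act _).act _).act _
  have h1 := hF.expand_left (m₀ := N) (fun r p q hr => by
    rw [mul12_comm13, mul12_comm23, mul12_kerLeft_of_le hab hGe c w hr, map_zero, map_zero])
    r p q (n := n) (by omega)
  have h2 := congrFun h1 (0, 0, k)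
  rw [Finset.sum_apply] at h2
  have h3 : mul12 e (mul13 e (mul23 e (kerLeft a b c w r p q))) (0, 0, k) =
      mul12 e (mul13 e (mul23 e (kerRight a b c w r p q))) (0, 0, k) - (-1 : ℂ) ^ r •
      mul12 (LaurentPolynomial.invert e) (mul13 e (mul23 e (kerRight b a c w r q p))) (0, 0, k) := by
    have e1 : kerLeft a b c w r p q = kerRight a b c w r p q -
        fun n => (-1 : ℂ) ^ r • kerRight b a c w r q p (n.2.1, n.1, n.2.2) := by
      rw [kerLeft_eq]; rfl
    rw [e1]
    simp only [map_sub, mul23_swap, mul13_swap, mul12_swap, Pi.sub_apply, mul13_comm23]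
  rw [← h3, h2]
  refine Finset.sum_congr rfl fun i hi => ?_
  rw [Finset.mem_range] at hi
  rw [Pi.smul_apply, kerLeft_residue hG hab hac hbc he heM (m := r + i) (by omega) (by omega)
    (by omega) (by omega)]

end BorcherdsIdentity

/-! ### Locality with prescribed poles -/

section Locality

open LaurentPolynomial

variable {W : Type*} [AddCommGroup W] [Module ℂ W] {a b c : VertexOperator ℂ W}

/-- The product of the `T - α`, for `α` in a list. -/
noncomputable def linProd (l : List ℂˣ) : ℂ[T;T⁻¹] := (l.map fun α : ℂˣ => T 1 - C (α : ℂ)).prod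

theorem linProd_append (l l' : List ℂˣ) : linProd (l ++ l') = linProd l * linProd l' := by
  simp [linProd]

theorem linProd_cons (α : ℂˣ) (l : List ℂˣ) :
    linProd (α :: l) = (T 1 - C (α : ℂ)) * linProd l := by
  simp [linProd]

theorem linProd_nil : linProd [] = 1 := by simp [linProd]

/-- Separation of the factors `T - 1` from the other factors. -/
theorem exists_linProd_eq (l : List ℂˣ) : ∃ (N : ℕ) (l' : List ℂˣ),
    IsCoprime tOne (linProd l') ∧ linProd l = tOne ^ N * linProd l' := by
  induction l with
  | nil => exact ⟨0, [], by rw [linProd_nil]; exact isCoprime_one_right, by simp [linProd_nil]⟩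
  | cons α l ih =>
    obtain ⟨N, l', hG, h⟩ := ih
    by_cases hα : α = 1
    · exact ⟨N + 1, l', hG, by
        rw [linProd_cons, h, hα, Units.val_one, ← tOne_eq, pow_succ]; ring⟩
    · refine ⟨N, α :: l', ?_, by rw [linProd_cons, linProd_cons, h]; ring⟩
      rw [linProd_cons]
      refine IsCoprime.mul_right ?_ hG
      rw [tOne_eq]
      exact isCoprime_T_sub_C fun h => hα (Units.ext h.symm)

theorem invert_linProd (l : List ℂˣ) : ∃ u, invert (linProd l) = u * linProd (l.map (·⁻¹)) := by
  induction l with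
  | nil => exact ⟨1, by simp [linProd_nil]⟩
  | cons α l ih =>
    obtain ⟨u, hu⟩ := ih
    refine ⟨-C (α : ℂ) * T (-1) * u, ?_⟩
    have e1 : (C (α : ℂ) * C ((α⁻¹ : ℂˣ) : ℂ) : ℂ[T;T⁻¹]) = 1 := by
      rw [← map_mul, ← Units.val_mul, mul_inv_cancel, Units.val_one, map_one]
    have e2 : (T (-1) * T 1 : ℂ[T;T⁻¹]) = 1 := by rw [← T_add]; simp
    rw [linProd_cons, map_mul, map_sub, invert_T, invert_C, hu, List.map_cons, linProd_cons]
    linear_combination (u * linProd (l.map (·⁻¹))) * (C (α : ℂ) * e2 - T (-1) * e1)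

theorem linProd_perm {l l' : List ℂˣ} (h : l.Perm l') : linProd l = linProd l' :=
  (h.map _).prod_eq

/-- A list closed under inversion gives an annihilator that serves both orders of the fields. -/
theorem invert_linProd_dvd (l : List ℂˣ) :
    invert (linProd (l ++ l.map (·⁻¹))) ∣ linProd (l ++ l.map (·⁻¹)) := by
  obtain ⟨u, hu⟩ := invert_linProd (l ++ l.map (·⁻¹))
  have hp : ((l ++ l.map (·⁻¹)).map (·⁻¹)).Perm (l ++ l.map (·⁻¹)) := by
    rw [List.map_append, List.map_map]
    simpa using List.perm_append_comm
  rw [linProd_perm hp] at hu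
  have := congrArg invert hu
  rw [map_mul, involutive_invert] at this
  exact ⟨invert u, by rw [mul_comm]; exact this⟩

/-- Locality with poles in `x₁ ∈ Φ x₂`: the kernel of `a, b` is annihilated by a product of
factors `x₁ / x₂ - α` with `α ∈ Φ`. -/
def LocalOn (Φ : Subgroup ℂˣ) (a b : VertexOperator ℂ W) : Prop :=
  ∃ l : List ℂˣ, (∀ α ∈ l, α ∈ Φ) ∧ KillsAt (linProd l) a b 0

variable {Φ : Subgroup ℂˣ}

/-- Locality is symmetric because the set of poles `Φ` is closed under inversion. -/
theorem LocalOn.symm (h : LocalOn Φ a b) : LocalOn Φ b a := by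
  obtain ⟨l, hl, h⟩ := h
  refine ⟨l.map (·⁻¹), fun α hα => ?_, ?_⟩
  · obtain ⟨β, hβ, rfl⟩ := List.mem_map.1 hα
    exact Φ.inv_mem (hl β hβ)
  · obtain ⟨u, hu⟩ := invert_linProd (l.map (·⁻¹))
    rw [List.map_map] at hu
    have e : l.map ((·⁻¹) ∘ (·⁻¹)) = l := by simp
    rw [e] at hu
    have h2 := (h.mul_left u)
    rw [← hu] at h2
    have h3 := h2.swap
    rwa [involutive_invert] at h3

theorem LocalOn.quasiLocal (h : LocalOn Φ a b) : QuasiLocal a b := by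
  obtain ⟨l, _, h⟩ := h
  obtain ⟨N, l', hG, e⟩ := exists_linProd_eq l
  exact ⟨N, linProd l', hG, e ▸ h⟩

/-- A common symmetric annihilator for three pairs of fields. -/
theorem LocalOn.common {a₁ b₁ a₂ b₂ a₃ b₃ : VertexOperator ℂ W} (h₁ : LocalOn Φ a₁ b₁)
    (h₂ : LocalOn Φ a₂ b₂) (h₃ : LocalOn Φ a₃ b₃) : ∃ (l : List ℂˣ) (N : ℕ) (G : ℂ[T;T⁻¹]),
    (∀ α ∈ l, α ∈ Φ) ∧ linProd l = tOne ^ N * G ∧ IsCoprime tOne G ∧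
    invert (tOne ^ N * G) ∣ tOne ^ N * G ∧ KillsAt (tOne ^ N * G) a₁ b₁ 0 ∧
    KillsAt (tOne ^ N * G) a₂ b₂ 0 ∧ KillsAt (tOne ^ N * G) a₃ b₃ 0 := by
  obtain ⟨l₁, hl₁, h₁⟩ := h₁
  obtain ⟨l₂, hl₂, h₂⟩ := h₂
  obtain ⟨l₃, hl₃, h₃⟩ := h₃
  set l := l₁ ++ l₂ ++ l₃ with hl
  obtain ⟨N, l', hG, e⟩ := exists_linProd_eq (l ++ l.map (·⁻¹))
  have hinv := invert_linProd_dvd l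
  have hmem : ∀ α ∈ l, α ∈ Φ := by
    intro α hα
    simp only [hl, List.mem_append] at hα
    rcases hα with (h | h) | h
    exacts [hl₁ _ h, hl₂ _ h, hl₃ _ h]
  refine ⟨_, N, linProd l', ?_, e, hG, e ▸ hinv, ?_, ?_, ?_⟩
  · intro α hα
    rcases List.mem_append.1 hα with h | h
    · exact hmem α h
    · obtain ⟨β, hβ, rfl⟩ := List.mem_map.1 h
      exact Φ.inv_mem (hmem β hβ)
  · rw [← e, hl, linProd_append, linProd_append, linProd_append]
    exact h₁.of_dvd (((dvd_mul_right _ _).mul_right _).mul_right _)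
  · rw [← e, hl, linProd_append, linProd_append, linProd_append]
    exact h₂.of_dvd (((dvd_mul_left _ _).mul_right _).mul_right _)
  · rw [← e, hl, linProd_append, linProd_append, linProd_append]
    exact h₃.of_dvd ((dvd_mul_left _ _).mul_right _)

theorem LocalOn.borcherds (hab : LocalOn Φ a b) (hac : LocalOn Φ a c) (hbc : LocalOn Φ b c)
    (r p q : ℤ) : ∀ᶠ n : ℕ in atTop,
    ∑ i ∈ Finset.range n, ((Ring.choose p i : ℤ) : ℂ) • prodN (prodN a b (r + i)) c (q + p - i) =
      ∑ i ∈ Finset.range n, bin r i • prodN a (prodN b c (q + i)) (p + r - i) -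
        (-1 : ℂ) ^ r • ∑ i ∈ Finset.range n, bin r i • prodN b (prodN a c (p + i)) (q + r - i) := by
  obtain ⟨l, N, G, _, _, hG, hinv, h1, h2, h3⟩ := hab.common hac hbc
  exact _root_.borcherds hG hinv h1 h2 h3 r p q

/-- Dong's lemma: products of mutually local fields are local, with poles in the same group. -/
theorem LocalOn.prodN_left (hab : LocalOn Φ a b) (hac : LocalOn Φ a c) (hbc : LocalOn Φ b c)
    (n : ℤ) : LocalOn Φ (prodN a b n) c := by
  obtain ⟨l, N, G, hl, e, hG, hinv, h1, h2, h3⟩ := hab.common hac hbc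
  set M := N + n.natAbs with hM
  obtain ⟨g, hg, hgM⟩ := exists_multiplier hG M 1
  rw [pow_one] at hg
  rw [prodN_eq ⟨N, G, M, hG, h1, hg, hgM, by omega⟩]
  have hk := killsAt_kerField_left (m := n) h1 h2 h3 hg (L := M) (by omega) 0
  refine ⟨(List.replicate (1 + M) l).flatten, fun α hα => ?_, ?_⟩
  · obtain ⟨l', hl', hα⟩ := List.mem_flatten.1 hα
    rw [List.eq_of_mem_replicate hl'] at hα
    exact hl α hα
  · have : ∀ k : ℕ, linProd (List.replicate k l).flatten = linProd l ^ k := fun k => by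
      induction k with
      | zero => simp [linProd_nil]
      | succ k ih => rw [List.replicate_succ, List.flatten_cons, linProd_append, ih, pow_succ']
    rwa [this, e]

theorem LocalOn.prodN_right (hbc : LocalOn Φ b c) (hab : LocalOn Φ a b) (hac : LocalOn Φ a c)
    (n : ℤ) : LocalOn Φ a (prodN b c n) :=
  (hbc.prodN_left hab.symm hac.symm n).symm

theorem LocalOn.add_right {b' : VertexOperator ℂ W} (h : LocalOn Φ a b) (h' : LocalOn Φ a b') :
    LocalOn Φ a (b + b') := by
  obtain ⟨l, hl, h⟩ := h
  obtain ⟨l', hl', h'⟩ := h'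
  refine ⟨l ++ l', fun α hα => (List.mem_append.1 hα).elim (hl α) (hl' α), ?_⟩
  rw [linProd_append]
  exact (h.of_dvd (dvd_mul_right _ _)).add_right (h'.of_dvd (dvd_mul_left _ _))

theorem LocalOn.smul_right (h : LocalOn Φ a b) (z : ℂ) : LocalOn Φ a (z • b) := by
  obtain ⟨l, hl, h⟩ := h
  exact ⟨l, hl, h.smul_right z⟩

theorem localOn_idField_right (a : VertexOperator ℂ W) : LocalOn Φ a idField :=
  ⟨[], by simp, by rw [linProd_nil]; exact killsAt_id_right⟩

theorem LocalOn.zero_right (a : VertexOperator ℂ W) : LocalOn Φ a 0 := by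
  simpa using (localOn_idField_right (Φ := Φ) a).smul_right 0

end Locality

/-! ### The vacuum module as a universal object -/

section VacuumModule

theorem UniversalEnvelopingAlgebra.subalgebra_eq_top {L : Type*} [LieRing L] [LieAlgebra ℂ L]
    {S : Subalgebra ℂ (UniversalEnvelopingAlgebra ℂ L)}
    (h : ∀ x, UniversalEnvelopingAlgebra.ι ℂ x ∈ S) : S = ⊤ := by
  let f : L →ₗ⁅ℂ⁆ S :=
    { toFun := fun x => ⟨UniversalEnvelopingAlgebra.ι ℂ x, h x⟩
      map_add' := fun x y => Subtype.ext (map_add _ _ _)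
      map_smul' := fun c x => Subtype.ext (map_smul _ _ _)
      map_lie' := fun {x y} => Subtype.ext (LieHom.map_lie _ _ _) }
  have e : S.val.comp (UniversalEnvelopingAlgebra.lift ℂ f) = AlgHom.id ℂ _ := by
    refine UniversalEnvelopingAlgebra.hom_ext ℂ (LieHom.ext fun x => ?_)
    change S.val (UniversalEnvelopingAlgebra.lift ℂ f (UniversalEnvelopingAlgebra.ι ℂ x)) =
      UniversalEnvelopingAlgebra.ι ℂ x
    rw [UniversalEnvelopingAlgebra.lift_ι_apply]
    rfl
  refine eq_top_iff.2 fun u _ => ?_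
  have := congr($e u)
  rw [AlgHom.id_apply] at this
  rw [← this]
  exact Subtype.property _

variable {K : Type*} [LieRing K] [LieAlgebra ℂ K] (F : InvForm K) (ℓ : ℂ)

theorem Vacuum.central_smul (v : Vacuum F ℓ) :
    UniversalEnvelopingAlgebra.ι ℂ (Affine.central F) • v = ℓ • v := by
  obtain ⟨u, rfl⟩ := (vacuumIdeal F ℓ).mkQ_surjective v
  have hc : u ∈ Subalgebra.centralizer ℂ {UniversalEnvelopingAlgebra.ι ℂ (Affine.central F)} := by
    have hS := UniversalEnvelopingAlgebra.subalgebra_eq_top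
      (S := Subalgebra.centralizer ℂ {UniversalEnvelopingAlgebra.ι ℂ (Affine.central F)})
      (fun x => by
        rw [Subalgebra.mem_centralizer_iff]
        rintro _ rfl
        have := (UniversalEnvelopingAlgebra.ι ℂ).map_lie (Affine.central F) x
        rw [Affine.central_lie, map_zero, LieRing.of_associative_ring_bracket] at this
        exact sub_eq_zero.1 this.symm)
    rw [hS]; trivial
  rw [Subalgebra.mem_centralizer_iff] at hc
  have h1 := hc _ rfl
  refine (Submodule.Quotient.eq (vacuumIdeal F ℓ)).2 ?_
  have h2 : UniversalEnvelopingAlgebra.ι ℂ (Affine.central F) * u - ℓ • u =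
      u • (UniversalEnvelopingAlgebra.ι ℂ (Affine.central F) - algebraMap ℂ _ ℓ) := by
    rw [h1, smul_eq_mul, mul_sub, Algebra.smul_def, Algebra.commutes]
  change UniversalEnvelopingAlgebra.ι ℂ (Affine.central F) * u - ℓ • u ∈ vacuumIdeal F ℓ
  rw [h2]
  exact Submodule.smul_mem _ _ (Submodule.subset_span (Or.inr rfl))

variable {F ℓ}

/-- `V(ℓ, 0)` is spanned by the vectors obtained from `𝟏` by the operators `a(n)`. -/
theorem Vacuum.induction {p : Vacuum F ℓ → Prop} (hone : p (Vacuum.one F ℓ))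
    (hmode : ∀ n a v, p v → p (Vacuum.modeAct F ℓ n a v))
    (hadd : ∀ v w, p v → p w → p (v + w)) (hsmul : ∀ (c : ℂ) v, p v → p (c • v))
    (v : Vacuum F ℓ) : p v := by
  have hzero : p 0 := by simpa using hsmul 0 _ hone
  let S : Subalgebra ℂ (UniversalEnvelopingAlgebra ℂ (Affine F)) :=
    { carrier := {u | ∀ v, p v → p (u • v)}
      mul_mem' := fun {x y} hx hy v hv => by rw [mul_smul]; exact hx _ (hy _ hv)
      add_mem' := fun {x y} hx hy v hv => by rw [add_smul]; exact hadd _ _ (hx _ hv) (hy _ hv)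
      algebraMap_mem' := fun c v hv => by rw [algebraMap_smul]; exact hsmul _ _ hv }
  have hS : S = ⊤ := by
    refine UniversalEnvelopingAlgebra.subalgebra_eq_top fun x => ?_
    refine Affine.induction (p := fun x => ∀ v, p v → p (UniversalEnvelopingAlgebra.ι ℂ x • v))
      (fun n a v hv => hmode n a v hv) (fun v hv => ?_) (fun v hv => ?_)
      (fun x y hx hy v hv => ?_) (fun c x hx v hv => ?_) x
    · rw [Vacuum.central_smul]; exact hsmul _ _ hv
    · rw [map_zero, zero_smul]; exact hzero
    · rw [map_add, add_smul]; exact hadd _ _ (hx v hv) (hy v hv)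
    · rw [map_smul, smul_assoc]; exact hsmul _ _ (hx v hv)
  obtain ⟨u, rfl⟩ := (vacuumIdeal F ℓ).mkQ_surjective v
  have hu : u ∈ S := by rw [hS]; trivial
  have := hu _ hone
  have e : u • Vacuum.one F ℓ = (vacuumIdeal F ℓ).mkQ u := by
    refine (LinearMap.map_smul (vacuumIdeal F ℓ).mkQ u 1).symm.trans ?_
    rw [smul_eq_mul, mul_one]
  rwa [e] at this

variable (F ℓ)

/-- The action of `a(n)` on `V(ℓ, 0)`, linear in `a`. -/
noncomputable def Vacuum.modeLin (n : ℤ) : K →ₗ[ℂ] Module.End ℂ (Vacuum F ℓ) :=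
  LinearMap.mk₂ ℂ (Vacuum.modeAct F ℓ n)
    (fun a b v => by rw [Vacuum.modeAct, map_add, map_add, add_smul]; rfl)
    (fun c a v => by rw [Vacuum.modeAct, map_smul, map_smul, smul_assoc]; rfl)
    (fun a v w => smul_add _ _ _) (fun c a v => Vacuum.modeAct_smul F ℓ n a c v)

theorem Vacuum.modeLin_apply (n : ℤ) (a : K) (v : Vacuum F ℓ) :
    Vacuum.modeLin F ℓ n a v = Vacuum.modeAct F ℓ n a v := rfl

theorem Vacuum.modeAct_comm (m n : ℤ) (a b : K) (v : Vacuum F ℓ) :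
    Vacuum.modeAct F ℓ m a (Vacuum.modeAct F ℓ n b v) -
      Vacuum.modeAct F ℓ n b (Vacuum.modeAct F ℓ m a v) =
      Vacuum.modeAct F ℓ (m + n) ⁅a, b⁆ v +
        ((m : ℂ) * (if m + n = 0 then 1 else 0) * F.form a b * ℓ) • v := by
  have h := (UniversalEnvelopingAlgebra.ι ℂ).map_lie (Affine.mode F m a) (Affine.mode F n b)
  rw [Affine.lie_mode_mode, LieRing.of_associative_ring_bracket, map_add, map_smul] at h
  have h2 := congrArg (· • v) h
  simp only [add_smul, sub_smul, mul_smul, smul_assoc, Vacuum.central_smul] at h2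
  simp only [Vacuum.modeAct, mul_smul]
  exact h2.symm

theorem Vacuum.modeAct_one (n : ℤ) (hn : 0 ≤ n) (a : K) :
    Vacuum.modeAct F ℓ n a (Vacuum.one F ℓ) = 0 := by
  refine (LinearMap.map_smul (vacuumIdeal F ℓ).mkQ _ 1).symm.trans ?_
  rw [smul_eq_mul, mul_one]
  exact (Submodule.Quotient.mk_eq_zero _).2 (Submodule.subset_span (Or.inl ⟨n, a, hn, rfl⟩))

theorem Vacuum.modeAct_trunc (v : Vacuum F ℓ) :
    ∀ a, ∃ N : ℤ, ∀ n, N ≤ n → Vacuum.modeAct F ℓ n a v = 0 := by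
  refine Vacuum.induction (p := fun v => ∀ a, ∃ N : ℤ, ∀ n, N ≤ n → Vacuum.modeAct F ℓ n a v = 0)
    (fun a => ⟨0, fun n hn => Vacuum.modeAct_one F ℓ n hn a⟩) ?_ ?_ ?_ v
  · intro m b v hv a
    obtain ⟨N, hN⟩ := hv a
    obtain ⟨N', hN'⟩ := hv ⁅a, b⁆
    refine ⟨max N (max (N' - m) (1 - m)), fun n hn => ?_⟩
    have := Vacuum.modeAct_comm F ℓ n m a b v
    rw [hN n (by omega), hN' _ (by omega), if_neg (by omega)] at this
    simpa [Vacuum.modeAct] using this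
  · intro v w hv hw a
    obtain ⟨N, hN⟩ := hv a
    obtain ⟨N', hN'⟩ := hw a
    refine ⟨max N N', fun n hn => ?_⟩
    rw [← Vacuum.modeLin_apply, map_add, Vacuum.modeLin_apply, Vacuum.modeLin_apply,
      hN _ (by omega), hN' _ (by omega), add_zero]
  · intro c v hv a
    obtain ⟨N, hN⟩ := hv a
    exact ⟨N, fun n hn => by rw [Vacuum.modeAct_smul, hN n hn, smul_zero]⟩

/-- A linear map on the affine Lie algebra is given by its values on modes and on `𝐤`. -/
noncomputable def Affine.lift {M : Type*} [AddCommGroup M] [Module ℂ M] (D : ℤ → K →ₗ[ℂ] M) (m : M) :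
    Affine F →ₗ[ℂ] M :=
  LinearMap.coprod (TensorProduct.lift ((AddMonoidAlgebra.basis ℤ ℂ).constr ℂ D))
    (LinearMap.toSpanSingleton ℂ M m)

theorem Affine.lift_mode {M : Type*} [AddCommGroup M] [Module ℂ M] (D : ℤ → K →ₗ[ℂ] M) (m : M)
    (n : ℤ) (a : K) : Affine.lift F D m (Affine.mode F n a) = D n a := by
  change TensorProduct.lift ((AddMonoidAlgebra.basis ℤ ℂ).constr ℂ D)
    (AddMonoidAlgebra.single n 1 ⊗ₜ[ℂ] a) + LinearMap.toSpanSingleton ℂ M m 0 = D n a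
  rw [map_zero, add_zero, TensorProduct.lift.tmul, ← AddMonoidAlgebra.basis_apply,
    Module.Basis.constr_basis]

theorem Affine.lift_central {M : Type*} [AddCommGroup M] [Module ℂ M] (D : ℤ → K →ₗ[ℂ] M) (m : M) :
    Affine.lift F D m (Affine.central F) = m := by
  change TensorProduct.lift ((AddMonoidAlgebra.basis ℤ ℂ).constr ℂ D) 0 +
    LinearMap.toSpanSingleton ℂ M m 1 = m
  rw [map_zero, zero_add, LinearMap.toSpanSingleton_apply, one_smul]

/-- A module for the affine Lie algebra from operators satisfying the commutation relations. -/
theorem Affine.lift_lie {M : Type*} [AddCommGroup M] [Module ℂ M]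
    (D : ℤ → K →ₗ[ℂ] Module.End ℂ M)
    (hD : ∀ m n a b x, D m a (D n b x) - D n b (D m a x) = D (m + n) ⁅a, b⁆ x +
      ((m : ℂ) * (if m + n = 0 then 1 else 0) * F.form a b * ℓ) • x) (x y : Affine F) :
    Affine.lift F D (ℓ • 1) ⁅x, y⁆ =
      ⁅Affine.lift F D (ℓ • 1) x, Affine.lift F D (ℓ • 1) y⁆ := by
  set f := Affine.lift F D (ℓ • 1) with hf
  have hc : ∀ z : Module.End ℂ M, ⁅f (Affine.central F), z⁆ = 0 := fun z => by
    rw [hf, Affine.lift_central, LieRing.of_associative_ring_bracket, smul_mul_assoc,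
      mul_smul_comm, one_mul, mul_one, sub_self]
  refine Affine.induction (p := fun x => ∀ y, f ⁅x, y⁆ = ⁅f x, f y⁆) (fun m a y => ?_) (fun y => ?_)
    (fun y => by rw [zero_lie, map_zero, zero_lie])
    (fun x x' hx hx' y => ?_)
    (fun c x hx y => ?_) x y
  · refine Affine.induction (p := fun y => f ⁅Affine.mode F m a, y⁆ = ⁅f (Affine.mode F m a), f y⁆)
      (fun n b => ?_) ?_ (by rw [lie_zero, map_zero, lie_zero]) (fun y y' hy hy' => ?_)
      (fun c y hy => ?_) y
    · rw [Affine.lie_mode_mode, map_add, map_smul, hf, Affine.lift_mode, Affine.lift_mode,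
        Affine.lift_mode, Affine.lift_central, LieRing.of_associative_ring_bracket, smul_smul]
      ext x
      exact (hD m n a b x).symm
    · rw [Affine.lie_central, map_zero, ← lie_skew, hc, neg_zero]
    · rw [lie_add, map_add, map_add, lie_add, hy, hy']
    · rw [lie_smul, map_smul, map_smul, lie_smul, hy]
  · rw [Affine.central_lie, map_zero, hc]
  · rw [add_lie, map_add, map_add, add_lie, hx, hx']
  · rw [smul_lie, map_smul, map_smul, smul_lie, hx]

end VacuumModule

/-! ### Fields satisfying the relations of an affine Lie algebra -/

section AffineFields

variable {W : Type*} [AddCommGroup W] [Module ℂ W]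

theorem prodN_zero_left (c : VertexOperator ℂ W) (n : ℤ) : prodN 0 c n = 0 := by
  have h : KillsAt 1 (0 : VertexOperator ℂ W) c 0 := fun w => by
    rw [jac_zero_left, map_zero]
  refine (prodN_eq (admissible_one h n)).trans (ext_ncoeff fun j w => ?_)
  rw [kerField_ncoeff, jac_zero_left, map_zero, ncoeff_zero]; rfl

variable {a b c : VertexOperator ℂ W} {Φ : Subgroup ℂˣ}

theorem sum_choose_zero_smul {M : Type*} [AddCommGroup M] [Module ℂ M] (f : ℕ → M) {n : ℕ}
    (hn : 0 < n) : ∑ i ∈ Finset.range n, ((Ring.choose (0 : ℤ) i : ℤ) : ℂ) • f i = f 0 := by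
  obtain ⟨n, rfl⟩ := Nat.exists_eq_succ_of_ne_zero hn.ne'
  rw [Finset.sum_range_succ', Finset.sum_eq_zero]
  · simp
  · intro i _
    simp [Ring.choose_zero_succ]

theorem sum_bin_zero_smul {M : Type*} [AddCommGroup M] [Module ℂ M] (f : ℕ → M) {n : ℕ}
    (hn : 0 < n) : ∑ i ∈ Finset.range n, bin 0 i • f i = f 0 := by
  obtain ⟨n, rfl⟩ := Nat.exists_eq_succ_of_ne_zero hn.ne'
  rw [Finset.sum_range_succ', Finset.sum_eq_zero]
  · simp [bin_zero_right]
  · intro i _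
    simp [bin_zero_succ]

/-- The case `r = 0` of the Borcherds identity: the commutator formula for products. -/
theorem LocalOn.commutator (hab : LocalOn Φ a b) (hac : LocalOn Φ a c) (hbc : LocalOn Φ b c)
    (p q : ℤ) : ∀ᶠ n : ℕ in atTop, prodN a (prodN b c q) p - prodN b (prodN a c p) q =
      ∑ i ∈ Finset.range n, ((Ring.choose p i : ℤ) : ℂ) • prodN (prodN a b i) c (q + p - i) := by
  filter_upwards [hab.borcherds hac hbc 0 p q, eventually_gt_atTop 0] with n hn hn0
  simp only [zero_add] at hn
  rw [hn, sum_bin_zero_smul (fun i : ℕ => prodN a (prodN b c (q + i)) (p + 0 - i)) hn0,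
    sum_bin_zero_smul (fun i : ℕ => prodN b (prodN a c (p + i)) (q + 0 - i)) hn0]
  simp

/-- The case `p = 0` of the Borcherds identity: the iterate formula for products. -/
theorem LocalOn.iterate (hab : LocalOn Φ a b) (hac : LocalOn Φ a c) (hbc : LocalOn Φ b c)
    (r q : ℤ) : ∀ᶠ n : ℕ in atTop, prodN (prodN a b r) c q =
      ∑ i ∈ Finset.range n, bin r i • prodN a (prodN b c (q + i)) (r - i) -
        (-1 : ℂ) ^ r • ∑ i ∈ Finset.range n, bin r i • prodN b (prodN a c i) (q + r - i) := by
  filter_upwards [hab.borcherds hac hbc r 0 q, eventually_gt_atTop 0] with n hn hn0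
  rw [sum_choose_zero_smul (fun i : ℕ => prodN (prodN a b (r + i)) c (q + 0 - i)) hn0] at hn
  simpa using hn

variable {K : Type*} [LieRing K] [LieAlgebra ℂ K]

/-- A family of mutually quasi-local fields whose products are those of the generating fields of
the affine vertex algebra of level `ℓ`. -/
structure IsAffineFields (F : InvForm K) (ℓ : ℂ) (Φ : Subgroup ℂˣ)
    (A : K →ₗ[ℂ] VertexOperator ℂ W) : Prop where
  loc : ∀ a b, LocalOn Φ (A a) (A b)
  prod_zero : ∀ a b, prodN (A a) (A b) 0 = A ⁅a, b⁆
  prod_one : ∀ a b, prodN (A a) (A b) 1 = (ℓ * F.form a b) • idField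
  prod_of_two_le : ∀ a b n, 2 ≤ n → prodN (A a) (A b) n = 0

/-- The space of fields which are local with respect to all `A a`. -/
def localFields (Φ : Subgroup ℂˣ) (A : K →ₗ[ℂ] VertexOperator ℂ W) :
    Submodule ℂ (VertexOperator ℂ W) where
  carrier := {c | ∀ a, LocalOn Φ (A a) c}
  add_mem' h h' a := (h a).add_right (h' a)
  zero_mem' _ := LocalOn.zero_right _
  smul_mem' z _ h a := (h a).smul_right z

noncomputable instance (Φ : Subgroup ℂˣ) (A : K →ₗ[ℂ] VertexOperator ℂ W) :
    AddCommGroup (localFields Φ A) := Submodule.addCommGroup _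

namespace IsAffineFields

variable {F : InvForm K} {ℓ : ℂ} {A : K →ₗ[ℂ] VertexOperator ℂ W} (hA : IsAffineFields F ℓ Φ A)

/-- The operator `c ↦ (A a)ₙ c` on the fields which are local with respect to all `A a`. -/
noncomputable def modeMap (n : ℤ) : K →ₗ[ℂ] Module.End ℂ (localFields Φ A) :=
  LinearMap.mk₂ ℂ (fun a c => ⟨prodN (A a) c n, fun b =>
      (c.2 a).prodN_right (hA.loc b a) (c.2 b) n⟩)
    (fun a b c => Subtype.ext (by
      change prodN (A (a + b)) c n = prodN (A a) c n + prodN (A b) c n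
      rw [map_add, prodN_add_left (c.2 a).quasiLocal (c.2 b).quasiLocal]))
    (fun z a c => Subtype.ext (by
      change prodN (A (z • a)) c n = z • prodN (A a) c n
      rw [map_smul, prodN_smul_left (c.2 a).quasiLocal]))
    (fun a c d => Subtype.ext (by
      exact prodN_add_right (c.2 a).quasiLocal (d.2 a).quasiLocal n))
    (fun z a c => Subtype.ext (by exact prodN_smul_right (c.2 a).quasiLocal z n))

/-- By the commutator formula, the operators `c ↦ (A a)ₙ c` satisfy the relations of the affine Lie
algebra. -/
theorem modeMap_comm (m n : ℤ) (a b : K) (c : localFields Φ A) :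
    hA.modeMap m a (hA.modeMap n b c) - hA.modeMap n b (hA.modeMap m a c) =
      hA.modeMap (m + n) ⁅a, b⁆ c +
        ((m : ℂ) * (if m + n = 0 then 1 else 0) * F.form a b * ℓ) • c := by
  refine Subtype.ext ?_
  obtain ⟨N, hN⟩ := ((tendsto_add_atTop_nat 2).eventually
    ((hA.loc a b).commutator (c.2 a) (c.2 b) m n)).exists
  change prodN (A a) (prodN (A b) c n) m - prodN (A b) (prodN (A a) c m) n =
    prodN (A ⁅a, b⁆) c (m + n) + ((m : ℂ) * (if m + n = 0 then 1 else 0) * F.form a b * ℓ) •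
      (c : VertexOperator ℂ W)
  -- only the products with index `0` and `1` contribute to the commutator formula
  rw [hN, Finset.sum_range_succ', Finset.sum_range_succ', Finset.sum_eq_zero]
  · have hid : QuasiLocal idField (c : VertexOperator ℂ W) :=
      ⟨0, 1, isCoprime_one_right, by simpa using killsAt_id_left⟩
    have e0 : prodN (A a) (A b) ((0 : ℕ) : ℤ) = A ⁅a, b⁆ := hA.prod_zero a b
    have e1 : prodN (A a) (A b) ((0 + 1 : ℕ) : ℤ) = (ℓ * F.form a b) • idField := hA.prod_one a b
    rw [e0, e1, prodN_smul_left hid, prodN_idField, zero_add, Ring.choose_one_right,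
      Ring.choose_zero_right, Int.cast_one, one_smul, add_comm, smul_smul]
    congr 1
    · congr 1; push_cast; ring
    · by_cases h : m + n = 0
      · rw [if_pos h, if_pos (by push_cast; omega)]
        congr 1; ring
      · rw [if_neg h, if_neg (by push_cast; omega)]
        simp
  · intro i _
    rw [hA.prod_of_two_le a b _ (by push_cast; omega), prodN_zero_left, smul_zero]

/-- The fields which are local with respect to all `A a` form a module for the affine Lie algebra.
-/
noncomputable def fieldRep : Affine F →ₗ⁅ℂ⁆ Module.End ℂ (localFields Φ A) where
  toLinearMap := Affine.lift F hA.modeMap (ℓ • 1)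
  map_lie' {x y} := Affine.lift_lie F ℓ hA.modeMap (fun m n a b c => hA.modeMap_comm m n a b c) x y

theorem fieldRep_mode (n : ℤ) (a : K) : hA.fieldRep (Affine.mode F n a) = hA.modeMap n a :=
  Affine.lift_mode _ _ _ _ _

theorem fieldRep_central : hA.fieldRep (Affine.central F) = ℓ • 1 := Affine.lift_central _ _ _

/-- The identity field, as a field which is local with respect to all `A a`. -/
noncomputable def oneField (_hA : IsAffineFields F ℓ Φ A) : localFields Φ A :=
  ⟨idField, fun _ => localOn_idField_right _⟩

/-- The map `V(ℓ, 0) → {local fields}` with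
`a₁(n₁) ⋯ a_r(n_r) 𝟏 ↦ (A a₁)_{n₁} ⋯ (A a_r)_{n_r} id`. -/
noncomputable def fieldMapAux : Vacuum F ℓ →ₗ[ℂ] localFields Φ A :=
  Submodule.liftQ ((vacuumIdeal F ℓ).restrictScalars ℂ)
    (LinearMap.flip (UniversalEnvelopingAlgebra.lift ℂ hA.fieldRep).toLinearMap hA.oneField) (by
      intro u hu
      change UniversalEnvelopingAlgebra.lift ℂ hA.fieldRep u hA.oneField = 0
      change u ∈ vacuumIdeal F ℓ at hu
      induction hu using Submodule.span_induction with
      | mem x hx =>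
        rcases hx with ⟨n, a, hn, rfl⟩ | rfl
        · rw [UniversalEnvelopingAlgebra.lift_ι_apply, fieldRep_mode]
          refine Subtype.ext ?_
          change prodN (A a) idField n = 0
          rw [prodN_idField_right n (by omega), if_neg (by omega)]
        · rw [map_sub, UniversalEnvelopingAlgebra.lift_ι_apply, fieldRep_central, AlgHom.commutes,
            Algebra.algebraMap_eq_smul_one, sub_self]
          rfl
      | zero => rw [map_zero]; rfl
      | add x y _ _ hx hy => rw [map_add, LinearMap.add_apply, hx, hy, add_zero]
      | smul c x _ hx => rw [smul_eq_mul, map_mul, Module.End.mul_apply, hx, map_zero])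

theorem fieldMapAux_one : hA.fieldMapAux (Vacuum.one F ℓ) = hA.oneField := by
  change UniversalEnvelopingAlgebra.lift ℂ hA.fieldRep 1 hA.oneField = _
  rw [map_one]; rfl

theorem fieldMapAux_modeAct (n : ℤ) (a : K) (v : Vacuum F ℓ) :
    hA.fieldMapAux (Vacuum.modeAct F ℓ n a v) = hA.modeMap n a (hA.fieldMapAux v) := by
  obtain ⟨u, rfl⟩ := (vacuumIdeal F ℓ).mkQ_surjective v
  change UniversalEnvelopingAlgebra.lift ℂ hA.fieldRep
    (UniversalEnvelopingAlgebra.ι ℂ (Affine.mode F n a) * u) hA.oneField =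
    hA.modeMap n a (UniversalEnvelopingAlgebra.lift ℂ hA.fieldRep u hA.oneField)
  rw [map_mul, Module.End.mul_apply, UniversalEnvelopingAlgebra.lift_ι_apply, fieldRep_mode]

/-- The field of a vector of `V(ℓ, 0)`. -/
noncomputable def fieldMap : Vacuum F ℓ →ₗ[ℂ] VertexOperator ℂ W :=
  (localFields Φ A).subtype ∘ₗ hA.fieldMapAux

theorem fieldMap_one : hA.fieldMap (Vacuum.one F ℓ) = idField := by
  rw [fieldMap, LinearMap.comp_apply, fieldMapAux_one]; rfl

theorem fieldMap_modeAct (n : ℤ) (a : K) (v : Vacuum F ℓ) :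
    hA.fieldMap (Vacuum.modeAct F ℓ n a v) = prodN (A a) (hA.fieldMap v) n := by
  rw [fieldMap, LinearMap.comp_apply, fieldMapAux_modeAct]; rfl

theorem fieldMap_state (a : K) : hA.fieldMap (Vacuum.state F ℓ a) = A a := by
  rw [Vacuum.state, fieldMap_modeAct, fieldMap_one, prodN_idField_right _ le_rfl, if_pos rfl]

theorem localOn_fieldMap (a : K) (v : Vacuum F ℓ) : LocalOn Φ (A a) (hA.fieldMap v) :=
  (hA.fieldMapAux v).2 a

/-- The fields of all vectors of `V(ℓ, 0)` are mutually local, by Dong's lemma. -/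
theorem fieldMap_localOn (u v : Vacuum F ℓ) : LocalOn Φ (hA.fieldMap u) (hA.fieldMap v) := by
  refine Vacuum.induction (p := fun u => LocalOn Φ (hA.fieldMap u) (hA.fieldMap v)) ?_ ?_ ?_ ?_ u
  · rw [fieldMap_one]; exact (localOn_idField_right _).symm
  · intro n a u hu
    rw [fieldMap_modeAct]
    exact (hA.localOn_fieldMap a u).prodN_left (hA.localOn_fieldMap a v) hu n
  · intro u u' hu hu'
    rw [map_add]
    exact (hu.symm.add_right hu'.symm).symm
  · intro z u hu
    rw [map_smul]
    exact (hu.symm.smul_right z).symm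

end IsAffineFields

/-- Products of two fields whose commutator, localized at the diagonal, is that of an affine Lie
algebra: `d(x₂)` times the delta function plus `κ` times its derivative. -/
theorem affine_products {e G : ℂ[T;T⁻¹]} {d : VertexOperator ℂ W} {κ : ℂ} (hG : IsCoprime tOne G)
    (hk : KillsAt (tOne ^ 2 * G) a b 0) (he : G ∣ e) (heM : tOne ^ 2 ∣ e - 1)
    (hD : ∀ w m n, mulT e (jac a b w 0) (m, n) =
      (d[[m + n]]) w + ((m : ℂ) * (if m + n = 0 then 1 else 0) * κ) • w) :
    prodN a b 0 = d ∧ prodN a b 1 = κ • idField ∧ ∀ n, 2 ≤ n → prodN a b n = 0 := by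
  have hadm : ∀ n : ℤ, 0 ≤ n → prodN a b n = kerField e a b 0 n := fun n hn =>
    prodN_eq ⟨2, G, 2, hG, hk, he, heM, by push_cast; omega⟩
  refine ⟨?_, ?_, fun n hn => prodN_eq_zero hG hk (by push_cast; omega)⟩
  · rw [hadm 0 le_rfl]
    refine ext_ncoeff fun j w => ?_
    rw [kerField_ncoeff, hD]
    simp
  · rw [hadm 1 zero_le_one]
    refine ext_ncoeff fun j w => ?_
    have h1 : mulT e (jac a b w (0 + 1)) (0, j) =
        mulT e (jac a b w 0) (1, j) - mulT e (jac a b w 0) (0, j + 1) := by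
      simp only [mulT_apply, jac_succ, smul_sub, Finsupp.sum_sub]
      simp only [sub_add_eq_add_sub, add_comm (1 : ℤ), zero_add]
    rw [kerField_ncoeff, ncoeff_smul, idField_ncoeff, ← zero_add (1 : ℤ), h1, hD, hD]
    by_cases h : j = -1
    · simp [h]
    · have h2 : ¬ j + 1 = 0 := by omega
      simp [h, h2, add_comm]

end AffineFields

/-! ### Series with poles on a line `x₁ = α x₂` -/

section LinePoles

open LaurentPolynomial

variable {W : Type*} [AddCommGroup W] [Module ℂ W]

/-- The coefficients `α ^ m (f (m + n) + m g (m + n))` of a combination of `δ(α x₂ / x₁)` and its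
derivative, with coefficients depending on `x₂`. -/
def lineSeries (α : ℂˣ) (f g : ℤ → W) (p : ℤ × ℤ) : W :=
  ((α ^ p.1 : ℂˣ) : ℂ) • (f (p.1 + p.2) + (p.1 : ℂ) • g (p.1 + p.2))

theorem mulT_T_sub_C (α : ℂ) (F : ℤ × ℤ → W) (i j : ℤ) :
    mulT (T 1 - C α) F (i, j) = F (i + 1, j - 1) - α • F (i, j) := by
  rw [mulT_sub, Pi.sub_apply, LaurentPolynomial.T, mulT_single, one_smul]
  congr 1
  change mulT (AddMonoidAlgebra.single 0 α) F (i, j) = _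
  rw [mulT_single, add_zero, sub_zero]

theorem mulT_sq_lineSeries (α : ℂˣ) (f g : ℤ → W) :
    mulT ((T 1 - C (α : ℂ)) ^ 2) (lineSeries α f g) = 0 := by
  rw [pow_two, mulT_mul]
  ext ⟨i, j⟩
  simp only [mulT_T_sub_C, lineSeries]
  have h1 : i + 1 + 1 + (j - 1 - 1) = i + j := by ring
  have h2 : i + 1 + (j - 1) = i + j := by ring
  rw [h1, h2, zpow_add_one, zpow_add_one]
  push_cast
  rw [Pi.zero_apply]
  module

theorem mulT_lineSeries_of_dvd {α : ℂˣ} {e : ℂ[T;T⁻¹]} (h : (T 1 - C (α : ℂ)) ^ 2 ∣ e)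
    (f g : ℤ → W) : mulT e (lineSeries α f g) = 0 := by
  obtain ⟨u, rfl⟩ := h
  rw [mul_comm, mulT_mul, mulT_sq_lineSeries, map_zero]

theorem mulT_lineSeries_of_dvd_sub_one {α : ℂˣ} {e : ℂ[T;T⁻¹]}
    (h : (T 1 - C (α : ℂ)) ^ 2 ∣ e - 1) (f g : ℤ → W) :
    mulT e (lineSeries α f g) = lineSeries α f g := by
  have := mulT_lineSeries_of_dvd h f g
  rwa [mulT_sub, mulT_one, sub_eq_zero] at this

end LinePoles

/-! ### The vertex algebra structure on the vacuum module -/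

section VertexAlgebraStructure

variable {W : Type*} [AddCommGroup W] [Module ℂ W] {a b : VertexOperator ℂ W}

theorem jac_eventually (a b : VertexOperator ℂ W) (w : W) (r p q : ℤ) : ∀ᶠ n : ℕ in atTop,
    jac a b w r (p, q) =
      ∑ i ∈ Finset.range n, bin r i • (a[[p + r - i]]) ((b[[q + i]]) w) -
        (-1 : ℂ) ^ r • ∑ i ∈ Finset.range n, bin r i • (b[[q + r - i]]) ((a[[p + i]]) w) := by
  have key : ∀ (a b : VertexOperator ℂ W) (p q : ℤ), ∀ᶠ n : ℕ in atTop, jacobiFirst a b w r p q =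
      ∑ i ∈ Finset.range n, bin r i • (a[[p + r - i]]) ((b[[q + i]]) w) := fun a b p q => by
    refine eventually_finsum_eq_sum ?_
    obtain ⟨N, hN⟩ := b.exists_trunc w
    exact ⟨(N - q).toNat, fun n hn => by rw [hN _ (by omega), map_zero, smul_zero]⟩
  filter_upwards [key a b p q, key b a q p] with n h1 h2
  rw [jac, jacobiSecond_eq]
  dsimp only
  rw [h1, h2]

theorem jacobiThird_eventually {V : Type*} [AddCommGroup V] [Module ℂ V]
    (Y : V →ₗ[ℂ] VertexOperator ℂ V) (YW : V →ₗ[ℂ] VertexOperator ℂ W) (u v : V) (w : W)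
    (r p q : ℤ) : ∀ᶠ n : ℕ in atTop, jacobiThird Y YW u v w r p q =
      ∑ i ∈ Finset.range n, ((Ring.choose p i : ℤ) : ℂ) •
        ((YW (((Y u)[[r + i]]) v))[[p + q - i]]) w := by
  refine eventually_finsum_eq_sum ?_
  obtain ⟨N, hN⟩ := (Y u).exists_trunc v
  exact ⟨(N - r).toNat, fun n hn => by
    rw [hN _ (by omega), map_zero, ncoeff_zero, smul_zero]⟩

theorem jacobiThird_zero {V : Type*} [AddCommGroup V] [Module ℂ V]
    (Y : V →ₗ[ℂ] VertexOperator ℂ V) (YW : V →ₗ[ℂ] VertexOperator ℂ W) (u v : V) (w : W)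
    (r q : ℤ) : jacobiThird Y YW u v w r 0 q = ((YW (((Y u)[[r]]) v))[[q]]) w := by
  obtain ⟨n, h, hn⟩ := ((jacobiThird_eventually Y YW u v w r 0 q).and
    (eventually_gt_atTop 0)).exists
  rw [h, sum_choose_zero_smul (fun i : ℕ => ((YW (((Y u)[[r + i]]) v))[[0 + q - i]]) w) hn]
  simp

/-- Operators intertwining two pairs of fields intertwine their kernels. -/
theorem map_jac {W' : Type*} [AddCommGroup W'] [Module ℂ W'] (σ : W →ₗ[ℂ] W')
    {a' b' : VertexOperator ℂ W'} (ha : ∀ n w, σ ((a[[n]]) w) = (a'[[n]]) (σ w))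
    (hb : ∀ n w, σ ((b[[n]]) w) = (b'[[n]]) (σ w)) (w : W) (r : ℤ) (n : ℤ × ℤ) :
    σ (jac a b w r n) = jac a' b' (σ w) r n := by
  obtain ⟨p, q⟩ := n
  obtain ⟨N, h1, h2⟩ := ((jac_eventually a b w r p q).and
    (jac_eventually a' b' (σ w) r p q)).exists
  rw [h1, h2]
  simp only [map_sub, map_smul, map_sum, ha, hb]

/-- For fields with poles only on the diagonal no multiplier is needed. -/
theorem LocalOn.prodN_bot (h : LocalOn ⊥ a b) :
    ∃ N : ℕ, KillsAt 1 a b N ∧ ∀ n, prodN a b n = kerField 1 a b 0 n := by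
  obtain ⟨l, hl, h⟩ := h
  have e : linProd l = tOne ^ l.length := by
    rw [List.eq_replicate_of_mem fun α hα => Subgroup.mem_bot.1 (hl α hα), linProd,
      List.map_replicate, List.prod_replicate, Units.val_one, ← tOne_eq, List.length_replicate]
  rw [e] at h
  have h' : KillsAt (tOne ^ l.length * 1) a b 0 := by rwa [mul_one]
  refine ⟨l.length, ?_, fun n => ?_⟩
  · simpa using killsAt_tOne_pow_mul.1 h'
  · exact prodN_eq ⟨l.length, 1, l.length + n.natAbs, isCoprime_one_right, h', dvd_rfl, by simp,
      by omega⟩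

variable {K : Type*} [LieRing K] [LieAlgebra ℂ K] (F : InvForm K) (ℓ : ℂ)

theorem Vacuum.modeLin_trunc (v : Vacuum F ℓ) (a : K) :
    ∃ N : ℤ, ∀ n, N ≤ n → Vacuum.modeLin F ℓ n a v = 0 := Vacuum.modeAct_trunc F ℓ v a

/-- The field `a(x) = ∑ a(n) x ^ (-n-1)` on `V(ℓ, 0)`. -/
noncomputable def Vacuum.genField : K →ₗ[ℂ] VertexOperator ℂ (Vacuum F ℓ) where
  toFun a := ofModes (fun n => Vacuum.modeLin F ℓ n a) fun v => Vacuum.modeLin_trunc F ℓ v a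
  map_add' a b := ext_ncoeff fun n w => by
    rw [ncoeff_add, ofModes_ncoeff, ofModes_ncoeff, ofModes_ncoeff, map_add]; rfl
  map_smul' c a := ext_ncoeff fun n w => by
    rw [RingHom.id_apply, ncoeff_smul, ofModes_ncoeff, ofModes_ncoeff, map_smul]; rfl

theorem Vacuum.genField_ncoeff (a : K) (n : ℤ) (v : Vacuum F ℓ) :
    ((Vacuum.genField F ℓ a)[[n]]) v = Vacuum.modeAct F ℓ n a v := by
  change ((ofModes (fun n => Vacuum.modeLin F ℓ n a) fun v => modeLin_trunc F ℓ v a)[[n]]) v = _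
  rw [ofModes_ncoeff, Vacuum.modeLin_apply]

theorem Vacuum.jac_genField (a b : K) (v : Vacuum F ℓ) (m n : ℤ) :
    jac (genField F ℓ a) (genField F ℓ b) v 0 (m, n) = ((genField F ℓ ⁅a, b⁆)[[m + n]]) v +
      ((m : ℂ) * (if m + n = 0 then 1 else 0) * (ℓ * F.form a b)) • v := by
  rw [jac_zero]
  simp only [genField_ncoeff]
  rw [modeAct_comm]
  congr 2
  ring

theorem Vacuum.killsAt_genField (a b : K) :
    KillsAt (tOne ^ 2) (genField F ℓ a) (genField F ℓ b) 0 := fun v => by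
  have e : jac (genField F ℓ a) (genField F ℓ b) v 0 = lineSeries 1
      (fun n => ((genField F ℓ ⁅a, b⁆)[[n]]) v)
      (fun n => ((if n = 0 then 1 else 0) * (ℓ * F.form a b)) • v) := by
    ext ⟨m, n⟩
    rw [jac_genField, lineSeries, one_zpow, Units.val_one, one_smul, smul_smul, mul_assoc]
  rw [e, tOne_eq]
  exact mulT_sq_lineSeries 1 _ _

theorem Vacuum.isAffineFields : IsAffineFields F ℓ ⊥ (Vacuum.genField F ℓ) := by
  have h := fun a b => affine_products (e := 1) (G := 1) (d := genField F ℓ ⁅a, b⁆)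
    (κ := ℓ * F.form a b) isCoprime_one_right
    (by rw [mul_one]; exact killsAt_genField F ℓ a b) dvd_rfl (by simp)
    fun v m n => by rw [mulT_one, jac_genField]
  refine ⟨fun a b => ⟨[1, 1], by simp, ?_⟩, fun a b => (h a b).1, fun a b => (h a b).2.1,
    fun a b => (h a b).2.2⟩
  rw [linProd_cons, linProd_cons, linProd_nil, mul_one, ← pow_two, Units.val_one, ← tOne_eq]
  exact killsAt_genField F ℓ a b

/-- The state-field correspondence of `V(ℓ, 0)`. -/
noncomputable def Vacuum.stateField : Vacuum F ℓ →ₗ[ℂ] VertexOperator ℂ (Vacuum F ℓ) :=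
  (Vacuum.isAffineFields F ℓ).fieldMap

variable {F ℓ}

theorem Vacuum.stateField_local (u v : Vacuum F ℓ) :
    ∃ N : ℕ, KillsAt 1 (stateField F ℓ u) (stateField F ℓ v) N ∧
      ∀ n, prodN (stateField F ℓ u) (stateField F ℓ v) n =
        kerField 1 (stateField F ℓ u) (stateField F ℓ v) 0 n :=
  ((Vacuum.isAffineFields F ℓ).fieldMap_localOn u v).prodN_bot

theorem Vacuum.stateField_one : stateField F ℓ (one F ℓ) = idField :=
  (Vacuum.isAffineFields F ℓ).fieldMap_one

theorem Vacuum.stateField_state (a : K) : stateField F ℓ (state F ℓ a) = genField F ℓ a :=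
  (Vacuum.isAffineFields F ℓ).fieldMap_state a

/-- The iterate formula for the fields of `V(ℓ, 0)`. -/
theorem Vacuum.stateField_modeAct (m n : ℤ) (a : K) (u v : Vacuum F ℓ) :
    ((stateField F ℓ (modeAct F ℓ m a u))[[n]]) v =
      jac (genField F ℓ a) (stateField F ℓ u) v m (0, n) := by
  rw [stateField, (Vacuum.isAffineFields F ℓ).fieldMap_modeAct,
    (((Vacuum.isAffineFields F ℓ).localOn_fieldMap a u).prodN_bot).choose_spec.2, kerField_ncoeff,
    mulT_one]

/-- The map from `V(ℓ, 0)` to fields carries the vertex operators to the products of fields; the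
induction step is the iterate formula on both sides. -/
theorem IsAffineFields.fieldMap_prodN {Φ : Subgroup ℂˣ} {A : K →ₗ[ℂ] VertexOperator ℂ W}
    (hA : IsAffineFields F ℓ Φ A) (u v : Vacuum F ℓ) (n : ℤ) :
    hA.fieldMap (((Vacuum.stateField F ℓ u)[[n]]) v) =
      prodN (hA.fieldMap u) (hA.fieldMap v) n := by
  refine Vacuum.induction (p := fun u => ∀ v n, hA.fieldMap (((Vacuum.stateField F ℓ u)[[n]]) v) =
      prodN (hA.fieldMap u) (hA.fieldMap v) n) ?_ ?_ ?_ ?_ u v n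
  · intro v n
    rw [Vacuum.stateField_one, hA.fieldMap_one, prodN_idField, idField_ncoeff]
    split_ifs
    · rfl
    · exact map_zero _
  · intro m a u hu v n
    rw [Vacuum.stateField_modeAct, hA.fieldMap_modeAct]
    obtain ⟨N, h1, h2⟩ := ((jac_eventually (Vacuum.genField F ℓ a) (Vacuum.stateField F ℓ u) v m 0
      n).and ((hA.localOn_fieldMap a u).iterate (hA.localOn_fieldMap a v)
        (hA.fieldMap_localOn u v) m n)).exists
    rw [h1, h2]
    simp only [map_sub, map_smul, map_sum, Vacuum.genField_ncoeff, hA.fieldMap_modeAct, hu,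
      zero_add]
  · intro u u' hu hu' v n
    rw [map_add, ncoeff_add, map_add, map_add, hu, hu', prodN_add_left
      (hA.fieldMap_localOn u v).quasiLocal (hA.fieldMap_localOn u' v).quasiLocal]
  · intro c u hu v n
    rw [map_smul, ncoeff_smul, map_smul, map_smul, hu, prodN_smul_left
      (hA.fieldMap_localOn u v).quasiLocal]

theorem Vacuum.stateField_creation (v : Vacuum F ℓ) :
    (∀ n : ℤ, 0 ≤ n → ((stateField F ℓ v)[[n]]) (one F ℓ) = 0) ∧
      ((stateField F ℓ v)[[-1]]) (one F ℓ) = v := by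
  refine Vacuum.induction (p := fun v =>
    (∀ n : ℤ, 0 ≤ n → ((stateField F ℓ v)[[n]]) (one F ℓ) = 0) ∧
      ((stateField F ℓ v)[[-1]]) (one F ℓ) = v) ?_ ?_ ?_ ?_ v
  · rw [stateField_one]
    exact ⟨fun n hn => by rw [idField_ncoeff, if_neg (by omega)], by rw [idField_ncoeff, if_pos rfl]⟩
  · rintro m a u ⟨h0, h1⟩
    have key : ∀ n, ∃ N > 0, ((stateField F ℓ (modeAct F ℓ m a u))[[n]]) (one F ℓ) =
        ∑ i ∈ Finset.range N, bin m i •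
          modeAct F ℓ (m - i) a (((stateField F ℓ u)[[n + i]]) (one F ℓ)) := fun n => by
      obtain ⟨N, h, hN⟩ := ((jac_eventually (genField F ℓ a) (stateField F ℓ u) (one F ℓ) m 0
        n).and (eventually_gt_atTop 0)).exists
      refine ⟨N, hN, ?_⟩
      rw [stateField_modeAct, h, sub_eq_self.2]
      · simp only [genField_ncoeff, zero_add]
      · rw [Finset.sum_eq_zero, smul_zero]
        intro i _
        rw [genField_ncoeff, modeAct_one _ _ _ (by omega), map_zero, smul_zero]
    have hz : ∀ n, modeAct F ℓ n a 0 = 0 := fun n => map_zero (modeLin F ℓ n a)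
    refine ⟨fun n hn => ?_, ?_⟩
    · obtain ⟨N, _, h⟩ := key n
      rw [h, Finset.sum_eq_zero]
      intro i _
      rw [h0 _ (by omega), hz, smul_zero]
    · obtain ⟨N, hN, h⟩ := key (-1)
      obtain ⟨N, rfl⟩ := Nat.exists_eq_succ_of_ne_zero hN.ne'
      rw [h, Finset.sum_range_succ', Finset.sum_eq_zero]
      · simp [bin_zero_right, h1]
      · intro i _
        rw [h0 _ (by push_cast; omega), hz, smul_zero]
  · rintro u v ⟨h0, h1⟩ ⟨h0', h1'⟩
    rw [map_add]
    exact ⟨fun n hn => by rw [ncoeff_add, h0 n hn, h0' n hn, add_zero], by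
      rw [ncoeff_add, h1, h1']⟩
  · rintro c u ⟨h0, h1⟩
    rw [map_smul]
    exact ⟨fun n hn => by rw [ncoeff_smul, h0 n hn, smul_zero], by rw [ncoeff_smul, h1]⟩

variable (F ℓ)

/-- The affine vertex algebra `V(ℓ, 0)`. -/
noncomputable def Vacuum.vertexAlgebra : VertexAlgebra (Vacuum F ℓ) where
  vac := Vacuum.one F ℓ
  Y := Vacuum.stateField F ℓ
  Y_vac n v := by rw [Vacuum.stateField_one, idField_ncoeff]
  creation := Vacuum.stateField_creation
  jacobi u v w r p q := by
    obtain ⟨N, hN, hprod⟩ := Vacuum.stateField_local u v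
    obtain ⟨n, h, hn⟩ := ((jacobiThird_eventually (Vacuum.stateField F ℓ) (Vacuum.stateField F ℓ)
      u v w r p q).and (eventually_ge_atTop (N + r.natAbs))).exists
    have h1 := congrArg (fun c : VertexOperator ℂ (Vacuum F ℓ) => (ncoeff c q) w)
      (kerField_taylor hN p r (n := n) (by omega))
    simp only [ncoeff_sum, ncoeff_smul, shift_ncoeff, kerField_ncoeff, mulT_one] at h1
    rw [h]
    refine h1.trans (Finset.sum_congr rfl fun i _ => ?_)
    have h2 := (Vacuum.isAffineFields F ℓ).fieldMap_prodN u v (r + i)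
    change Vacuum.stateField F ℓ _ = prodN (Vacuum.stateField F ℓ u) (Vacuum.stateField F ℓ v) _
      at h2
    rw [h2, hprod, kerField_ncoeff, mulT_one]
    congr 3
    ring

theorem Vacuum.isAffineVertexAlgebra : IsAffineVertexAlgebra F ℓ (Vacuum.vertexAlgebra F ℓ) where
  vac_eq := rfl
  Y_state a n v := by
    change ((stateField F ℓ (state F ℓ a))[[n]]) v = _
    rw [stateField_state, genField_ncoeff]

variable {F ℓ}

/-- The case `p = 0` of the Jacobi identity determines the field of `a(m) u` from those of `a` and
`u`. -/
theorem IsAffineVertexAlgebra.Y_eq {𝒱 : VertexAlgebra (Vacuum F ℓ)}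
    (h : IsAffineVertexAlgebra F ℓ 𝒱) : 𝒱.Y = Vacuum.stateField F ℓ := by
  have hs : ∀ a, 𝒱.Y (Vacuum.state F ℓ a) = Vacuum.genField F ℓ a := fun a =>
    ext_ncoeff fun n w => by rw [h.Y_state, Vacuum.genField_ncoeff]
  refine LinearMap.ext fun u => ?_
  refine Vacuum.induction (p := fun u => 𝒱.Y u = Vacuum.stateField F ℓ u) ?_ ?_ ?_ ?_ u
  · rw [← h.vac_eq]
    refine ext_ncoeff fun n w => ?_
    rw [𝒱.Y_vac, h.vac_eq, Vacuum.stateField_one, idField_ncoeff]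
  · intro m a u hu
    refine ext_ncoeff fun n w => ?_
    rw [Vacuum.stateField_modeAct, ← h.Y_state, ← jacobiThird_zero 𝒱.Y 𝒱.Y, ← 𝒱.jacobi, hs, hu]
    rfl
  · intro u v hu hv
    rw [map_add, map_add, hu, hv]
  · intro c u hu
    rw [map_smul, map_smul, hu]

theorem IsAffineVertexAlgebra.eq {𝒱 : VertexAlgebra (Vacuum F ℓ)}
    (h : IsAffineVertexAlgebra F ℓ 𝒱) : 𝒱 = Vacuum.vertexAlgebra F ℓ :=
  VertexAlgebra.ext h.vac_eq h.Y_eq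

end VertexAlgebraStructure

/-! ### The group action on the affine vertex algebra -/

section GroupAction

variable {G K : Type*} [Group G] [LieRing K] [LieAlgebra ℂ K] {F : InvForm K} (A : FormAct G F)
  (φ : G →* ℂˣ) (ℓ : ℂ)

theorem FormAct.vacuumAct_one (g : G) :
    A.vacuumAct φ ℓ g (Vacuum.one _ ℓ) = Vacuum.one _ ℓ := by
  refine (congrArg (Vacuum.powL0 _ ℓ (φ g)⁻¹) (Vacuum.twist_one _ ℓ _ _ _ _)).trans ?_
  exact Vacuum.twist_one _ ℓ _ _ _ _

/-- Compatibility of `R_g` with the vertex operators, `R_g Y(v, x) w = Y(R_g v, φ(g)⁻¹ x) R_g w`. It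
holds for generators, and is inherited by products of fields. -/
theorem FormAct.vacuumAct_stateField (g : G) (v w : Vacuum (A.kerForm φ) ℓ) (n : ℤ) :
    A.vacuumAct φ ℓ g (((Vacuum.stateField _ ℓ v)[[n]]) w) =
      ((dilate (φ g)⁻¹ (Vacuum.stateField _ ℓ (A.vacuumAct φ ℓ g v)))[[n]])
        (A.vacuumAct φ ℓ g w) := by
  refine Vacuum.induction (p := fun v => ∀ w n, A.vacuumAct φ ℓ g (((Vacuum.stateField _ ℓ v)[[n]]) w) =
      ((dilate (φ g)⁻¹ (Vacuum.stateField _ ℓ (A.vacuumAct φ ℓ g v)))[[n]])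
        (A.vacuumAct φ ℓ g w)) ?_ ?_ ?_ ?_ v w n
  · intro w n
    rw [A.vacuumAct_one, Vacuum.stateField_one, dilate_ncoeff, LinearMap.smul_apply,
      idField_ncoeff, idField_ncoeff]
    by_cases h : n = -1
    · simp [h]
    · simp [h]
  · intro m a u hu w n
    have ha : ∀ k w, A.vacuumAct φ ℓ g (((Vacuum.genField _ ℓ a)[[k]]) w) =
        ((dilate (φ g)⁻¹ ((φ g : ℂ)⁻¹ • Vacuum.genField _ ℓ (A.kerAct φ g a)))[[k]])
          (A.vacuumAct φ ℓ g w) := fun k w => by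
      rw [Vacuum.genField_ncoeff, A.vacuumAct_modeAct, dilate_ncoeff, LinearMap.smul_apply,
        ncoeff_smul, Vacuum.genField_ncoeff, smul_smul]
      congr 1
      rw [← Units.val_inv_eq_inv_val, ← Units.val_mul]
      congr 1
      rw [inv_zpow', ← zpow_neg_one, ← zpow_add]
      congr 1; ring
    rw [Vacuum.stateField_modeAct, map_jac _ ha fun k w => hu w k, jac_dilate,
      A.vacuumAct_modeAct, map_smul,
      dilate_ncoeff, LinearMap.smul_apply, ncoeff_smul, Vacuum.stateField_modeAct, smul_smul]
    rw [← jacLin_apply, map_smul, LinearMap.smul_apply, LinearMap.smul_apply, Pi.smul_apply,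
      jacLin_apply,
      smul_smul]
    congr 1
    rw [← Units.val_inv_eq_inv_val, ← Units.val_mul, ← Units.val_mul]
    congr 1
    rw [inv_zpow', inv_zpow', ← zpow_neg_one, ← zpow_add, ← zpow_add]
    congr 1; ring
  · intro u v hu hv w n
    simp only [dilate_ncoeff, LinearMap.smul_apply] at hu hv ⊢
    rw [map_add (Vacuum.stateField _ ℓ), ncoeff_add, map_add, hu, hv, map_add (A.vacuumAct φ ℓ g),
      map_add (Vacuum.stateField _ ℓ), ncoeff_add, smul_add]
  · intro c u hu w n
    simp only [dilate_ncoeff, LinearMap.smul_apply] at hu ⊢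
    rw [map_smul (Vacuum.stateField _ ℓ), ncoeff_smul, map_smul, hu, map_smul (A.vacuumAct φ ℓ g),
      map_smul (Vacuum.stateField _ ℓ), ncoeff_smul, smul_comm]

theorem FormAct.isGroupVertexAlgebra {𝒱 : VertexAlgebra (Vacuum (A.kerForm φ) ℓ)}
    (h : IsAffineVertexAlgebra (A.kerForm φ) ℓ 𝒱) :
    𝒱.IsGroupVertexAlgebra (A.vacuumAct φ ℓ) φ where
  map_vac g := by rw [h.vac_eq, A.vacuumAct_one]
  conj g v n := by
    ext w
    rw [h.Y_eq, Module.End.mul_apply, Module.End.mul_apply, A.vacuumAct_stateField, dilate_ncoeff,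
      ← Module.End.mul_apply (A.vacuumAct φ ℓ g), ← map_mul, mul_inv_cancel, map_one]
    rfl

end GroupAction

/-! ### Polynomials in `x₁, x₂` acting on formal series -/

section PolynomialAction

variable {W : Type*} [AddCommGroup W] [Module ℂ W]

/-- The inclusion of `ℂ[x₁, x₂]` in the group algebra of `ℤ × ℤ`. -/
noncomputable def polyIncl : MvPolynomial (Fin 2) ℂ →ₐ[ℂ] AddMonoidAlgebra ℂ (ℤ × ℤ) :=
  MvPolynomial.aeval ![AddMonoidAlgebra.single (1, 0) 1, AddMonoidAlgebra.single (0, 1) 1]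

theorem polyIncl_monomial (s : Fin 2 →₀ ℕ) (c : ℂ) :
    polyIncl (MvPolynomial.monomial s c) = AddMonoidAlgebra.single ((s 0 : ℤ), (s 1 : ℤ)) c := by
  rw [polyIncl, MvPolynomial.aeval_monomial, Finsupp.prod_fintype _ _ (fun i => pow_zero _),
    Fin.prod_univ_two, Matrix.cons_val_zero, Matrix.cons_val_one, Matrix.cons_val_fin_one,
    AddMonoidAlgebra.single_pow, AddMonoidAlgebra.single_pow, AddMonoidAlgebra.single_mul_single,
    Algebra.algebraMap_eq_smul_one, AddMonoidAlgebra.one_def, AddMonoidAlgebra.smul_single,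
    AddMonoidAlgebra.single_mul_single]
  simp

theorem polyMul_eq (P : MvPolynomial (Fin 2) ℂ) (D : ℤ → ℤ → W) (p q : ℤ) :
    polyMul P D p q = act (polyIncl P) (fun n => D n.1 n.2) (p, q) := by
  conv_rhs => rw [P.as_sum, map_sum, map_sum, LinearMap.sum_apply, Finset.sum_apply]
  refine Finset.sum_congr rfl fun s _ => ?_
  rw [polyIncl_monomial, act_single]
  rfl

theorem polyIncl_linear (α : ℂ) :
    polyIncl (MvPolynomial.X 0 - MvPolynomial.C α * MvPolynomial.X 1) =
      AddMonoidAlgebra.single (0, 1) 1 *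
        tau (1, -1) (LaurentPolynomial.T 1 - LaurentPolynomial.C α) := by
  have h1 : tau ((1, -1) : ℤ × ℤ) (LaurentPolynomial.C α) = AddMonoidAlgebra.single (0 • (1, -1)) α :=
    tau_single _ _ _
  rw [map_sub, map_sub, LaurentPolynomial.T, tau_single, h1, mul_sub,
    AddMonoidAlgebra.single_mul_single, AddMonoidAlgebra.single_mul_single, map_mul,
    MvPolynomial.X, MvPolynomial.X, ← MvPolynomial.monomial_zero', polyIncl_monomial,
    polyIncl_monomial, polyIncl_monomial, AddMonoidAlgebra.single_mul_single]
  simp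

/-- The polynomial `(x₁ - α₁ x₂) ⋯ (x₁ - α_k x₂)`. -/
noncomputable def homProd (l : List ℂˣ) : MvPolynomial (Fin 2) ℂ :=
  (l.map fun α : ℂˣ => (MvPolynomial.X 0 - MvPolynomial.C (α : ℂ) * MvPolynomial.X 1 :
    MvPolynomial (Fin 2) ℂ)).prod

theorem polyIncl_homProd (l : List ℂˣ) : polyIncl (homProd l) =
    AddMonoidAlgebra.single (0, (l.length : ℤ)) 1 * tau (1, -1) (linProd l) := by
  induction l with
  | nil =>
    rw [linProd_nil, map_one, mul_one, homProd, List.map_nil, List.prod_nil, map_one]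
    rfl
  | cons α l ih =>
    rw [homProd, List.map_cons, List.prod_cons, ← homProd, map_mul, ih, polyIncl_linear,
      linProd_cons, map_mul, mul_mul_mul_comm, AddMonoidAlgebra.single_mul_single]
    simp [add_comm]

theorem homProd_ne_zero (l : List ℂˣ) : homProd l ≠ 0 := by
  refine List.prod_ne_zero fun h => ?_
  obtain ⟨α, _, hα⟩ := List.mem_map.1 h
  have := congrArg (MvPolynomial.eval ![(1 : ℂ), 0]) hα
  simp at this

theorem act_single_one_mul (v : ℤ × ℤ) (x : AddMonoidAlgebra ℂ (ℤ × ℤ)) (F : ℤ × ℤ → W)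
    (n : ℤ × ℤ) : act (AddMonoidAlgebra.single v 1 * x) F n = act x F (n + v) := by
  rw [act_mul, act_single, one_smul]

/-- The action of `(x₁ - α₁ x₂) ⋯ (x₁ - α_k x₂)` is that of a Laurent polynomial in `x₁ / x₂`, up
to a translation. -/
theorem act_homProd (l : List ℂˣ) (F : ℤ × ℤ → W) (n : ℤ × ℤ) :
    act (polyIncl (homProd l)) F n = mulT (linProd l) F (n + (0, (l.length : ℤ))) := by
  rw [polyIncl_homProd, act_single_one_mul]; rfl

theorem act_homProd_eq_zero {l : List ℂˣ} {F : ℤ × ℤ → W} :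
    act (polyIncl (homProd l)) F = 0 ↔ mulT (linProd l) F = 0 := by
  refine ⟨fun h => funext fun n => ?_, fun h => funext fun n => ?_⟩
  · have := congrFun h (n - (0, (l.length : ℤ)))
    rwa [act_homProd, sub_add_cancel] at this
  · rw [act_homProd, h]; rfl

theorem localOn_iff_polyMul {Φ : Subgroup ℂˣ} {a b : VertexOperator ℂ W} :
    LocalOn Φ a b ↔ ∃ l : List ℂˣ, (∀ α ∈ l, α ∈ Φ) ∧
      polyMul (homProd l) (voCommutator a b) = 0 := by
  refine exists_congr fun l => and_congr_right fun _ => ?_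
  have key : ∀ p q w, polyMul (homProd l) (voCommutator a b) p q w =
      act (polyIncl (homProd l)) (jac a b w 0) (p, q) := fun p q w => by
    have : polyMul (homProd l) (voCommutator a b) p q w =
        polyMul (homProd l) (fun p q => voCommutator a b p q w) p q := by
      rw [polyMul, LinearMap.sum_apply]; rfl
    rw [this, polyMul_eq]
    refine congrFun (congrArg _ (funext fun n => ?_)) _
    rw [jac_zero]; rfl
  refine ⟨fun h => ?_, fun h w => ?_⟩
  · ext p q w
    rw [key, act_homProd_eq_zero.2 (h w)]; rfl
  · rw [← act_homProd_eq_zero]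
    ext ⟨p, q⟩
    rw [← key, h]; rfl

/-- The restriction of a polynomial to the diagonal `x₁ = x₂`. -/
noncomputable def polyDiag : MvPolynomial (Fin 2) ℂ →ₐ[ℂ] Polynomial ℂ :=
  MvPolynomial.aeval fun _ => Polynomial.X

/-- A polynomial that vanishes on the diagonal is divisible by `x₁ - x₂`. -/
theorem dvd_of_polyDiag_eq_zero {P : MvPolynomial (Fin 2) ℂ} (h : polyDiag P = 0) :
    (MvPolynomial.X 0 - MvPolynomial.X 1) ∣ P := by
  have key : (MvPolynomial.X 0 - MvPolynomial.X 1 : MvPolynomial (Fin 2) ℂ) ∣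
      P - Polynomial.aeval (MvPolynomial.X 1) (polyDiag P) := by
    clear h
    induction P using MvPolynomial.induction_on with
    | C c => simp [polyDiag]
    | add P Q hP hQ =>
      rw [map_add, map_add, add_sub_add_comm]
      exact dvd_add hP hQ
    | mul_X P i hP =>
      have e : P * MvPolynomial.X i - Polynomial.aeval (MvPolynomial.X 1)
          (polyDiag (P * MvPolynomial.X i)) =
          (P - Polynomial.aeval (MvPolynomial.X 1) (polyDiag P)) * MvPolynomial.X i +
          Polynomial.aeval (MvPolynomial.X 1) (polyDiag P) *
            (MvPolynomial.X i - MvPolynomial.X 1) := by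
        have : polyDiag (MvPolynomial.X i) = Polynomial.X := MvPolynomial.aeval_X _ _
        rw [map_mul, this, map_mul, Polynomial.aeval_X]
        ring
      rw [e]
      refine dvd_add (hP.mul_right _) (Dvd.dvd.mul_left ?_ _)
      fin_cases i
      · exact dvd_rfl
      · simp
  rwa [h, map_zero, sub_zero] at key

theorem exists_eq_diff_pow_mul {P : MvPolynomial (Fin 2) ℂ} (hP : P ≠ 0) :
    ∃ (j : ℕ) (Q : MvPolynomial (Fin 2) ℂ),
      P = (MvPolynomial.X 0 - MvPolynomial.X 1) ^ j * Q ∧ polyDiag Q ≠ 0 := by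
  have hu : ¬ IsUnit (MvPolynomial.X 0 - MvPolynomial.X 1 : MvPolynomial (Fin 2) ℂ) := fun h => by
    have := h.map (MvPolynomial.eval ![(0 : ℂ), 0])
    simp at this
  obtain ⟨Q, h1, h2⟩ := (FiniteMultiplicity.of_not_isUnit hu hP).exists_eq_pow_mul_and_not_dvd
  exact ⟨_, Q, h1, fun h => h2 (dvd_of_polyDiag_eq_zero h)⟩

/-- On series in which only the sum of the exponents matters, that is, multiples of the delta
function, a polynomial acts through its restriction to the diagonal. -/
theorem act_diag (Q : MvPolynomial (Fin 2) ℂ) (h : ℤ → W) :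
    act (polyIncl Q) (fun n => h (n.1 + n.2)) =
      fun n => act (Polynomial.toLaurent (polyDiag Q)) h (n.1 + n.2) := by
  induction Q using MvPolynomial.induction_on generalizing h with
  | C c =>
    ext n
    rw [← MvPolynomial.monomial_zero', polyIncl_monomial, act_single, MvPolynomial.monomial_zero']
    have : Polynomial.toLaurent (polyDiag (MvPolynomial.C c)) = AddMonoidAlgebra.single 0 c := by
      rw [polyDiag, MvPolynomial.aeval_C]
      exact Polynomial.toLaurent_C c
    rw [this, act_single]
    simp
  | add P Q hP hQ => rw [map_add, act_add, hP, hQ, map_add, map_add, act_add]; rfl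
  | mul_X P i hP =>
    have e : Polynomial.toLaurent (polyDiag (P * MvPolynomial.X i)) =
        Polynomial.toLaurent (polyDiag P) * AddMonoidAlgebra.single 1 1 := by
      rw [map_mul, map_mul, polyDiag, MvPolynomial.aeval_X, Polynomial.toLaurent_X]
      rfl
    have e2 : act (polyIncl (MvPolynomial.X i)) (fun n => h (n.1 + n.2)) =
        fun n => (fun k => h (k + 1)) (n.1 + n.2) := by
      ext n
      rw [MvPolynomial.X, polyIncl_monomial, act_single, one_smul]
      refine congrArg h ?_
      fin_cases i
      · simp; ring_nf
      · simp; ring_nf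
    have e3 : act (AddMonoidAlgebra.single 1 1) h = fun k => h (k + 1) := by
      ext k
      rw [act_single, one_smul]
    rw [map_mul, act_mul, e2]
    refine (hP fun k => h (k + 1)).trans ?_
    rw [e, ← e3]
    ext n
    rw [act_mul]

/-- A nonzero Laurent polynomial acts injectively on sequences vanishing for large indices. -/
theorem eq_zero_of_act_eq_zero {g : ℂ[T;T⁻¹]} (hg : g ≠ 0) {h : ℤ → W}
    (hN : ∃ N, ∀ n, N ≤ n → h n = 0) (h0 : act g h = 0) : h = 0 := by
  by_contra hne
  obtain ⟨N, hN⟩ := hN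
  obtain ⟨n, hn, hmax⟩ := Int.exists_greatest_of_bdd (P := fun n => h n ≠ 0)
    ⟨N, fun z hz => by by_contra hlt; exact hz (hN z (by omega))⟩ (Function.ne_iff.1 hne)
  have hs : g.coeff.support.Nonempty :=
    Finsupp.support_nonempty_iff.2 fun h => hg (AddMonoidAlgebra.coeff_injective h)
  set s := g.coeff.support.min' hs with hs'
  have h1 := congrFun h0 (n - s)
  rw [act_apply, Finsupp.sum, Finset.sum_eq_single s] at h1
  · rw [sub_add_cancel, Pi.zero_apply, smul_eq_zero] at h1
    exact h1.elim (Finsupp.mem_support_iff.1 (Finset.min'_mem _ hs)) hn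
  · intro t ht hts
    have hle := Finset.min'_le _ t ht
    rw [← hs'] at hle
    have : h (n - s + t) = 0 := by
      by_contra hc
      have := hmax _ hc
      omega
    rw [this, smul_zero]
  · intro hc
    exact absurd (Finset.min'_mem _ hs) hc

end PolynomialAction

/-! ### The quasi-Jacobi identity and the products of fields -/

section QuasiJacobi

variable {W : Type*} [AddCommGroup W] [Module ℂ W] {a b : VertexOperator ℂ W}

/-- A family of series in `x₁, x₂` in which raising the index is multiplication by `x₁ - x₂`. -/
def IsPairFamily (X : ℤ → ℤ × ℤ → W) : Prop :=
  ∀ r p q, X (r + 1) (p, q) = X r (p + 1, q) - X r (p, q + 1)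

theorem IsPairFamily.act_diff {X : ℤ → ℤ × ℤ → W} (h : IsPairFamily X) (r : ℤ) :
    act (polyIncl (MvPolynomial.X 0 - MvPolynomial.X 1)) (X r) = X (r + 1) := by
  ext ⟨p, q⟩
  rw [map_sub, act_sub, Pi.sub_apply, MvPolynomial.X, MvPolynomial.X, polyIncl_monomial,
    polyIncl_monomial, act_single, act_single, h]
  simp

theorem IsPairFamily.act_diff_pow {X : ℤ → ℤ × ℤ → W} (h : IsPairFamily X) (j : ℕ) (r : ℤ) :
    act (polyIncl ((MvPolynomial.X 0 - MvPolynomial.X 1) ^ j)) (X r) = X (r + j) := by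
  induction j generalizing r with
  | zero => rw [pow_zero, map_one, act_one]; simp
  | succ j ih =>
    rw [pow_succ, map_mul, act_mul, h.act_diff, ih]
    congr 1; push_cast; ring

theorem IsPairFamily.mulT_tOne {X : ℤ → ℤ × ℤ → W} (h : IsPairFamily X) {m : ℤ}
    (hm : ∀ r, m ≤ r → X r = 0) (M : ℕ) (r : ℤ) (hr : m ≤ r + M) : mulT (tOne ^ M) (X r) = 0 := by
  induction M generalizing r with
  | zero => rw [hm r (by simpa using hr), map_zero]
  | succ M ih =>
    have e : mulT tOne (X r) = act (AddMonoidAlgebra.single (0, -1) 1) (X (r + 1)) := by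
      ext ⟨p, q⟩
      rw [act_single, one_smul, _root_.mulT_tOne, Prod.mk_add_mk, h]
      simp [sub_eq_add_neg]
    rw [pow_succ, mulT_mul, e, mulT, act_comm, ← mulT, ih _ (by push_cast at hr; omega), map_zero]

theorem isPairFamily_jac (a b : VertexOperator ℂ W) (w : W) : IsPairFamily (jac a b w) :=
  fun r p q => jac_succ a b w r (p, q)

/-- The coefficients of `x₂⁻¹ δ((x₁ - x₀) / x₂) c(x₀, x₂) w`, where
`c(x₀, x₂) = ∑ cᵢ(x₂) x₀ ^ (-i-1)`. -/
noncomputable def taylor (c : ℤ → VertexOperator ℂ W) (w : W) (r : ℤ) (n : ℤ × ℤ) : W :=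
  ∑ᶠ i : ℕ, ((Ring.choose n.1 i : ℤ) : ℂ) • ((c (r + i))[[n.1 + n.2 - i]]) w

variable {c d : ℤ → VertexOperator ℂ W}

theorem taylor_eq_sum {N : ℤ} (hc : ∀ i, N ≤ i → c i = 0) (w : W) (r p q : ℤ) {k : ℕ}
    (hk : N ≤ r + k) : taylor c w r (p, q) = ∑ i ∈ Finset.range k,
      ((Ring.choose p i : ℤ) : ℂ) • ((c (r + i))[[p + q - i]]) w := by
  rw [taylor]
  refine finsum_eq_sum_of_support_subset _ fun i hi => ?_
  simp only [Finset.coe_range, Set.mem_Iio]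
  by_contra h
  refine hi ?_
  beta_reduce
  rw [hc _ (by omega), ncoeff_zero, smul_zero]

theorem isPairFamily_taylor {N : ℤ} (hc : ∀ i, N ≤ i → c i = 0) (w : W) :
    IsPairFamily (taylor c w) := fun r p q => by
  have hk : N ≤ r + 1 + (N - r - 1).toNat := by omega
  have hk' : N ≤ r + ((N - r - 1).toNat + 1 : ℕ) := by push_cast; omega
  rw [taylor_eq_sum hc w (r + 1) p q hk, taylor_eq_sum hc w r (p + 1) q hk',
    taylor_eq_sum hc w r p (q + 1) hk', Finset.sum_range_succ', Finset.sum_range_succ',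
    add_sub_add_comm, ← Finset.sum_sub_distrib]
  have e0 : p + 1 + q - ((0 : ℕ) : ℤ) = p + (q + 1) - ((0 : ℕ) : ℤ) := by ring
  rw [e0, Ring.choose_zero_right, Ring.choose_zero_right, sub_self, add_zero]
  refine Finset.sum_congr rfl fun i _ => ?_
  have e1 : p + 1 + q - ((i + 1 : ℕ) : ℤ) = p + q - i := by push_cast; ring
  have e2 : p + (q + 1) - ((i + 1 : ℕ) : ℤ) = p + q - i := by push_cast; ring
  have e3 : r + ((i + 1 : ℕ) : ℤ) = r + 1 + i := by push_cast; ring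
  rw [e1, e2, e3, ← sub_smul, Ring.choose_succ_succ]
  congr 1
  push_cast
  ring

theorem taylor_eq_zero {N : ℤ} (hc : ∀ i, N ≤ i → c i = 0) (w : W) (r : ℤ) (hr : N ≤ r) :
    taylor c w r = 0 := by
  ext ⟨p, q⟩
  rw [taylor_eq_sum hc w r p q (k := 0) (by simpa using hr)]
  rfl

/-- The difference of two families agreeing above the index `r` is a multiple of the delta
function. -/
theorem taylor_sub_taylor {N : ℤ} (hc : ∀ i, N ≤ i → c i = 0) (hd : ∀ i, N ≤ i → d i = 0) (w : W)
    {r : ℤ} (h : ∀ i, r < i → c i = d i) :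
    taylor c w r - taylor d w r =
      fun n => (fun k => ((c r)[[k]]) w - ((d r)[[k]]) w) (n.1 + n.2) := by
  ext ⟨p, q⟩
  have hk : N ≤ r + ((N - r).toNat + 1 : ℕ) := by push_cast; omega
  rw [Pi.sub_apply, taylor_eq_sum hc w r p q hk, taylor_eq_sum hd w r p q hk,
    Finset.sum_range_succ', Finset.sum_range_succ', add_sub_add_comm, sub_eq_zero.2, zero_add]
  · simp
  · refine Finset.sum_congr rfl fun i _ => ?_
    rw [h _ (by push_cast; omega)]

/-- A localized kernel is the delta function expansion of its residues. -/
theorem mulT_jac_eq_taylor {e : ℂ[T;T⁻¹]} {m : ℤ} (h : KillsAt e a b m) (w : W) (r : ℤ) :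
    mulT e (jac a b w r) = taylor (fun i => kerField e a b 0 i) w r := by
  have hc : ∀ i, m ≤ i → kerField e a b 0 i = 0 := fun i hi => kerField_eq_zero (h.mono hi) 0
  ext ⟨p, q⟩
  have hk : m ≤ r + (m - r).toNat := by omega
  rw [taylor_eq_sum hc w r p q hk, ← kerField_ncoeff, kerField_taylor h p r hk, ncoeff_sum]
  refine Finset.sum_congr rfl fun i _ => ?_
  rw [ncoeff_smul, shift_ncoeff]
  congr 4
  ring_nf

/-- A Laurent polynomial that agrees with `1` to high order on the diagonal acts trivially on
series supported on the diagonal. -/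
theorem mulT_taylor {N : ℤ} (hc : ∀ i, N ≤ i → c i = 0) {e : ℂ[T;T⁻¹]} {M : ℕ}
    (he : tOne ^ M ∣ e - 1) (w : W) {r : ℤ} (hr : N ≤ r + M) :
    mulT e (taylor c w r) = taylor c w r := by
  obtain ⟨s, hs⟩ := he
  have h := (isPairFamily_taylor hc w).mulT_tOne (taylor_eq_zero hc w) M r hr
  have h2 : mulT (e - 1) (taylor c w r) = 0 := by rw [hs, mul_comm, mulT_mul, h, map_zero]
  rwa [mulT_sub, mulT_one, sub_eq_zero] at h2

/-- In the Jacobi identity up to multiplication by a nonzero polynomial, the coefficients of the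
iterate are the products of the two fields: after separation of the powers of `x₁ - x₂`, the
polynomial does not vanish on the diagonal, and the top coefficients can be compared. -/
theorem eq_prodN_of_quasiJacobi {N : ℤ} (hc : ∀ i, N ≤ i → c i = 0) (hab : QuasiLocal a b)
    {P : MvPolynomial (Fin 2) ℂ} (hP : P ≠ 0)
    (h : ∀ w r, act (polyIncl P) (jac a b w r) = act (polyIncl P) (taylor c w r)) (n : ℤ) :
    c n = prodN a b n := by
  obtain ⟨j, Q, rfl, hQ⟩ := exists_eq_diff_pow_mul hP
  have hQ' : ∀ w r, act (polyIncl Q) (jac a b w r) = act (polyIncl Q) (taylor c w r) := fun w r => by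
    have := h w (r - j)
    rwa [mul_comm, map_mul, act_mul, act_mul, (isPairFamily_jac a b w).act_diff_pow,
      (isPairFamily_taylor hc w).act_diff_pow, sub_add_cancel] at this
  obtain ⟨K, G, hG, hK⟩ := hab
  -- descending induction on the index, from the range where both families vanish down to `n`
  set M : ℕ := K + n.natAbs + N.natAbs with hM
  obtain ⟨e, he, heM⟩ := exists_multiplier hG M 1
  rw [pow_one] at he
  have hd : ∀ i : ℤ, (K + N.natAbs : ℕ) ≤ i → kerField e a b 0 i = 0 := fun i hi =>
    kerField_eq_zero (hK.of_order_zero he (by omega)) 0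
  have hc' : ∀ i : ℤ, (K + N.natAbs : ℕ) ≤ i → c i = 0 := fun i hi =>
    hc i (by omega)
  rw [prodN_eq ⟨K, G, M, hG, hK, he, heM, by omega⟩]
  have key : ∀ k : ℕ, ∀ i : ℤ, n ≤ i → (K + N.natAbs : ℕ) ≤ i + k →
      c i = kerField e a b 0 i := by
    intro k
    induction k with
    | zero => intro i _ hi; rw [hc' i (by simpa using hi), hd i (by simpa using hi)]
    | succ k ih =>
      intro i hni hi
      refine ext_ncoeff fun t w => ?_
      have h1 := taylor_sub_taylor hc' hd w (r := i) fun i' hi' =>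
        ih i' (by omega) (by omega)
      have h2 : act (polyIncl Q) (taylor c w i -
          taylor (fun i => kerField e a b 0 i) w i) = 0 := by
        rw [← mulT_jac_eq_taylor (hK.of_order_zero (n := K) he le_rfl), ← mulT_taylor hc heM w
          (r := i) (by omega), ← map_sub (mulT e), mulT, act_comm, map_sub (act (polyIncl Q)), hQ',
          sub_self, map_zero]
      rw [h1] at h2
      have h4 := (act_diag Q
        fun k => ((c i)[[k]]) w - ((kerField e a b 0 i)[[k]]) w).symm.trans h2
      have h3 := eq_zero_of_act_eq_zero (W := W)
        (g := Polynomial.toLaurent (polyDiag Q)) (fun h => hQ (Polynomial.toLaurent_injective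
          (h.trans (map_zero _).symm)))
        (h := fun k => ((c i)[[k]]) w - ((kerField e a b 0 i)[[k]]) w) ?_ ?_
      · exact sub_eq_zero.1 (congrFun h3 t)
      · obtain ⟨N1, hN1⟩ := (c i).exists_trunc w
        obtain ⟨N2, hN2⟩ := (kerField e a b 0 i).exists_trunc w
        exact ⟨max N1 N2, fun k hk => by rw [hN1 _ (by omega), hN2 _ (by omega), sub_zero]⟩
      · ext k
        simpa using congrFun h4 (k, 0)
  exact key (K + N.natAbs + n.natAbs) n le_rfl (by omega)

/-- The Jacobi identity for the products of two local fields, up to multiplication by the factors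
`x₁ - α x₂` with `α ≠ 1`. -/
theorem LocalOn.exists_quasiJacobi {Φ : Subgroup ℂˣ} (h : LocalOn Φ a b) :
    ∃ P : MvPolynomial (Fin 2) ℂ, P ≠ 0 ∧ ∀ w r,
      act (polyIncl P) (jac a b w r) = act (polyIncl P) (taylor (prodN a b) w r) := by
  obtain ⟨l, _, hk⟩ := h
  obtain ⟨N, l', hG, e⟩ := exists_linProd_eq l
  rw [e] at hk
  refine ⟨homProd l', homProd_ne_zero l', fun w r => ?_⟩
  rw [← sub_eq_zero, ← map_sub (act (polyIncl (homProd l'))), act_homProd_eq_zero]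
  obtain ⟨e, he, heM⟩ := exists_multiplier hG (N + r.natAbs) 1
  rw [pow_one] at he
  have h1 : mulT e (jac a b w r) = taylor (prodN a b) w r := by
    rw [mulT_jac_eq_taylor (hk.of_order_zero (n := N) he le_rfl)]
    ext ⟨p, q⟩
    refine finsum_congr fun i => ?_
    rw [prodN_eq ⟨N, linProd l', _, hG, hk, he, heM, by omega⟩]
  obtain ⟨s, hs⟩ := heM
  have h2 : mulT (linProd l' * (e - 1)) (jac a b w r) = 0 := by
    rw [hs, mul_left_comm]
    exact hk.of_order (dvd_mul_right _ _) (by omega) w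
  rw [mul_sub, mul_one, mulT_sub] at h2
  rw [← h1, map_sub (mulT (linProd l')), ← mulT_mul, ← neg_sub, h2, neg_zero]

end QuasiJacobi

/-! ### Quasimodules for the affine vertex algebra -/

section Quasimodule

variable {V W : Type*} [AddCommGroup V] [Module ℂ V] [AddCommGroup W] [Module ℂ W]

/-- The Jacobi identity up to multiplication by `P`, in terms of kernels. -/
theorem polyMul_jacobi_iff {P : MvPolynomial (Fin 2) ℂ} {Y : V →ₗ[ℂ] VertexOperator ℂ V}
    {YW : V →ₗ[ℂ] VertexOperator ℂ W} {u v : V} :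
    (∀ (w : W) (r p q : ℤ), polyMul P (jacobiFirst (YW u) (YW v) w r) p q -
      polyMul P (jacobiSecond (YW u) (YW v) w r) p q = polyMul P (jacobiThird Y YW u v w r) p q) ↔
    ∀ w r, act (polyIncl P) (jac (YW u) (YW v) w r) =
      act (polyIncl P) (taylor (fun i => YW (((Y u)[[i]]) v)) w r) := by
  refine forall_congr' fun w => forall_congr' fun r => ?_
  have e : jac (YW u) (YW v) w r = (fun n => jacobiFirst (YW u) (YW v) w r n.1 n.2) -
      fun n => jacobiSecond (YW u) (YW v) w r n.1 n.2 := rfl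
  simp only [polyMul_eq, e, map_sub]
  exact ⟨fun h => funext fun n => h n.1 n.2, fun h p q => congrFun h (p, q)⟩

variable {G : Type*} [Group G] {𝒱 : VertexAlgebra V} {R : Representation ℂ G V} {φ : G →* ℂˣ}
  {YW : V →ₗ[ℂ] VertexOperator ℂ W}

theorem VertexAlgebra.IsGroupQuasimodule.localOn (h : 𝒱.IsGroupQuasimodule R φ YW) (u v : V) :
    LocalOn φ.range (YW u) (YW v) := localOn_iff_polyMul.2 (h.gammaLocal u v)

/-- In a quasimodule, the field of `uₙ v` is the `n`-th product of the fields of `u` and `v`. -/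
theorem VertexAlgebra.IsGroupQuasimodule.map_prodN (h : 𝒱.IsGroupQuasimodule R φ YW) (u v : V)
    (n : ℤ) : YW (((𝒱.Y u)[[n]]) v) = prodN (YW u) (YW v) n := by
  obtain ⟨P, hP, hJ⟩ := h.quasiJacobi u v
  obtain ⟨N, hN⟩ := (𝒱.Y u).exists_trunc v
  exact eq_prodN_of_quasiJacobi (c := fun i => YW (((𝒱.Y u)[[i]]) v)) (N := N)
    (fun i hi => by rw [hN i hi, map_zero]) (h.localOn u v).quasiLocal hP
    (polyMul_jacobi_iff.1 hJ) n

end Quasimodule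

/-! ### Fields with the commutation relations of the twisted affine Lie algebra -/

section TwistedFields

variable {G K : Type*} [Group G] [LieRing K] [LieAlgebra ℂ K] {F : InvForm K} (A : FormAct G F)
  (φ : G →* ℂˣ) (ℓ : ℂ) {W : Type*} [AddCommGroup W] [Module ℂ W]

/-- A linear family of fields indexed by `K / ker φ` is equivariant if
`B(g x) = φ(g) B(x)(φ(g) ·)` for `g ∈ G`. -/
def FormAct.Equivariant (B : A.KerCoinv φ →ₗ[ℂ] VertexOperator ℂ W) : Prop :=
  ∀ g x, B (A.kerAct φ g x) = (φ g : ℂ) • dilate (φ g) (B x)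

/-- A quasimodule structure is determined by the fields of the generators. -/
theorem VertexAlgebra.IsGroupQuasimodule.ext_state {𝒱 : VertexAlgebra (Vacuum (A.kerForm φ) ℓ)}
    (h𝒱 : IsAffineVertexAlgebra (A.kerForm φ) ℓ 𝒱)
    {R : Representation ℂ G (Vacuum (A.kerForm φ) ℓ)}
    {YW YW' : Vacuum (A.kerForm φ) ℓ →ₗ[ℂ] VertexOperator ℂ W}
    (h : 𝒱.IsGroupQuasimodule R φ YW) (h' : 𝒱.IsGroupQuasimodule R φ YW')
    (hs : ∀ x, YW (Vacuum.state _ ℓ x) = YW' (Vacuum.state _ ℓ x)) : YW = YW' := by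
  refine LinearMap.ext fun v => ?_
  refine Vacuum.induction (p := fun v => YW v = YW' v) ?_ ?_ ?_ ?_ v
  · rw [← h𝒱.vac_eq]
    exact ext_ncoeff fun n w => by rw [h.Y_vac, h'.Y_vac]
  · intro n a v hv
    rw [← h𝒱.Y_state, h.map_prodN, h'.map_prodN, hs, hv]
  · intro v v' hv hv'
    rw [map_add, map_add, hv, hv']
  · intro c v hv
    rw [map_smul, map_smul, hv]

variable {A φ ℓ}

/-- Equivariant fields with the relations of the affine Lie algebra of `K / ker φ` generate a
quasimodule for the affine vertex algebra. -/
theorem IsAffineFields.isGroupQuasimodule {𝒱 : VertexAlgebra (Vacuum (A.kerForm φ) ℓ)}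
    (h𝒱 : IsAffineVertexAlgebra (A.kerForm φ) ℓ 𝒱)
    {B : A.KerCoinv φ →ₗ[ℂ] VertexOperator ℂ W}
    (hB : IsAffineFields (A.kerForm φ) ℓ φ.range B) (hE : A.Equivariant φ B) :
    𝒱.IsGroupQuasimodule (A.vacuumAct φ ℓ) φ hB.fieldMap where
  Y_vac n w := by rw [h𝒱.vac_eq, hB.fieldMap_one, idField_ncoeff]
  quasiJacobi u v := by
    obtain ⟨P, hP, h⟩ := (hB.fieldMap_localOn u v).exists_quasiJacobi
    refine ⟨P, hP, polyMul_jacobi_iff.2 fun w r => (h w r).trans ?_⟩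
    congr 2
    ext1 i
    rw [h𝒱.Y_eq, hB.fieldMap_prodN]
  equivariant g v n := by
    suffices h : hB.fieldMap (A.vacuumAct φ ℓ g v) = dilate (φ g) (hB.fieldMap v) by
      rw [h, dilate_ncoeff]
    refine Vacuum.induction (p := fun v => hB.fieldMap (A.vacuumAct φ ℓ g v) =
      dilate (φ g) (hB.fieldMap v)) ?_ ?_ ?_ ?_ v
    · rw [A.vacuumAct_one, hB.fieldMap_one]
      refine ext_ncoeff fun n w => ?_
      rw [dilate_ncoeff, LinearMap.smul_apply, idField_ncoeff]
      by_cases h : n = -1 <;> simp [h]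
    · intro m a u hu
      have hl := (hB.localOn_fieldMap a u).quasiLocal
      rw [A.vacuumAct_modeAct, map_smul, hB.fieldMap_modeAct, hB.fieldMap_modeAct, hu, hE,
        prodN_smul_left, prodN_dilate hl, smul_smul, smul_smul, ← Units.val_mul,
        ← Units.val_mul, ← zpow_add_one, ← zpow_add]
      · rw [show m + 1 + (-m - 1) = 0 by ring, zpow_zero, Units.val_one, one_smul]
      · obtain ⟨N, G, hG, hk⟩ := hl
        exact ⟨N, G, hG, hk.dilate (φ g)⟩
    · intro u v hu hv
      refine ext_ncoeff fun n w => ?_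
      simp only [dilate_ncoeff, LinearMap.smul_apply] at hu hv ⊢
      rw [map_add (A.vacuumAct φ ℓ g), map_add hB.fieldMap, hu, hv, map_add hB.fieldMap, ncoeff_add,
        ncoeff_add, smul_add, dilate_ncoeff, dilate_ncoeff]
      rfl
    · intro c u hu
      refine ext_ncoeff fun n w => ?_
      rw [map_smul, map_smul, hu, ncoeff_smul, dilate_ncoeff, dilate_ncoeff, map_smul hB.fieldMap,
        LinearMap.smul_apply, LinearMap.smul_apply, ncoeff_smul, smul_comm]
  gammaLocal u v := localOn_iff_polyMul.1 (hB.fieldMap_localOn u v)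

variable (A φ ℓ)

/-- The linear map on the affine Lie algebra of `K` with `a ⊗ t ^ n ↦ B(ā)ₙ` and `𝐤 ↦ ℓ`. -/
noncomputable def FormAct.twistedLift (B : A.KerCoinv φ →ₗ[ℂ] VertexOperator ℂ W) :
    Affine F →ₗ[ℂ] Module.End ℂ W :=
  Affine.lift F (fun n => LinearMap.proj n ∘ₗ ncoeff ∘ₗ B ∘ₗ (A.restrict φ.ker).toCoinv) (ℓ • 1)

/-- The coefficients of the right-hand side of the commutation relation of `ā(x₁)` and `b̄(x₂)`. -/
noncomputable def FormAct.twistedComm (B : A.KerCoinv φ →ₗ[ℂ] VertexOperator ℂ W) (a b : K) (w : W)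
    (p : ℤ × ℤ) : W :=
  A.twistedLift φ ℓ B ((A.affineAct φ).bracket (Affine.mode F p.1 a) (Affine.mode F p.2 b)) w

variable (B : A.KerCoinv φ →ₗ[ℂ] VertexOperator ℂ W)

theorem FormAct.twistedLift_mode (n : ℤ) (a : K) : A.twistedLift φ ℓ B (Affine.mode F n a) =
    (B ((A.restrict φ.ker).toCoinv a))[[n]] := Affine.lift_mode _ _ _ _ _

theorem FormAct.twistedLift_central : A.twistedLift φ ℓ B (Affine.central F) = ℓ • 1 :=
  Affine.lift_central _ _ _

/-- The commutator of the twisted affine Lie algebra is a sum of series supported on the lines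
`x₁ = φ(g) x₂`. -/
theorem FormAct.twistedComm_eq_sum (a b : K) : ∃ S : Finset G,
    (∀ g ∉ S, ⁅A.ρ g a, b⁆ = 0 ∧ F.form (A.ρ g a) b = 0) ∧ ∀ w, A.twistedComm φ ℓ B a b w =
      ∑ g ∈ S, lineSeries (φ g)
        (fun n => ((B ((A.restrict φ.ker).toCoinv ⁅A.ρ g a, b⁆))[[n]]) w)
        (fun n => ((if n = 0 then 1 else 0) * (ℓ * F.form (A.ρ g a) b)) • w) := by
  set S := ((A.finite_lie a b).union (A.finite_form a b)).toFinset with hS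
  have hS' : ∀ g ∉ S, ⁅A.ρ g a, b⁆ = 0 ∧ F.form (A.ρ g a) b = 0 := fun g hg => by
    simpa [hS, not_or] using hg
  refine ⟨S, hS', fun w => ?_⟩
  ext ⟨m, n⟩
  rw [FormAct.twistedComm, affineAct_bracket_mode, finsum_eq_sum_of_support_subset (s := S),
    map_sum, LinearMap.sum_apply, Finset.sum_apply]
  · refine Finset.sum_congr rfl fun g _ => ?_
    rw [map_smul, map_add, map_smul, twistedLift_mode, twistedLift_central, lineSeries]
    simp only [LinearMap.smul_apply, LinearMap.add_apply, Module.End.one_apply, smul_smul]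
    congr 3
    ring
  · intro g hg
    by_contra h
    obtain ⟨h1, h2⟩ := hS' g h
    refine hg ?_
    beta_reduce
    rw [h1, h2, map_zero, mul_zero, zero_smul, add_zero, smul_zero]

theorem finsum_ker {M : Type*} [AddCommMonoid M] (f : G → M) (S : Finset G)
    (hS : ∀ g ∉ S, f g = 0) [DecidablePred fun g => φ g = 1] :
    ∑ᶠ h : φ.ker, f h = ∑ g ∈ S with φ g = 1, f g := by
  refine (finsum_set_coe_eq_finsum_mem (φ.ker : Set G)).trans ?_
  refine finsum_mem_eq_sum_of_inter_support_eq f ?_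
  ext g
  simp only [Set.mem_inter_iff, SetLike.mem_coe, MonoidHom.mem_ker, Function.mem_support,
    Finset.coe_filter, Set.mem_ofPred_eq]
  constructor
  · rintro ⟨h1, h2⟩
    exact ⟨⟨by_contra fun h => h2 (hS g h), h1⟩, h2⟩
  · rintro ⟨⟨_, h1⟩, h2⟩
    exact ⟨h1, h2⟩

theorem isCoprime_linProd {l : List ℂˣ} (h : ∀ α ∈ l, α ≠ 1) : IsCoprime tOne (linProd l) := by
  induction l with
  | nil => rw [linProd_nil]; exact isCoprime_one_right
  | cons α l ih =>
    rw [linProd_cons]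
    refine IsCoprime.mul_right ?_ (ih fun β hβ => h β (List.mem_cons_of_mem _ hβ))
    rw [tOne_eq]
    exact isCoprime_T_sub_C fun h' => h α List.mem_cons_self (Units.ext h'.symm)

theorem dvd_linProd {l : List ℂˣ} {α : ℂˣ} (h : α ∈ l) :
    LaurentPolynomial.T 1 - LaurentPolynomial.C (α : ℂ) ∣ linProd l :=
  List.dvd_prod (List.mem_map_of_mem h)

/-- Localization at the diagonal of the commutator: only the terms with `φ(g) = 1` survive, and they
add up to the bracket and the form of `K / ker φ`. -/
theorem FormAct.twistedComm_localize (a b : K) : ∃ l : List ℂˣ, (∀ α ∈ l, α ∈ φ.range) ∧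
    IsCoprime tOne (linProd l) ∧
    (∀ w, mulT (tOne ^ 2 * linProd l) (A.twistedComm φ ℓ B a b w) = 0) ∧
    ∀ e, linProd l ∣ e → tOne ^ 2 ∣ e - 1 → ∀ w m n, mulT e (A.twistedComm φ ℓ B a b w) (m, n) =
      ((B ⁅(A.restrict φ.ker).toCoinv a, (A.restrict φ.ker).toCoinv b⁆)[[m + n]]) w +
      ((m : ℂ) * (if m + n = 0 then 1 else 0) * (ℓ * (A.kerForm φ).form
        ((A.restrict φ.ker).toCoinv a) ((A.restrict φ.ker).toCoinv b))) • w := by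
  classical
  obtain ⟨S, hS, hsum⟩ := A.twistedComm_eq_sum φ ℓ B a b
  -- each pole off the diagonal is at most double
  set l := (S.filter fun g => φ g ≠ 1).toList.map φ with hl
  have hmem : ∀ α, α ∈ l ↔ ∃ g ∈ S, φ g ≠ 1 ∧ φ g = α := fun α => by simp [hl, and_assoc]
  have hdvd : ∀ g ∈ S, φ g ≠ 1 →
      (LaurentPolynomial.T 1 - LaurentPolynomial.C (φ g : ℂ)) ^ 2 ∣ linProd (l ++ l) := by
    intro g hg hg1
    rw [linProd_append, ← pow_two]
    exact pow_dvd_pow_of_dvd (dvd_linProd ((hmem _).2 ⟨g, hg, hg1, rfl⟩)) 2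
  refine ⟨l ++ l, fun α hα => ?_, isCoprime_linProd fun α hα => ?_, fun w => ?_,
    fun e he heM w m n => ?_⟩
  · obtain ⟨g, _, _, h⟩ := (hmem α).1 (by simpa using hα)
    exact ⟨g, h⟩
  · obtain ⟨g, _, h, h'⟩ := (hmem α).1 (by simpa using hα)
    exact h' ▸ h
  · rw [hsum, map_sum]
    refine Finset.sum_eq_zero fun g hg => mulT_lineSeries_of_dvd ?_ _ _
    by_cases h : φ g = 1
    · rw [h, Units.val_one, ← tOne_eq]
      exact dvd_mul_right _ _
    · exact (hdvd g hg h).mul_left _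
  · have h1 : mulT e (A.twistedComm φ ℓ B a b w) = ∑ g ∈ S with φ g = 1, lineSeries 1
        (fun n => ((B ((A.restrict φ.ker).toCoinv ⁅A.ρ g a, b⁆))[[n]]) w)
        (fun n => ((if n = 0 then 1 else 0) * (ℓ * F.form (A.ρ g a) b)) • w) := by
      rw [hsum, map_sum, Finset.sum_filter]
      refine Finset.sum_congr rfl fun g hg => ?_
      split_ifs with h
      · rw [mulT_lineSeries_of_dvd_sub_one, h]
        rwa [h, Units.val_one, ← tOne_eq]
      · exact mulT_lineSeries_of_dvd ((hdvd g hg h).trans he) _ _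
    have h2 : ⁅(A.restrict φ.ker).toCoinv a, (A.restrict φ.ker).toCoinv b⁆ =
        ∑ g ∈ S with φ g = 1, (A.restrict φ.ker).toCoinv ⁅A.ρ g a, b⁆ := by
      rw [LieAct.toCoinv_lie, ← map_sum, ← finsum_ker φ (fun g => ⁅A.ρ g a, b⁆) S
        fun g hg => (hS g hg).1]
      rfl
    have h3 : (A.kerForm φ).form ((A.restrict φ.ker).toCoinv a) ((A.restrict φ.ker).toCoinv b) =
        ∑ g ∈ S with φ g = 1, F.form (A.ρ g a) b := by
      rw [← finsum_ker φ (fun g => F.form (A.ρ g a) b) S fun g hg => (hS g hg).2]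
      rfl
    rw [h1, h2, h3, map_sum, ncoeff_sum, Finset.sum_apply]
    simp only [lineSeries, one_zpow, Units.val_one, one_smul, Finset.sum_add_distrib, smul_smul,
      ← Finset.sum_smul, Finset.mul_sum, mul_assoc]

variable {A φ ℓ B}

/-- Fields with the commutation relations of the twisted affine Lie algebra have the products of
the generators of the affine vertex algebra of `K / ker φ`. -/
theorem FormAct.isAffineFields_of_comm (h : ∀ a b w,
      jac (B ((A.restrict φ.ker).toCoinv a)) (B ((A.restrict φ.ker).toCoinv b)) w 0 =
        A.twistedComm φ ℓ B a b w) :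
    IsAffineFields (A.kerForm φ) ℓ φ.range B := by
  have key : ∀ x y, LocalOn φ.range (B x) (B y) ∧ prodN (B x) (B y) 0 = B ⁅x, y⁆ ∧
      prodN (B x) (B y) 1 = (ℓ * (A.kerForm φ).form x y) • idField ∧
      ∀ n, 2 ≤ n → prodN (B x) (B y) n = 0 := by
    intro x y
    obtain ⟨a, rfl⟩ := LieAct.toCoinv_surjective _ x
    obtain ⟨b, rfl⟩ := LieAct.toCoinv_surjective _ y
    obtain ⟨l, hl, hG, hk, hloc⟩ := A.twistedComm_localize φ ℓ B a b
    have hk' : KillsAt (tOne ^ 2 * linProd l) (B ((A.restrict φ.ker).toCoinv a))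
        (B ((A.restrict φ.ker).toCoinv b)) 0 := fun w => by rw [h, hk]
    obtain ⟨e, he, heM⟩ := exists_multiplier hG 2 1
    rw [pow_one] at he
    refine ⟨⟨1 :: 1 :: l, ?_, ?_⟩, affine_products hG hk' he heM fun w m n => ?_⟩
    · intro α hα
      rcases List.mem_cons.1 hα with rfl | hα
      · exact one_mem _
      rcases List.mem_cons.1 hα with rfl | hα
      · exact one_mem _
      exact hl α hα
    · rw [linProd_cons, linProd_cons, Units.val_one, ← tOne_eq, ← mul_assoc, ← pow_two]
      exact hk'
    · rw [h, hloc e he heM]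
  exact ⟨fun x y => (key x y).1, fun x y => (key x y).2.1, fun x y => (key x y).2.2.1,
    fun x y => (key x y).2.2.2⟩

end TwistedFields

/-! ### From twisted modules to quasimodules and back -/

section Correspondence

/-- The substitution of `z T` for `T` in a Laurent polynomial. -/
noncomputable def scaleT (z : ℂˣ) : ℂ[T;T⁻¹] →ₐ[ℂ] ℂ[T;T⁻¹] :=
  AddMonoidAlgebra.lift ℂ ℂ[T;T⁻¹] ℤ
    { toFun := fun s => AddMonoidAlgebra.single s.toAdd ((z ^ s.toAdd : ℂˣ) : ℂ)
      map_one' := by rw [toAdd_one, zpow_zero, Units.val_one]; rfl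
      map_mul' := fun s t => by
        rw [AddMonoidAlgebra.single_mul_single, toAdd_mul, zpow_add, Units.val_mul] }

theorem scaleT_single (z : ℂˣ) (s : ℤ) (c : ℂ) :
    scaleT z (AddMonoidAlgebra.single s c) =
      AddMonoidAlgebra.single s (c * ((z ^ s : ℂˣ) : ℂ)) := by
  rw [scaleT, AddMonoidAlgebra.lift_single]
  exact AddMonoidAlgebra.smul_single _ _ _

variable {W : Type*} [AddCommGroup W] [Module ℂ W]

/-- Multiplication by a Laurent polynomial in `x₁ / x₂` is compatible with rescaling `x₁`. -/
theorem mulT_scaleT (z : ℂˣ) (e : ℂ[T;T⁻¹]) (X : ℤ × ℤ → W) (i j : ℤ) :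
    mulT (scaleT z⁻¹ e) (fun n => ((z ^ n.1 : ℂˣ) : ℂ) • X n) (i, j) =
      ((z ^ i : ℂˣ) : ℂ) • mulT e X (i, j) := by
  induction e using AddMonoidAlgebra.induction_linear with
  | zero => simp [mulT]
  | add f g hf hg => rw [map_add, mulT_add, mulT_add, Pi.add_apply, Pi.add_apply, hf, hg, smul_add]
  | single s c =>
    rw [scaleT_single, mulT_single, mulT_single, smul_smul, smul_smul, mul_assoc, ← Units.val_mul,
      inv_zpow', ← zpow_add, mul_comm]
    congr 4
    ring

/-- A Laurent polynomial that is `1` at `T = 1` becomes one that is nonzero at `T = z`. -/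
theorem isCoprime_scaleT {z : ℂˣ} {e : ℂ[T;T⁻¹]} (h : tOne ∣ e - 1) :
    IsCoprime (LaurentPolynomial.T 1 - LaurentPolynomial.C (z : ℂ)) (scaleT z⁻¹ e) := by
  obtain ⟨s, hs⟩ := h
  have h1 := congrArg (scaleT z⁻¹) hs
  have h2 : scaleT z⁻¹ tOne = LaurentPolynomial.C ((z⁻¹ : ℂˣ) : ℂ) *
      (LaurentPolynomial.T 1 - LaurentPolynomial.C (z : ℂ)) := by
    rw [tOne, map_sub, map_one, LaurentPolynomial.T, scaleT_single, mul_sub, ← map_mul,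
      ← Units.val_mul, inv_mul_cancel, Units.val_one, map_one, zpow_one, one_mul]
    congr 1
    exact LaurentPolynomial.single_eq_C_mul_T _ _
  rw [map_sub, map_one, map_mul, h2] at h1
  exact ⟨-(LaurentPolynomial.C ((z⁻¹ : ℂˣ) : ℂ) * scaleT z⁻¹ s), 1, by linear_combination h1⟩

/-- A series annihilated by a product of linear factors vanishes if, for each of the factors, it is
annihilated by a Laurent polynomial coprime to that factor. -/
theorem eq_zero_of_mulT_linProd {l : List ℂˣ} {X : ℤ × ℤ → W} (h : mulT (linProd l) X = 0)
    (hc : ∀ α ∈ l, ∃ e, IsCoprime (LaurentPolynomial.T 1 - LaurentPolynomial.C (α : ℂ)) e ∧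
      mulT e X = 0) : X = 0 := by
  induction l with
  | nil => rwa [linProd_nil, mulT_one] at h
  | cons α l ih =>
    refine ih ?_ fun β hβ => hc β (List.mem_cons_of_mem _ hβ)
    obtain ⟨e, ⟨u, v, huv⟩, he⟩ := hc α List.mem_cons_self
    rw [← mulT_one (mulT (linProd l) X), ← huv, mulT_add, mulT_mul u, ← mulT_mul _ (linProd l),
      ← linProd_cons, h, mulT_mul v, mulT_comm e, he, map_zero, map_zero, map_zero, add_zero]

variable {G K : Type*} [Group G] [LieRing K] [LieAlgebra ℂ K] {F : InvForm K} {A : FormAct G F}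
  {φ : G →* ℂˣ} {ℓ : ℂ}

theorem FormAct.Equivariant.ncoeff {B : A.KerCoinv φ →ₗ[ℂ] VertexOperator ℂ W}
    (hE : A.Equivariant φ B) (g : G) (a : K) (n : ℤ) :
    (B ((A.restrict φ.ker).toCoinv (A.ρ g a)))[[n]] =
      ((φ g ^ (-n) : ℂˣ) : ℂ) • (B ((A.restrict φ.ker).toCoinv a))[[n]] := by
  ext w
  rw [← A.kerAct_toCoinv, hE, ncoeff_smul, dilate_ncoeff, LinearMap.smul_apply, smul_smul,
    LinearMap.smul_apply, ← Units.val_mul, mul_comm, ← zpow_add_one]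
  congr 3
  ring

/-- The commutator of the fields, localized at the diagonal. -/
theorem IsAffineFields.mulT_jac {K' : Type*} [LieRing K'] [LieAlgebra ℂ K'] {F' : InvForm K'}
    {Φ : Subgroup ℂˣ} {B : K' →ₗ[ℂ] VertexOperator ℂ W} (hB : IsAffineFields F' ℓ Φ B) {x y : K'}
    {N M : ℕ} {G e : ℂ[T;T⁻¹]} (hG : IsCoprime tOne G)
    (hk : KillsAt (tOne ^ N * G) (B x) (B y) 0) (he : G ∣ e) (heM : tOne ^ M ∣ e - 1) (hM : N ≤ M)
    (w : W) (m n : ℤ) : mulT e (jac (B x) (B y) w 0) (m, n) = ((B ⁅x, y⁆)[[m + n]]) w +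
      ((m : ℂ) * (if m + n = 0 then 1 else 0) * (ℓ * F'.form x y)) • w := by
  have hp : ∀ i : ℤ, 0 ≤ i → kerField e (B x) (B y) 0 i = prodN (B x) (B y) i := fun i hi =>
    (prodN_eq ⟨N, G, M, hG, hk, he, heM, by omega⟩).symm
  have h2 : ∀ i : ℤ, 2 ≤ i → kerField e (B x) (B y) 0 i = 0 := fun i hi => by
    rw [hp i (by omega), hB.prod_of_two_le x y i hi]
  have h0 : kerField e (B x) (B y) 0 (0 + ((0 : ℕ) : ℤ)) = B ⁅x, y⁆ :=
    (hp 0 le_rfl).trans (hB.prod_zero x y)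
  have h1 : kerField e (B x) (B y) 0 (0 + ((0 + 1 : ℕ) : ℤ)) = (ℓ * F'.form x y) • idField :=
    (hp 1 zero_le_one).trans (hB.prod_one x y)
  rw [mulT_jac_eq_taylor (hk.of_order_zero (n := N) he le_rfl), taylor_eq_sum h2 w 0 m n (k := 2)
    (by simp), Finset.sum_range_succ', Finset.sum_range_one, h0, h1, ncoeff_smul, idField_ncoeff,
    Ring.choose_zero_right, zero_add, Ring.choose_one_right, add_comm]
  by_cases h : m + n = 0
  · rw [if_pos h, if_pos (by push_cast; omega)]
    simp [smul_smul]
  · rw [if_neg h, if_neg (by push_cast; omega)]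
    simp

/-- Equivariant fields with the relations of the affine Lie algebra of `K / ker φ` satisfy the
commutation relations of the twisted affine Lie algebra: both sides are supported on the lines
`x₁ = α x₂`, they agree near the diagonal, and equivariance moves any of the lines to the
diagonal. -/
theorem IsAffineFields.jac_eq_twistedComm {B : A.KerCoinv φ →ₗ[ℂ] VertexOperator ℂ W}
    (hB : IsAffineFields (A.kerForm φ) ℓ φ.range B) (hE : A.Equivariant φ B) (a b : K) (w : W) :
    jac (B ((A.restrict φ.ker).toCoinv a)) (B ((A.restrict φ.ker).toCoinv b)) w 0 =
      A.twistedComm φ ℓ B a b w := by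
  set X : K → ℤ × ℤ → W := fun a =>
    jac (B ((A.restrict φ.ker).toCoinv a)) (B ((A.restrict φ.ker).toCoinv b)) w 0 -
      A.twistedComm φ ℓ B a b w with hX
  -- `X` is the difference of the two sides; it inherits the equivariance in `a`
  have hscale : ∀ g a, X a = fun n => ((φ g ^ n.1 : ℂˣ) : ℂ) • X (A.ρ g a) n := by
    intro g a
    ext ⟨m, n⟩
    have h1 : A.twistedComm φ ℓ B a b w (m, n) =
        ((φ g ^ m : ℂˣ) : ℂ) • A.twistedComm φ ℓ B (A.ρ g a) b w (m, n) := by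
      rw [FormAct.twistedComm, ← (A.affineAct φ).bracket_act_left g, A.affineAct_mode, map_smul,
        LinearMap.smul_apply, map_smul]
      rfl
    simp only [hX, Pi.sub_apply]
    rw [h1, jac_zero, jac_zero]
    dsimp only
    rw [hE.ncoeff, LinearMap.smul_apply, LinearMap.smul_apply, map_smul, ← smul_sub, smul_sub,
      smul_smul, ← Units.val_mul, ← zpow_add, add_neg_cancel, zpow_zero, Units.val_one, one_smul]
  have hdiag : ∀ a, ∃ e, tOne ∣ e - 1 ∧ mulT e (X a) = 0 := by
    intro a
    obtain ⟨l, hl, hG, hk, hloc⟩ := A.twistedComm_localize φ ℓ B a b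
    obtain ⟨N, G', hG', hk'⟩ := (hB.loc ((A.restrict φ.ker).toCoinv a)
      ((A.restrict φ.ker).toCoinv b)).quasiLocal
    obtain ⟨e, he, heM⟩ := exists_multiplier (hG'.mul_right hG) (N + 2) 1
    rw [pow_one] at he
    refine ⟨e, (dvd_pow_self _ (by omega)).trans heM, ?_⟩
    ext ⟨m, n⟩
    rw [hX, map_sub, Pi.sub_apply, hB.mulT_jac hG' hk' ((dvd_mul_right _ _).trans he) heM (by omega),
      hloc e ((dvd_mul_left _ _).trans he) ((pow_dvd_pow _ (by omega)).trans heM), sub_self]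
    rfl
  refine sub_eq_zero.1 (?_ : X a = 0)
  obtain ⟨l, hl, hG, hk, -⟩ := A.twistedComm_localize φ ℓ B a b
  obtain ⟨l', hl', hk'⟩ := hB.loc ((A.restrict φ.ker).toCoinv a) ((A.restrict φ.ker).toCoinv b)
  refine eq_zero_of_mulT_linProd (l := l' ++ (1 :: 1 :: l)) ?_ fun α hα => ?_
  · rw [linProd_append, hX, map_sub, linProd_cons, linProd_cons, Units.val_one, ← tOne_eq,
      ← mul_assoc tOne, ← pow_two, mulT_mul, mulT_comm, hk' w, map_zero, mulT_mul (linProd l'), hk,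
      map_zero, sub_zero]
  · obtain ⟨g, rfl⟩ : α ∈ φ.range := by
      simp only [List.mem_append, List.mem_cons] at hα
      rcases hα with h | rfl | rfl | h
      exacts [hl' _ h, one_mem _, one_mem _, hl _ h]
    obtain ⟨e, he, h0⟩ := hdiag (A.ρ g a)
    refine ⟨scaleT (φ g)⁻¹ e, isCoprime_scaleT he, ?_⟩
    ext ⟨m, n⟩
    rw [hscale g a, mulT_scaleT, h0]
    exact smul_zero _

/-- The fields of a restricted module for the twisted affine Lie algebra. -/
noncomputable def FormAct.IsRestrictedOfLevel.field
    {π : A.TwistedAffine φ →ₗ⁅ℂ⁆ Module.End ℂ W} (h : A.IsRestrictedOfLevel φ ℓ π) :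
    K →ₗ[ℂ] VertexOperator ℂ W where
  toFun a := ofModes (fun n => π (A.twistedMode φ n a)) (h.restricted a)
  map_add' a b := ext_ncoeff fun n w => by
    rw [ncoeff_add, ofModes_ncoeff, ofModes_ncoeff, ofModes_ncoeff]
    simp only [FormAct.twistedMode, map_add, LinearMap.add_apply]
  map_smul' c a := ext_ncoeff fun n w => by
    rw [RingHom.id_apply, ncoeff_smul, ofModes_ncoeff, ofModes_ncoeff]
    simp only [FormAct.twistedMode, map_smul, LinearMap.smul_apply]

theorem FormAct.IsRestrictedOfLevel.field_ncoeff {π : A.TwistedAffine φ →ₗ⁅ℂ⁆ Module.End ℂ W}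
    (h : A.IsRestrictedOfLevel φ ℓ π) (a : K) (n : ℤ) :
    (h.field a)[[n]] = π (A.twistedMode φ n a) := ofModes_ncoeff _ _ _

theorem FormAct.twistedMode_act (g : G) (a : K) (n : ℤ) :
    A.twistedMode φ n (A.ρ g a) = ((φ g ^ (-n) : ℂˣ) : ℂ) • A.twistedMode φ n a := by
  have h := (A.affineAct φ).toCoinv_act g (Affine.mode F n a)
  rw [A.affineAct_mode, map_smul] at h
  rw [FormAct.twistedMode, FormAct.twistedMode, ← h, smul_smul, ← Units.val_mul, ← zpow_add,
    neg_add_cancel, zpow_zero, Units.val_one, one_smul]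

theorem FormAct.IsRestrictedOfLevel.field_act {π : A.TwistedAffine φ →ₗ⁅ℂ⁆ Module.End ℂ W}
    (h : A.IsRestrictedOfLevel φ ℓ π) (g : G) (a : K) :
    h.field (A.ρ g a) = (φ g : ℂ) • dilate (φ g) (h.field a) := ext_ncoeff fun n w => by
  rw [ncoeff_smul, dilate_ncoeff, LinearMap.smul_apply, h.field_ncoeff, h.field_ncoeff,
    FormAct.twistedMode_act, map_smul, LinearMap.smul_apply, smul_smul, ← Units.val_mul,
    ← zpow_one_add]
  congr 3
  ring

/-- The fields of a restricted module for the twisted affine Lie algebra depend only on classes in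
`K / ker φ`. -/
noncomputable def FormAct.IsRestrictedOfLevel.barField
    {π : A.TwistedAffine φ →ₗ⁅ℂ⁆ Module.End ℂ W} (h : A.IsRestrictedOfLevel φ ℓ π) :
    A.KerCoinv φ →ₗ[ℂ] VertexOperator ℂ W :=
  (A.restrict φ.ker).coinvLift h.field fun u hu => by
    induction hu using Submodule.span_induction with
    | mem x hx =>
      obtain ⟨g, u, rfl⟩ := hx
      have hg : φ g = 1 := g.2
      have := h.field_act (g : G) u
      rw [hg, Units.val_one, one_smul] at this
      rw [map_sub, sub_eq_zero]
      refine this.trans (ext_ncoeff fun n w => ?_)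
      rw [dilate_ncoeff, one_zpow, Units.val_one, one_smul]
    | zero => exact map_zero _
    | add x y _ _ hx hy => rw [map_add, hx, hy, add_zero]
    | smul c x _ hx => rw [map_smul, hx, smul_zero]

variable {π : A.TwistedAffine φ →ₗ⁅ℂ⁆ Module.End ℂ W}

theorem FormAct.IsRestrictedOfLevel.barField_toCoinv (h : A.IsRestrictedOfLevel φ ℓ π) (a : K) :
    h.barField ((A.restrict φ.ker).toCoinv a) = h.field a := rfl

theorem FormAct.IsRestrictedOfLevel.equivariant (h : A.IsRestrictedOfLevel φ ℓ π) :
    A.Equivariant φ h.barField := fun g x => by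
  obtain ⟨a, rfl⟩ := LieAct.toCoinv_surjective _ x
  rw [A.kerAct_toCoinv, h.barField_toCoinv, h.barField_toCoinv, h.field_act]

theorem FormAct.IsRestrictedOfLevel.twistedLift_eq (h : A.IsRestrictedOfLevel φ ℓ π)
    {B : A.KerCoinv φ →ₗ[ℂ] VertexOperator ℂ W}
    (hB : ∀ a n, π (A.twistedMode φ n a) = (B ((A.restrict φ.ker).toCoinv a))[[n]]) :
    A.twistedLift φ ℓ B = (π : A.TwistedAffine φ →ₗ[ℂ] Module.End ℂ W) ∘ₗ
      (A.affineAct φ).toCoinv := by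
  refine Affine.hom_ext (fun n a => ?_) ?_
  · rw [A.twistedLift_mode, ← hB]; rfl
  · rw [A.twistedLift_central]
    ext w
    exact (h.level w).symm

/-- Localized at the diagonal, the commutation relations of the twisted affine Lie algebra are
those of the affine Lie algebra of `K / ker φ`. -/
theorem FormAct.IsRestrictedOfLevel.isAffineFields (h : A.IsRestrictedOfLevel φ ℓ π) :
    IsAffineFields (A.kerForm φ) ℓ φ.range h.barField := by
  refine FormAct.isAffineFields_of_comm fun a b w => ?_
  ext ⟨m, n⟩
  rw [jac_zero, FormAct.twistedComm, h.twistedLift_eq (B := h.barField)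
    (fun a n => by rw [h.barField_toCoinv, h.field_ncoeff]), LinearMap.comp_apply,
    ← LieAct.toCoinv_lie]
  change _ = π ⁅A.twistedMode φ m a, A.twistedMode φ n b⁆ w
  rw [LieHom.map_lie, LieRing.of_associative_ring_bracket, h.barField_toCoinv, h.barField_toCoinv,
    h.field_ncoeff, h.field_ncoeff]
  rfl

variable (A φ ℓ)

/-- Equivariant fields with the relations of the affine Lie algebra of `K / ker φ` give a module
for the twisted affine Lie algebra. -/
noncomputable def FormAct.twistedRep (B : A.KerCoinv φ →ₗ[ℂ] VertexOperator ℂ W)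
    (hB : IsAffineFields (A.kerForm φ) ℓ φ.range B) (hE : A.Equivariant φ B) :
    A.TwistedAffine φ →ₗ⁅ℂ⁆ Module.End ℂ W where
  toLinearMap := (A.affineAct φ).coinvLift (A.twistedLift φ ℓ B) fun u hu => by
    induction hu using Submodule.span_induction with
    | mem x hx =>
      obtain ⟨g, u, rfl⟩ := hx
      rw [map_sub, sub_eq_zero]
      suffices H : A.twistedLift φ ℓ B ∘ₗ (A.affineAct φ).ρ g = A.twistedLift φ ℓ B from
        congr($H u)
      refine Affine.hom_ext (fun n a => ?_) ?_
      · rw [LinearMap.comp_apply, A.affineAct_mode, map_smul, A.twistedLift_mode, A.twistedLift_mode,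
          hE.ncoeff, smul_smul, ← Units.val_mul, ← zpow_add, add_neg_cancel, zpow_zero,
          Units.val_one, one_smul]
      · rw [LinearMap.comp_apply, A.affineAct_central]
    | zero => exact map_zero _
    | add x y _ _ hx hy => rw [map_add, hx, hy, add_zero]
    | smul c x _ hx => rw [map_smul, hx, smul_zero]
  map_lie' {x y} := by
    obtain ⟨u, rfl⟩ := LieAct.toCoinv_surjective _ x
    obtain ⟨v, rfl⟩ := LieAct.toCoinv_surjective _ y
    change A.twistedLift φ ℓ B ((A.affineAct φ).bracket u v) =
      ⁅A.twistedLift φ ℓ B u, A.twistedLift φ ℓ B v⁆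
    have hc : ∀ z : Module.End ℂ W, ⁅A.twistedLift φ ℓ B (Affine.central F), z⁆ = 0 := fun z => by
      rw [A.twistedLift_central, LieRing.of_associative_ring_bracket, smul_mul_assoc,
        mul_smul_comm, one_mul, mul_one, sub_self]
    refine Affine.induction (p := fun u => A.twistedLift φ ℓ B ((A.affineAct φ).bracket u v) =
      ⁅A.twistedLift φ ℓ B u, A.twistedLift φ ℓ B v⁆) (fun m a => ?_) ?_ ?_
      (fun x x' hx hx' => ?_) (fun c x hx => ?_) u
    · refine Affine.induction (p := fun v => A.twistedLift φ ℓ B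
        ((A.affineAct φ).bracket (Affine.mode F m a) v) =
        ⁅A.twistedLift φ ℓ B (Affine.mode F m a), A.twistedLift φ ℓ B v⁆) (fun n b => ?_) ?_ ?_
        (fun y y' hy hy' => ?_) (fun c y hy => ?_) v
      · ext w
        have := congrFun (hB.jac_eq_twistedComm hE a b w) (m, n)
        rw [jac_zero] at this
        rw [A.twistedLift_mode, A.twistedLift_mode, LieRing.of_associative_ring_bracket]
        exact this.symm
      · rw [LieAct.bracket_apply, ← lie_skew, hc, neg_zero, finsum_eq_zero_of_forall_eq_zero,
          map_zero]
        exact fun g => Affine.lie_central F _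
      · rw [map_zero, map_zero, lie_zero]
      · rw [map_add, map_add, map_add, lie_add, hy, hy']
      · rw [map_smul, map_smul, map_smul, lie_smul, hy]
    · rw [LieAct.bracket_apply, hc, finsum_eq_zero_of_forall_eq_zero, map_zero]
      exact fun g => by rw [A.affineAct_central, Affine.central_lie]
    · rw [map_zero, map_zero, LinearMap.zero_apply, map_zero, zero_lie]
    · rw [map_add, map_add, LinearMap.add_apply, map_add, add_lie, hx, hx']
    · rw [map_smul, map_smul, LinearMap.smul_apply, map_smul, smul_lie, hx]

variable {A φ ℓ}

theorem FormAct.twistedRep_mode {B : A.KerCoinv φ →ₗ[ℂ] VertexOperator ℂ W}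
    (hB : IsAffineFields (A.kerForm φ) ℓ φ.range B) (hE : A.Equivariant φ B) (a : K) (n : ℤ) :
    A.twistedRep φ ℓ B hB hE (A.twistedMode φ n a) = (B ((A.restrict φ.ker).toCoinv a))[[n]] :=
  A.twistedLift_mode φ ℓ B n a

theorem FormAct.isRestrictedOfLevel_twistedRep {B : A.KerCoinv φ →ₗ[ℂ] VertexOperator ℂ W}
    (hB : IsAffineFields (A.kerForm φ) ℓ φ.range B) (hE : A.Equivariant φ B) :
    A.IsRestrictedOfLevel φ ℓ (A.twistedRep φ ℓ B hB hE) where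
  restricted a w := by
    obtain ⟨N, hN⟩ := (B ((A.restrict φ.ker).toCoinv a)).exists_trunc w
    exact ⟨N, fun n hn => by rw [FormAct.twistedRep_mode, hN n hn]⟩
  level w := congr($(A.twistedLift_central φ ℓ B) w)

/-- The embedding of the Lie algebra in the vacuum module, as a linear map. -/
noncomputable def Vacuum.stateLin (F : InvForm K) (ℓ : ℂ) : K →ₗ[ℂ] Vacuum F ℓ :=
  (Vacuum.modeLin F ℓ (-1)).flip (Vacuum.one F ℓ)

theorem Vacuum.stateLin_apply (a : K) : Vacuum.stateLin F ℓ a = Vacuum.state F ℓ a := rfl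

theorem Vacuum.modeAct_state (n : ℤ) (hn : 0 ≤ n) (a b : K) :
    Vacuum.modeAct F ℓ n a (Vacuum.state F ℓ b) = Vacuum.modeAct F ℓ (n - 1) ⁅a, b⁆ (one F ℓ) +
      ((n : ℂ) * (if n - 1 = 0 then 1 else 0) * F.form a b * ℓ) • one F ℓ := by
  have h := Vacuum.modeAct_comm F ℓ n (-1) a b (one F ℓ)
  have hz : Vacuum.modeAct F ℓ (-1) b 0 = 0 := map_zero (modeLin F ℓ (-1) b)
  rwa [modeAct_one F ℓ n hn, hz, sub_zero] at h

variable {𝒱 : VertexAlgebra (Vacuum (A.kerForm φ) ℓ)}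
  {YW : Vacuum (A.kerForm φ) ℓ →ₗ[ℂ] VertexOperator ℂ W}

/-- In a quasimodule, the fields of the generators have the products of the affine vertex algebra,
because `Y_W` carries `uₙ v` to the product of the fields of `u` and `v`. -/
theorem VertexAlgebra.IsGroupQuasimodule.isAffineFields
    (h𝒱 : IsAffineVertexAlgebra (A.kerForm φ) ℓ 𝒱)
    (h : 𝒱.IsGroupQuasimodule (A.vacuumAct φ ℓ) φ YW) :
    IsAffineFields (A.kerForm φ) ℓ φ.range (YW ∘ₗ Vacuum.stateLin (A.kerForm φ) ℓ) := by
  have key : ∀ x y (n : ℤ), 0 ≤ n → prodN (YW (Vacuum.state _ ℓ x)) (YW (Vacuum.state _ ℓ y)) n =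
      YW (Vacuum.modeAct (A.kerForm φ) ℓ (n - 1) ⁅x, y⁆ (Vacuum.one _ ℓ)) +
      ((n : ℂ) * (if n - 1 = 0 then 1 else 0) * (A.kerForm φ).form x y * ℓ) •
        YW (Vacuum.one _ ℓ) := fun x y n hn => by
    rw [← h.map_prodN, h𝒱.Y_state, Vacuum.modeAct_state n hn, map_add, map_smul]
  refine ⟨fun x y => h.localOn _ _, fun x y => ?_, fun x y => ?_, fun x y n hn => ?_⟩
  · refine (key x y 0 le_rfl).trans ?_
    simp [Vacuum.stateLin_apply, Vacuum.state]
  · refine (key x y 1 zero_le_one).trans ?_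
    have hid : YW (Vacuum.one _ ℓ) = idField := ext_ncoeff fun n w => by
      rw [← h𝒱.vac_eq, h.Y_vac, idField_ncoeff]
    rw [Vacuum.modeAct_one _ _ _ (by norm_num), map_zero, hid, zero_add]
    congr 1
    simp [mul_comm]
  · refine (key x y n (by omega)).trans ?_
    rw [Vacuum.modeAct_one _ _ _ (by omega), map_zero, if_neg (by omega)]
    simp

/-- The generators have weight `1`, so that `R_g` acts on them as `φ(g)⁻¹ g`. -/
theorem VertexAlgebra.IsGroupQuasimodule.equivariant_state
    (h : 𝒱.IsGroupQuasimodule (A.vacuumAct φ ℓ) φ YW) :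
    A.Equivariant φ (YW ∘ₗ Vacuum.stateLin (A.kerForm φ) ℓ) := fun g x => by
  have h1 : A.vacuumAct φ ℓ g (Vacuum.state _ ℓ x) =
      ((φ g ^ (-1 : ℤ) : ℂˣ) : ℂ) • Vacuum.state _ ℓ (A.kerAct φ g x) := by
    rw [Vacuum.state, A.vacuumAct_modeAct, A.vacuumAct_one]; rfl
  refine ext_ncoeff fun n w => ?_
  have h2 := h.equivariant g (Vacuum.state _ ℓ x) n
  rw [h1] at h2
  have h3 := congr($h2 w)
  rw [map_smul, ncoeff_smul] at h3
  rw [ncoeff_smul, dilate_ncoeff, LinearMap.comp_apply, LinearMap.comp_apply, Vacuum.stateLin_apply,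
    Vacuum.stateLin_apply, ← h3, smul_smul, ← Units.val_mul, zpow_neg_one, mul_inv_cancel,
    Units.val_one, one_smul]

theorem FormAct.existsUnique_quasimodule (h𝒱 : IsAffineVertexAlgebra (A.kerForm φ) ℓ 𝒱)
    (hπ : A.IsRestrictedOfLevel φ ℓ π) :
    ∃! YW : Vacuum (A.kerForm φ) ℓ →ₗ[ℂ] VertexOperator ℂ W,
      𝒱.IsGroupQuasimodule (A.vacuumAct φ ℓ) φ YW ∧
      ∀ (a : K) (n : ℤ), (YW (A.barState φ ℓ a))[[n]] = π (A.twistedMode φ n a) := by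
  refine ⟨hπ.isAffineFields.fieldMap,
    ⟨hπ.isAffineFields.isGroupQuasimodule h𝒱 hπ.equivariant, fun a n => ?_⟩, ?_⟩
  · rw [FormAct.barState, IsAffineFields.fieldMap_state, hπ.barField_toCoinv, hπ.field_ncoeff]
  · rintro YW ⟨h1, h2⟩
    refine VertexAlgebra.IsGroupQuasimodule.ext_state A φ ℓ h𝒱 h1
      (hπ.isAffineFields.isGroupQuasimodule h𝒱 hπ.equivariant) fun x => ?_
    obtain ⟨a, rfl⟩ := LieAct.toCoinv_surjective _ x
    refine ext_ncoeff fun n w => ?_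
    rw [IsAffineFields.fieldMap_state, hπ.barField_toCoinv, hπ.field_ncoeff, ← h2]
    rfl

theorem FormAct.existsUnique_twistedModule (h𝒱 : IsAffineVertexAlgebra (A.kerForm φ) ℓ 𝒱)
    (h : 𝒱.IsGroupQuasimodule (A.vacuumAct φ ℓ) φ YW) :
    ∃! π : A.TwistedAffine φ →ₗ⁅ℂ⁆ Module.End ℂ W, A.IsRestrictedOfLevel φ ℓ π ∧
      ∀ (a : K) (n : ℤ), π (A.twistedMode φ n a) = (YW (A.barState φ ℓ a))[[n]] := by
  refine ⟨A.twistedRep φ ℓ _ (h.isAffineFields h𝒱) h.equivariant_state,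
    ⟨FormAct.isRestrictedOfLevel_twistedRep _ _, fun a n => FormAct.twistedRep_mode _ _ a n⟩, ?_⟩
  rintro π ⟨h1, h2⟩
  refine LieHom.ext fun x => ?_
  obtain ⟨u, rfl⟩ := LieAct.toCoinv_surjective _ x
  have := h1.twistedLift_eq (B := YW ∘ₗ Vacuum.stateLin (A.kerForm φ) ℓ) h2
  exact congr($this u).symm

end Correspondence

theorem theorem4p9 {𝔤 : Type*} [LieRing 𝔤] [LieAlgebra ℂ 𝔤] (F : InvForm 𝔤)
    (Γ : Subgroup F.aut)
    (hΓ : ∀ a b : 𝔤, {g : Γ | ⁅(g : 𝔤 ≃ₗ[ℂ] 𝔤) a, b⁆ ≠ 0}.Finite ∧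
      {g : Γ | F.form ((g : 𝔤 ≃ₗ[ℂ] 𝔤) a) b ≠ 0}.Finite)
    (φ : Γ →* ℂˣ) (ℓ : ℂ) :
    (∃! 𝒱, IsAffineVertexAlgebra ((F.subgroupAct Γ hΓ).kerForm φ) ℓ 𝒱) ∧
    ∀ 𝒱, IsAffineVertexAlgebra ((F.subgroupAct Γ hΓ).kerForm φ) ℓ 𝒱 →
      𝒱.IsGroupVertexAlgebra ((F.subgroupAct Γ hΓ).vacuumAct φ ℓ) φ ∧
      ∀ (W : Type*) [AddCommGroup W] [Module ℂ W],
        (∀ π : (F.subgroupAct Γ hΓ).TwistedAffine φ →ₗ⁅ℂ⁆ Module.End ℂ W,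
          (F.subgroupAct Γ hΓ).IsRestrictedOfLevel φ ℓ π →
          ∃! YW : Vacuum ((F.subgroupAct Γ hΓ).kerForm φ) ℓ →ₗ[ℂ] VertexOperator ℂ W,
            𝒱.IsGroupQuasimodule ((F.subgroupAct Γ hΓ).vacuumAct φ ℓ) φ YW ∧
            ∀ (a : 𝔤) (n : ℤ), (YW ((F.subgroupAct Γ hΓ).barState φ ℓ a))[[n]] =
              π ((F.subgroupAct Γ hΓ).twistedMode φ n a)) ∧
        (∀ YW : Vacuum ((F.subgroupAct Γ hΓ).kerForm φ) ℓ →ₗ[ℂ] VertexOperator ℂ W,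
          𝒱.IsGroupQuasimodule ((F.subgroupAct Γ hΓ).vacuumAct φ ℓ) φ YW →
          ∃! π : (F.subgroupAct Γ hΓ).TwistedAffine φ →ₗ⁅ℂ⁆ Module.End ℂ W,
            (F.subgroupAct Γ hΓ).IsRestrictedOfLevel φ ℓ π ∧
            ∀ (a : 𝔤) (n : ℤ), π ((F.subgroupAct Γ hΓ).twistedMode φ n a) =
              (YW ((F.subgroupAct Γ hΓ).barState φ ℓ a))[[n]]) := by
  exact ⟨⟨Vacuum.vertexAlgebra _ ℓ, Vacuum.isAffineVertexAlgebra _ ℓ, fun 𝒱 h => h.eq⟩,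
    fun 𝒱 h => ⟨FormAct.isGroupVertexAlgebra _ φ ℓ h, fun W _ _ =>
      ⟨fun π hπ => FormAct.existsUnique_quasimodule h hπ,
        fun YW hYW => FormAct.existsUnique_twistedModule h hYW⟩⟩⟩
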